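/- **Joins.** A tuple over a finite set $U$ of attributes is a function from $U$ to a countably infinite set $\mathbf{dom}$ of values; a relation $R$ is a finite set of tuples over one set $\mathrm{scheme}(R)$ of attributes. A join query $\mathcal Q$ is a finite set of relations; it is *simple* if distinct relations have distinct schemes, and *binary* if every scheme has exactly two attributes. Put $\mathrm{attset}(\mathcal Q)=\bigcup_{R\in\mathcal Q}\mathrm{scheme}(R)$; the result $\mathrm{Join}(\mathcal Q)$ is the set of all tuples over $\mathrm{attset}(\mathcal Q)$ whose projection on $\mathrm{scheme}(R)$ lies in $R$ for every $R\in\mathcal Q$. The input size is $m=\sum_{R\in\mathcal Q}|R|$. The fractional edge covering number $\rho$ of $\mathcal Q$ is the smallest value of $\sum_{e}W(e)$ over all functions $W$ from $\{\mathrm{scheme}(R): R\in\mathcal Q\}$ to $[0,1]$ with $\sum_{e\ni X}W(e)\ge 1$ for every $X\in\mathrm{attset}(\mathcal Q)$. **MPC model.** There are $p$ machines. The input tuples are partitioned among them in an arbitrary way such that each machine initially stores at most $B\,m/p$ tuples, where $B$ is a constant. The machines share a random seed drawn before the input arrives. In each round every machine sends to every machine a message, i.e. a list of words, that is an arbitrary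 function of the seed and of its local storage (its initial tuples and everything it received in earlier rounds). A word is either a value of $\mathbf{dom}$ that the sender stores, or an integer of $O(\log m)$ bits. The load of a round is the largest number of words received by a machine in this round, and the load of the algorithm is the sum of the loads of its rounds. After the last round each machine produces a set of tuples, computed from the seed and its local storage and using only values that it stores; the query is answered if the union of these sets is exactly $\mathrm{Join}(\mathcal Q)$. **Theorem.** For every $k$ there are constants $r,w,d$, depending only on $k$, such that for all real constants $c,B>0$ there is a constant $C>0$, depending only on $k,c,B$, with the following property. For every set of schemes using at most $k$ attributes in total and every $p\ge1$ there is a randomized MPC algorithm for $p$ machines with at most $r$ rounds such that, for every simple binary join $\mathcal Q$ with this set of schemes and with input size $m\ge p^3$, and for every initial distribution of its tuples with at most $B\,m/p$ tuples per machine: * for every value of the seed, the algorithm answers $\mathcal Q$ and all integers it sends are at most $m^w$; * with probability at least $1-1/p^{c}$, the load is at most $$C\,(1+\log m+\log p)^{d}\cdot\frac{m}{p^{1/\rho}},$$ where $\rho$ is the fractional edge covering number of $\mathcal Q$. In short, a simple binary join with $m\ge p^3$ can be answered in a constant number of rounds with load $\tilde O(m/p^{1/\rho})$, subject to a failure probability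 of at most $1/p^c$ for an arbitrarily large constant $c$. -/

import Mathlib

open MeasureTheory

namespace MPCJoin

/-! ### Relations and join queries -/

/-- A tuple over a finite set of attributes, bundled with that set (its scheme). -/
abbrev Tuple (att dom : Type) : Type := Σ U : Finset att, (U → dom)

/-- A (finite) relation: a finite set of tuples over one set of attributes. -/
structure Relation (att dom : Type) where
  scheme : Finset att
  tuples : Finset (scheme → dom)

/-- A join query is a finite set of relations. -/
abbrev JoinQuery (att dom : Type) : Type := Finset (Relation att dom)

namespace JoinQuery

variable {att dom : Type}

/-- No two distinct relations of the query have the same scheme. -/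
def IsSimple (Q : JoinQuery att dom) : Prop :=
  ∀ R ∈ Q, ∀ S ∈ Q, R.scheme = S.scheme → R = S

/-- Every relation of the query has exactly two attributes. -/
def IsBinary (Q : JoinQuery att dom) : Prop :=
  ∀ R ∈ Q, R.scheme.card = 2

/-- The input size `m`: the total number of tuples in the input relations. -/
def inputSize (Q : JoinQuery att dom) : ℕ :=
  ∑ R ∈ Q, R.tuples.card

/-- All input tuples of the query, each labelled with its scheme. In a simple query the scheme
identifies the relation that the tuple comes from. -/
def inputTuples (Q : JoinQuery att dom) : Set (Tuple att dom) :=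
  {t | ∃ R ∈ Q, ∃ u ∈ R.tuples, t = ⟨R.scheme, u⟩}

variable [DecidableEq att]

/-- The set of the schemes of the relations, i.e. the edge set of the hypergraph of the query. -/
def schemes (Q : JoinQuery att dom) : Finset (Finset att) :=
  Q.image Relation.scheme

/-- The set of all attributes of the query, i.e. the vertex set of its hypergraph. -/
def attset (Q : JoinQuery att dom) : Finset att :=
  Q.biUnion Relation.scheme

theorem scheme_subset_attset {Q : JoinQuery att dom} {R : Relation att dom} (hR : R ∈ Q) :
    R.scheme ⊆ Q.attset :=
  Finset.subset_biUnion_of_mem Relation.scheme hR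

/-- The result of the join: all tuples over `attset` whose projection on the scheme of each
relation `R` of the query belongs to `R`. -/
def join (Q : JoinQuery att dom) : Set (Q.attset → dom) :=
  {u | ∀ (R : Relation att dom) (hR : R ∈ Q),
    (fun X : R.scheme => u ⟨X.1, scheme_subset_attset hR X.2⟩) ∈ R.tuples}

/-- The result of the join, as a set of tuples bundled with their scheme. -/
def joinTuples (Q : JoinQuery att dom) : Set (Tuple att dom) :=
  {t | ∃ u ∈ Q.join, t = ⟨Q.attset, u⟩}

end JoinQuery

/-! ### Fractional edge coverings -/

section Hypergraph

variable {att : Type} [DecidableEq att]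

/-- `W` is a fractional edge covering of the hypergraph with edge set `E` and vertex set `⋃ E`:
the weights of the edges lie in `[0, 1]`, and the edges incident to any vertex have total weight
at least `1`. -/
def IsFractionalEdgeCovering (E : Finset (Finset att)) (W : Finset att → ℝ) : Prop :=
  (∀ e ∈ E, 0 ≤ W e ∧ W e ≤ 1) ∧
    ∀ X ∈ E.biUnion id, 1 ≤ ∑ e ∈ E with X ∈ e, W e

/-- The fractional edge covering number: the smallest total weight of a fractional edge covering.
(There is a covering, the constant `1`, and total weights are nonnegative.) -/
noncomputable def fractionalEdgeCoveringNumber (E : Finset (Finset att)) : ℝ :=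
  sInf {s | ∃ W : Finset att → ℝ, IsFractionalEdgeCovering E W ∧ s = ∑ e ∈ E, W e}

end Hypergraph

/-- The fractional edge covering number `ρ` of a join query. -/
noncomputable def JoinQuery.rho {att dom : Type} [DecidableEq att] (Q : JoinQuery att dom) : ℝ :=
  fractionalEdgeCoveringNumber Q.schemes

/-! ### The massively parallel computation (MPC) model -/

/-- A machine word holds one value of the domain or one integer. The size of the integers is
limited by `MPCAlgorithm.WordsBounded` below. -/
inductive Word (dom : Type) : Type
  | val (x : dom) : Word dom
  | num (n : ℕ) : Word dom

/-- What one of `p` machines receives in one round: a message, i.e. a list of words, from each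
machine. The empty list means that no message was sent. -/
abbrev Inbox (dom : Type) (p : ℕ) : Type := Fin p → List (Word dom)

/-- The domain values present in the storage of a machine that was given the set `I` of tuples at
the beginning and has received the messages in `h` (one inbox per completed round). -/
def storedValues {att dom : Type} {p : ℕ} (I : Set (Tuple att dom)) (h : List (Inbox dom p)) :
    Set dom :=
  {x | (∃ t ∈ I, ∃ X : t.1, t.2 X = x) ∨ ∃ b ∈ h, ∃ j : Fin p, Word.val x ∈ b j}

/-- A randomized algorithm for `p` machines in the MPC model. The machines agree on a random seed
before the input arrives. Local computation is free: the messages that a machine sends in a round,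
and the tuples it produces at the end, are arbitrary functions of the seed and of the local storage
of that machine, which holds its initial tuples and all it has received in earlier rounds. Values
of the domain are atomic: a machine can send or produce only values that it stores. -/
structure MPCAlgorithm (att dom : Type) (p : ℕ) where
  /-- the space of random seeds -/
  Seed : Type
  [seedSpace : MeasurableSpace Seed]
  /-- the distribution of the seed -/
  law : Measure Seed
  [law_prob : IsProbabilityMeasure law]
  /-- the number of rounds -/
  rounds : ℕ
  /-- `send ω i I h j`: the message that machine `i` sends to machine `j` in the next round, if the
  seed is `ω`, the initial tuples of `i` are `I`, and `i` has received the inboxes `h` so far -/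
  send : Seed → Fin p → Set (Tuple att dom) → List (Inbox dom p) → Fin p → List (Word dom)
  /-- `output ω i I h`: the tuples that machine `i` produces after the last round -/
  output : Seed → Fin p → Set (Tuple att dom) → List (Inbox dom p) → Set (Tuple att dom)
  send_stored : ∀ ω i I h j x, Word.val x ∈ send ω i I h j → x ∈ storedValues I h
  output_stored : ∀ ω i I h, ∀ t ∈ output ω i I h, ∀ X : t.1, t.2 X ∈ storedValues I h

attribute [instance] MPCAlgorithm.seedSpace MPCAlgorithm.law_prob

namespace MPCAlgorithm

variable {att dom : Type} {p : ℕ} (A : MPCAlgorithm att dom p)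

/-- `A.history D ω t i`: the inboxes received by machine `i` in the first `t` rounds, when machine
`j` is initially given the tuples `D j` and the seed is `ω`. -/
def history (D : Fin p → Set (Tuple att dom)) (ω : A.Seed) : ℕ → Fin p → List (Inbox dom p)
  | 0, _ => []
  | t + 1, i =>
      history D ω t i ++ [fun j => A.send ω j (D j) (history D ω t j) i]

/-- The message sent from machine `j` to machine `i` in round `t` (rounds count from `0`). -/
def message (D : Fin p → Set (Tuple att dom)) (ω : A.Seed) (t : ℕ) (j i : Fin p) :
    List (Word dom) :=
  A.send ω j (D j) (A.history D ω t j) i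

/-- The load of round `t`: the largest number of words received by a machine in that round. -/
def roundLoad (D : Fin p → Set (Tuple att dom)) (ω : A.Seed) (t : ℕ) : ℕ :=
  Finset.univ.sup fun i : Fin p => ∑ j : Fin p, (A.message D ω t j i).length

/-- The load of the algorithm: the total load of all rounds. -/
def load (D : Fin p → Set (Tuple att dom)) (ω : A.Seed) : ℕ :=
  ∑ t ∈ Finset.range A.rounds, A.roundLoad D ω t

/-- The tuples produced by the machines after the last round. -/
def produced (D : Fin p → Set (Tuple att dom)) (ω : A.Seed) : Set (Tuple att dom) :=
  {t | ∃ i : Fin p, t ∈ A.output ω i (D i) (A.history D ω A.rounds i)}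

/-- All integers sent during the run are at most `N`. -/
def WordsBounded (D : Fin p → Set (Tuple att dom)) (ω : A.Seed) (N : ℕ) : Prop :=
  ∀ t < A.rounds, ∀ i j : Fin p, ∀ n : ℕ, Word.num n ∈ A.message D ω t j i → n ≤ N

end MPCAlgorithm

/-- The initial storage: the input tuples of the query are partitioned among the machines,
the tuple `t` being stored on machine `place t`. -/
def initialStorage {att dom : Type} {p : ℕ} (Q : JoinQuery att dom)
    (place : Tuple att dom → Fin p) (i : Fin p) : Set (Tuple att dom) :=
  {t | t ∈ Q.inputTuples ∧ place t = i}

/-- The input is evenly distributed: each machine stores at most `B * m / p` input tuples. -/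
def EvenlyDistributed {att dom : Type} {p : ℕ} (B : ℝ) (Q : JoinQuery att dom)
    (place : Tuple att dom → Fin p) : Prop :=
  ∀ i : Fin p, ((initialStorage Q place i).ncard : ℝ) ≤ B * Q.inputSize / p

end MPCJoin

open MPCJoin

/-! Put `λ = p ^ (1 / (2ρ))`, so that the target load is `m / λ²` up to logarithms. A value is heavy
if, in some relation, at least a proportion `1 / λ` of the input contains it; an attribute has
`O(λ)` heavy values. The result is split according to the set `U` of attributes that take heavy
values and according to these values `η`. For fixed `(U, η)` there are two kinds of attributes
outside `U`. An attribute with a neighbour outside `U` has its light values hashed into about `λ`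
buckets; since light values have degree at most `m / λ`, a pair of buckets receives about `m / λ²`
tuples of a relation. An isolated attribute `X`, with all neighbours in `U`, can only take values
adjacent to `η Z`, where `Z ∈ U` is a neighbour chosen as its host; these values are cut into pieces
of about `m / λ²`. A cell is a choice of `U`, `η` and one class per remaining attribute, and it can
be evaluated by one machine that receives about `m / λ²` words.

It remains to see that there are only `O(p)` cells. If `f ≥ 1` isolated attributes share the host
`Z`, the sum over heavy `z` of the products of their numbers of pieces is `O(λ ^ (2f))`, because the
degrees in a relation add up to at most the input size. Every other attribute contributes `O(λ)`.
With `I` the isolated attributes, the total is `O(λ ^ (|V| + |I| - |host(I)|))`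
(`sum_prod_width_le`). A deficiency version of Hall's theorem chooses hosts with `|I| - |host(I)|`
at most the largest `|S| - |N(S)|` for `S ⊆ I` (`exists_host`), and `|V| + |S| - |N(S)| ≤ 2ρ` by
weak duality applied to the vertex weights `(1 + 1_S - 1_{N(S)}) / 2` (`card_add_card_le_sum`).
Hence there are `O(λ ^ (2ρ)) = O(p)` cells (`card_cells_le`), that is `O(1)` per machine.

Five rounds suffice. Hash values name a home machine for each value; homes collect degrees, heavy
values are broadcast, and the heavy neighbours of each value reach its home and then the machines
that hold its tuples, which can then tell to which cells a tuple belongs. The answer is correct for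
every seed; randomness affects only the load. An exponential moment bound for bucket sizes
(`measureReal_bucket_le`, `measureReal_bucket_pair_le`) and a union bound show that all buckets
exceed their means by at most logarithmic factors with high probability (`not_goodSeed_le`).

Messages are first defined from the whole instance. That they are computable locally is proved
afterwards: two instances that look the same to a machine make it send and output the same
(`SameView.records_eq`, `SameView.output_eq`), and `Transcript.algorithm` turns this into an
algorithm. -/

namespace MPCJoin

/-! ### Algorithms from transcripts -/

section Transcript

variable {att dom Inst Seed : Type} {p : ℕ}

/-- The inboxes that machine `i` receives in the first `t` rounds of a transcript. -/
def transcriptHistory (msg : Inst → Seed → ℕ → Fin p → Fin p → List (Word dom))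
    (q : Inst) (ω : Seed) (t : ℕ) (i : Fin p) : List (Inbox dom p) :=
  (List.range t).map fun t' j => msg q ω t' j i

/-- A description of the messages and the output of an algorithm on each instance of a problem,
such that messages and output depend only on the seed and on what the machine has seen. -/
structure Transcript (Inst att dom Seed : Type) (p : ℕ) where
  init : Inst → Fin p → Set (Tuple att dom)
  rounds : ℕ
  msg : Inst → Seed → ℕ → Fin p → Fin p → List (Word dom)
  out : Inst → Seed → Fin p → Set (Tuple att dom)
  msg_local : ∀ q q' ω t j, t < rounds → init q j = init q' j →
    (∀ t' < t, ∀ j', msg q ω t' j' j = msg q' ω t' j' j) → ∀ i, msg q ω t j i = msg q' ω t j i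
  out_local : ∀ q q' ω j, init q j = init q' j →
    (∀ t < rounds, ∀ j', msg q ω t j' j = msg q' ω t j' j) → out q ω j = out q' ω j
  msg_stored : ∀ q ω t j i x, t < rounds → Word.val x ∈ msg q ω t j i →
    x ∈ storedValues (init q j) (transcriptHistory msg q ω t j)
  out_stored : ∀ q ω j, ∀ t ∈ out q ω j, ∀ X : t.1,
    t.2 X ∈ storedValues (init q j) (transcriptHistory msg q ω rounds j)

variable (T : Transcript Inst att dom Seed p)

/-- The inboxes that machine `i` receives in the first `t` rounds. -/
def Transcript.history (q : Inst) (ω : Seed) (t : ℕ) (i : Fin p) : List (Inbox dom p) :=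
  transcriptHistory T.msg q ω t i

theorem Transcript.history_injective {q q' : Inst} {ω : Seed} {t : ℕ} {i : Fin p}
    (h : T.history q ω t i = T.history q' ω t i) :
    ∀ t' < t, ∀ j, T.msg q ω t' j i = T.msg q' ω t' j i := by
  intro t' ht' j
  have := List.map_inj_left.1 h t' (List.mem_range.2 ht')
  exact congrFun this j

open Classical in
/-- The algorithm with a given transcript. -/
noncomputable def Transcript.algorithm [MeasurableSpace Seed] (law : Measure Seed)
    [IsProbabilityMeasure law] : MPCAlgorithm att dom p where
  Seed := Seed
  law := law
  rounds := T.rounds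
  send ω j I h i :=
    -- The machine simulates any instance consistent with what it has seen; by `msg_local` the
    -- choice does not matter.
    if hq : ∃ q, T.init q j = I ∧ h.length < T.rounds ∧ h = T.history q ω h.length j then
      T.msg hq.choose ω h.length j i else []
  output ω j I h :=
    if hq : ∃ q, T.init q j = I ∧ h = T.history q ω T.rounds j then
      T.out hq.choose ω j else ∅
  send_stored ω j I h i x hx := by
    split_ifs at hx with hq
    · obtain ⟨h1, h2, h3⟩ := hq.choose_spec
      have := T.msg_stored _ _ _ _ _ _ h2 hx
      rw [h1] at this
      rw [h3]
      exact this
    · simp at hx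
  output_stored ω j I h t ht X := by
    split_ifs at ht with hq
    · obtain ⟨h1, h2⟩ := hq.choose_spec
      have := T.out_stored _ _ _ _ ht X
      rw [h1] at this
      rw [h2]
      exact this
    · simp at ht

variable [MeasurableSpace Seed] (law : Measure Seed) [IsProbabilityMeasure law]

theorem Transcript.algorithm_send {q : Inst} {ω : Seed} {t : ℕ} (ht : t < T.rounds) (j i : Fin p) :
    (T.algorithm law).send ω j (T.init q j) (T.history q ω t j) i = T.msg q ω t j i := by
  have hl : (T.history q ω t j).length = t := by simp [Transcript.history, transcriptHistory]
  have hq : ∃ q', T.init q' j = T.init q j ∧ (T.history q ω t j).length < T.rounds ∧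
      T.history q ω t j = T.history q' ω (T.history q ω t j).length j :=
    ⟨q, rfl, by rwa [hl], by rw [hl]⟩
  have h0 : (T.algorithm law).send ω j (T.init q j) (T.history q ω t j) i =
      T.msg hq.choose ω (T.history q ω t j).length j i := dif_pos hq
  obtain ⟨h1, -, h3⟩ := hq.choose_spec
  have h3' : T.history q ω t j = T.history hq.choose ω t j :=
    h3.trans (congrArg (fun n => T.history hq.choose ω n j) hl)
  rw [h0, congrArg (fun n => T.msg hq.choose ω n j i) hl]
  exact T.msg_local _ _ _ _ _ ht h1 (fun t' ht' j' => (T.history_injective h3' t' ht' j').symm) i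

theorem Transcript.algorithm_history (q : Inst) (ω : Seed) :
    ∀ t ≤ T.rounds, ∀ i, (T.algorithm law).history (T.init q) ω t i = T.history q ω t i := by
  intro t
  induction t with
  | zero => intro _ i; rfl
  | succ t ih =>
    intro ht i
    have ht' : t < T.rounds := ht
    have h1 : (T.algorithm law).history (T.init q) ω (t + 1) i =
        (T.algorithm law).history (T.init q) ω t i ++
          [fun j => (T.algorithm law).send ω j (T.init q j)
            ((T.algorithm law).history (T.init q) ω t j) i] := rfl
    have h2 : T.history q ω (t + 1) i = T.history q ω t i ++ [fun j => T.msg q ω t j i] := by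
      simp [Transcript.history, transcriptHistory, List.range_succ]
    rw [h1, h2, ih ht'.le]
    congr 2
    funext j
    rw [ih ht'.le, T.algorithm_send law ht']

theorem Transcript.algorithm_message {q : Inst} {ω : Seed} {t : ℕ} (ht : t < T.rounds)
    (j i : Fin p) : (T.algorithm law).message (T.init q) ω t j i = T.msg q ω t j i := by
  unfold MPCAlgorithm.message
  rw [T.algorithm_history law q ω t ht.le, T.algorithm_send law ht]

theorem Transcript.algorithm_produced (q : Inst) (ω : Seed) :
    (T.algorithm law).produced (T.init q) ω = ⋃ i, T.out q ω i := by
  ext t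
  simp only [MPCAlgorithm.produced, Set.mem_ofPred_eq, Set.mem_iUnion]
  refine exists_congr fun i => ?_
  have hr : (T.algorithm law).rounds = T.rounds := rfl
  rw [hr, T.algorithm_history law q ω _ le_rfl]
  have hq : ∃ q', T.init q' i = T.init q i ∧
      T.history q ω T.rounds i = T.history q' ω T.rounds i := ⟨q, rfl, rfl⟩
  have h0 : (T.algorithm law).output ω i (T.init q i) (T.history q ω T.rounds i) =
      T.out hq.choose ω i := dif_pos hq
  obtain ⟨h1, h2⟩ := hq.choose_spec
  rw [h0, T.out_local _ q ω i h1 (fun t ht j => (T.history_injective h2 t ht j).symm)]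

theorem Transcript.algorithm_load_le {q : Inst} {ω : Seed} {N : ℕ → ℕ}
    (h : ∀ t < T.rounds, ∀ i, ∑ j, (T.msg q ω t j i).length ≤ N t) :
    (T.algorithm law).load (T.init q) ω ≤ ∑ t ∈ Finset.range T.rounds, N t := by
  refine Finset.sum_le_sum fun t ht => Finset.sup_le fun i _ => ?_
  have ht : t < T.rounds := Finset.mem_range.1 ht
  simp only [T.algorithm_message law ht]
  exact h t ht i

end Transcript

/-! ### Messages that are sets of records -/

/-- A record: a number, or a pair of attributes with a number and two values. -/
inductive Rec (V dom : Type) : Type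
  | count (n : ℕ) : Rec V dom
  | tuple (X Y : V) (n : ℕ) (x y : dom) : Rec V dom

namespace Rec

variable {V dom : Type}

/-- The number in a record. -/
def num : Rec V dom → ℕ
  | count n => n
  | tuple _ _ n _ _ => n

/-- The values in a record. -/
def vals : Rec V dom → Set dom
  | count _ => ∅
  | tuple _ _ _ x y => {x, y}

variable [Fintype V]

/-- The code of a record as four words. -/
noncomputable def words : Rec V dom → List (Word dom)
  | count n => [.num 0, .num n, .num 0, .num 0]
  | tuple X Y n x y => [.num (Fintype.equivFin (V × V) (X, Y)), .num n, .val x, .val y]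

theorem length_words (r : Rec V dom) : r.words.length = 4 := by
  cases r <;> rfl

theorem words_injective : Function.Injective (words : Rec V dom → List (Word dom)) := by
  intro r s h
  cases r <;> cases s <;> simp [words] at h
  · simp [h]
  · obtain ⟨h1, h2, h3, h4⟩ := h
    have := (Fintype.equivFin (V × V)).injective (Fin.ext h1)
    simp_all

theorem val_mem_words {r : Rec V dom} {x : dom} : Word.val x ∈ r.words ↔ x ∈ r.vals := by
  cases r <;> simp [words, vals]

theorem num_mem_words {r : Rec V dom} {n : ℕ} (h : Word.num n ∈ r.words) :
    n ≤ r.num ∨ n ≤ Fintype.card V ^ 2 := by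
  cases r with
  | count n =>
    simp only [words, List.mem_cons, Word.num.injEq, List.not_mem_nil, or_false] at h
    rcases h with h | h | h | h <;> simp [num, h]
  | tuple X Y n x y =>
    simp only [words, List.mem_cons, Word.num.injEq, List.not_mem_nil, or_false, reduceCtorEq]
      at h
    rcases h with h | h
    · right
      rw [h, sq, ← Fintype.card_prod]
      exact (Fin.is_lt _).le
    · left; simp [num, h]

/-- All codes have length four, so a concatenation can be cut into records again. -/
theorem flatMap_words_injective :
    Function.Injective (fun l : List (Rec V dom) => l.flatMap words) := by
  intro l
  induction l with
  | nil =>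
    intro l' h
    cases l' with
    | nil => rfl
    | cons r l' =>
      have := congrArg List.length h
      simp [length_words] at this
      omega
  | cons r l ih =>
    intro l' h
    cases l' with
    | nil =>
      have := congrArg List.length h
      simp [length_words] at this
    | cons r' l' =>
      simp only [List.flatMap_cons] at h
      obtain ⟨h1, h2⟩ := List.append_inj h (by simp [length_words])
      rw [words_injective h1, ih h2]

/-- The code of a finite set of records as a list of words. -/
noncomputable def encode (S : Set (Rec V dom)) : List (Word dom) :=
  -- The order of the list is a function of the set alone, so equal sets of records give equal
  -- messages.
  open Classical in
  if h : S.Finite then h.toFinset.toList.flatMap words else []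

theorem length_encode {S : Set (Rec V dom)} (hS : S.Finite) : (encode S).length = 4 * S.ncard := by
  rw [encode, dif_pos hS, List.length_flatMap, Set.ncard_eq_toFinset_card S hS,
    ← Finset.length_toList, mul_comm, ← smul_eq_mul, ← List.sum_replicate, ← List.map_const']
  simp only [length_words]

theorem mem_encode {S : Set (Rec V dom)} (hS : S.Finite) {a : Word dom} :
    a ∈ encode S ↔ ∃ r ∈ S, a ∈ r.words := by
  simp [encode, dif_pos hS]

theorem encode_injective {S S' : Set (Rec V dom)} (hS : S.Finite) (hS' : S'.Finite)
    (h : encode S = encode S') : S = S' := by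
  rw [encode, encode, dif_pos hS, dif_pos hS'] at h
  have h1 := flatMap_words_injective h
  ext r
  rw [← hS.mem_toFinset, ← Finset.mem_toList, h1, Finset.mem_toList, hS'.mem_toFinset]

end Rec

end MPCJoin

namespace MPCJoin

/-! ### Concentration of bucket sizes -/

section Concentration

open ProbabilityTheory Finset

variable {Ω ι β α : Type} [MeasurableSpace Ω] {μ : Measure Ω} [IsProbabilityMeasure μ]
  [MeasurableSpace β] {f : ι → Ω → β}

/-- For `0 ≤ w ≤ 1` one has `exp w ≤ 1 + 2w`, so the moment is at most `1 + 2w / n`. -/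
theorem mgf_indicator_le {g : Ω → β} (hg : Measurable g) {A : Set β} (hA : MeasurableSet A)
    {w n : ℝ} (hw : 0 ≤ w) (hw1 : w ≤ 1) (hn : μ.real (g ⁻¹' A) ≤ 1 / n) :
    mgf (fun ω => w * A.indicator 1 (g ω)) μ 1 ≤ Real.exp (2 * w / n) := by
  have hexp : Real.exp w ≤ 1 + 2 * w := by
    have := Real.abs_exp_sub_one_sub_id_le (x := w) (by rw [abs_of_nonneg hw]; exact hw1)
    have := (abs_le.1 this).2
    nlinarith
  have hpt : ∀ ω, Real.exp (1 * (w * A.indicator 1 (g ω)))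
      ≤ 1 + 2 * w * (g ⁻¹' A).indicator 1 ω := by
    intro ω
    by_cases h : g ω ∈ A
    · have h' : ω ∈ g ⁻¹' A := h
      simpa [h, h'] using hexp
    · have h' : ω ∉ g ⁻¹' A := h
      simp [h, h']
  have hm : MeasurableSet (g ⁻¹' A) := hg hA
  have hint : Integrable ((g ⁻¹' A).indicator (1 : Ω → ℝ)) μ :=
    (integrable_const (1 : ℝ)).indicator hm
  have hint2 : Integrable (fun ω => 1 + 2 * w * (g ⁻¹' A).indicator 1 ω) μ :=
    (integrable_const (1 : ℝ)).add (hint.const_mul _)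
  calc mgf (fun ω => w * A.indicator 1 (g ω)) μ 1
      ≤ ∫ ω, (1 + 2 * w * (g ⁻¹' A).indicator 1 ω) ∂μ :=
        integral_mono_of_nonneg (ae_of_all _ fun ω => (Real.exp_pos _).le) hint2
          (ae_of_all _ hpt)
    _ = 1 + 2 * w * μ.real (g ⁻¹' A) := by
        rw [integral_add (integrable_const _) (hint.const_mul _), integral_const_mul,
          integral_indicator_one hm]
        simp
    _ ≤ 1 + 2 * w * (1 / n) := by gcongr
    _ ≤ Real.exp (2 * w / n) := by
        have := Real.add_one_le_exp (2 * w / n)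
        have e : 2 * w * (1 / n) = 2 * w / n := by ring
        linarith

open Classical in
/-- If every key has at most `W` of at most `n * W` items, then it is unlikely that a random
bucket, which receives each key with probability at most `1 / n`, has many items. -/
theorem measureReal_bucket_le (hf : iIndepFun f μ) (hfm : ∀ i, Measurable (f i)) {A : Set β}
    (hA : MeasurableSet A) {n W : ℝ} (hn : 0 < n) (hW : 0 < W)
    (hAn : ∀ i, μ.real (f i ⁻¹' A) ≤ 1 / n) (P : Finset α) (key : α → ι)
    (hkey : ∀ i, (#{a ∈ P | key a = i} : ℝ) ≤ W) (hP : (#P : ℝ) ≤ n * W) (s : ℝ) :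
    μ.real {ω | s * W < #{a ∈ P | f (key a) ω ∈ A}} ≤ Real.exp (2 - s) := by
  -- Dividing by `W` gives independent terms with weights in `[0, 1]` and total weight at most `n`,
  -- for which the exponential moment at `1` is at most `exp 2`.
  set w : ι → ℝ := fun i => #{a ∈ P | key a = i} / W with hw
  set X : ι → Ω → ℝ := fun i ω => w i * A.indicator 1 (f i ω) with hX
  have hw0 : ∀ i, 0 ≤ w i := fun i => by positivity
  have hw1 : ∀ i, w i ≤ 1 := fun i => (div_le_one hW).2 (hkey i)
  have hXm : ∀ i, Measurable (X i) := fun i =>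
    (((measurable_const (a := (1 : ℝ))).indicator hA).comp (hfm i)).const_mul _
  have hXi : iIndepFun X μ := hf.comp (fun i b => w i * A.indicator 1 b)
    fun i => ((measurable_const (a := (1 : ℝ))).indicator hA).const_mul _
  have hwsum : ∑ i ∈ P.image key, w i ≤ n := by
    rw [hw, ← sum_div, div_le_iff₀ hW, ← Nat.cast_sum,
      ← card_eq_sum_card_fiberwise (fun a ha => mem_image_of_mem key ha)]
    exact hP
  have hsum : ∀ ω, ((#{a ∈ P | f (key a) ω ∈ A} : ℕ) : ℝ) = W * (∑ i ∈ P.image key, X i) ω := by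
    intro ω
    rw [card_eq_sum_card_fiberwise (f := key) (t := P.image key)
      (fun a ha => mem_image_of_mem key (mem_filter.1 ha).1), Finset.sum_apply, mul_sum,
      Nat.cast_sum]
    refine sum_congr rfl fun i _ => ?_
    rw [filter_filter]
    by_cases h : f i ω ∈ A
    · have : ({a ∈ P | f (key a) ω ∈ A ∧ key a = i} : Finset α) = {a ∈ P | key a = i} :=
        filter_congr fun a _ => ⟨fun h => h.2, fun h' => ⟨by rwa [h'], h'⟩⟩
      simp only [this, hX, hw, h, Set.indicator_of_mem, Pi.one_apply]
      field_simp
    · have : ({a ∈ P | f (key a) ω ∈ A ∧ key a = i} : Finset α) = ∅ :=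
        filter_false_of_mem fun a _ h' => h (h'.2 ▸ h'.1)
      simp [this, hX, h]
  have hsub : {ω | s * W < #{a ∈ P | f (key a) ω ∈ A}} ⊆
      {ω | s ≤ (∑ i ∈ P.image key, X i) ω} := by
    intro ω hω
    simp only [Set.mem_ofPred_eq] at hω ⊢
    rw [hsum, mul_comm s] at hω
    exact (lt_of_mul_lt_mul_left hω hW.le).le
  have hint : Integrable (fun ω => Real.exp (1 * (∑ i ∈ P.image key, X i) ω)) μ := by
    refine Integrable.of_bound (C := Real.exp n) (by fun_prop) (ae_of_all _ fun ω => ?_)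
    rw [Real.norm_of_nonneg (Real.exp_pos _).le, one_mul, Real.exp_le_exp, Finset.sum_apply]
    refine (sum_le_sum fun i _ => ?_).trans hwsum
    by_cases h : f i ω ∈ A <;> simp [hX, h, hw0 i]
  calc μ.real {ω | s * W < #{a ∈ P | f (key a) ω ∈ A}}
      ≤ μ.real {ω | s ≤ (∑ i ∈ P.image key, X i) ω} := measureReal_mono hsub
    _ ≤ Real.exp (-1 * s) * mgf (∑ i ∈ P.image key, X i) μ 1 :=
        measure_ge_le_exp_mul_mgf s zero_le_one hint
    _ = Real.exp (-1 * s) * ∏ i ∈ P.image key, mgf (X i) μ 1 := by rw [hXi.mgf_sum hXm]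
    _ ≤ Real.exp (-1 * s) * ∏ i ∈ P.image key, Real.exp (2 * w i / n) := by
        gcongr with i _
        · exact fun i _ => mgf_nonneg
        · exact mgf_indicator_le (hfm i) hA (hw0 i) (hw1 i) (hAn i)
    _ = Real.exp (-1 * s + 2 * (∑ i ∈ P.image key, w i) / n) := by
        rw [← Real.exp_sum, ← Real.exp_add, mul_sum, sum_div]
    _ ≤ Real.exp (2 - s) := by
        rw [Real.exp_le_exp]
        have : 2 * (∑ i ∈ P.image key, w i) / n ≤ 2 := by
          rw [div_le_iff₀ hn]; linarith
        linarith

open Classical in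
/-- The bound for items with two keys, both of which are hashed. -/
theorem measureReal_bucket_pair_le [Finite β] [MeasurableSingletonClass β] (hf : iIndepFun f μ) (hfm : ∀ i, Measurable (f i)) {A B : Set β}
    (hA : MeasurableSet A) (hB : MeasurableSet B) {n W : ℝ} (hn : 0 < n) (hW : 0 < W)
    (hAn : ∀ i, μ.real (f i ⁻¹' A) ≤ 1 / n) (hBn : ∀ i, μ.real (f i ⁻¹' B) ≤ 1 / n)
    (P : Finset α) (key key' : α → ι) (hne : ∀ a ∈ P, ∀ a' ∈ P, key a ≠ key' a')
    (hkey : ∀ i, (#{a ∈ P | key a = i} : ℝ) ≤ n * W)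
    (hkey' : ∀ i, (#{a ∈ P | key' a = i} : ℝ) ≤ n * W)
    (hpair : ∀ i i', (#{a ∈ P | key' a = i' ∧ key a = i} : ℝ) ≤ W)
    (hP : (#P : ℝ) ≤ n * (n * W)) {s : ℝ} (hs : 0 < s) :
    μ.real {ω | s * (s * W) < #{a ∈ P | f (key a) ω ∈ A ∧ f (key' a) ω ∈ B}} ≤
      (#P + 2) * Real.exp (2 - s) := by
  -- The two hashings are exposed one after the other. `E1`: the first selects too many items in
  -- total. `E2 i`: it selects too many items with second key `i`. Otherwise the selected set is
  -- some `T` in `good`, and the one-key bound applies to the second hashing of `T`.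
  set E1 : Set Ω := {ω | s * (n * W) < #{a ∈ P | f (key a) ω ∈ A}}
  set E2 : ι → Set Ω := fun i => {ω | s * W < #{a ∈ {a ∈ P | key' a = i} | f (key a) ω ∈ A}}
  set R : Ω → Finset α := fun ω => {a ∈ P | f (key a) ω ∈ A}
  set good : Finset (Finset α) := {T ∈ P.powerset |
    (#T : ℝ) ≤ n * (s * W) ∧ ∀ i, (#{a ∈ T | key' a = i} : ℝ) ≤ s * W}
  set E3 : Finset α → Set Ω := fun T => {ω | R ω = T}
  set E4 : Finset α → Set Ω := fun T => {ω | s * (s * W) < #{a ∈ T | f (key' a) ω ∈ B}}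
  have h1 : μ.real E1 ≤ Real.exp (2 - s) :=
    measureReal_bucket_le hf hfm hA hn (by positivity) hAn P key hkey hP s
  have h2 : ∀ i, μ.real (E2 i) ≤ Real.exp (2 - s) := fun i =>
    measureReal_bucket_le hf hfm hA hn hW hAn _ key
      (fun j => by rw [filter_filter]; exact hpair j i) (hkey' i) s
  have h4 : ∀ T ∈ good, μ.real (E4 T) ≤ Real.exp (2 - s) := fun T hT =>
    measureReal_bucket_le hf hfm hB hn (by positivity) hBn T key'
      (mem_filter.1 hT).2.2 (mem_filter.1 hT).2.1 s
  set S := P.image key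
  set S' := P.image key'
  -- First and second keys form disjoint sets, so fixing the set selected by the first hashing does
  -- not bias the second.
  have hind := hf.indepFun_finset S S' (disjoint_left.2 fun i hi hi' => by
    obtain ⟨a, ha, rfl⟩ := mem_image.1 hi
    obtain ⟨a', ha', h⟩ := mem_image.1 hi'
    exact hne a ha a' ha' h.symm) hfm
  have h3e : ∀ T, E3 T = (fun ω (i : S) => f i ω) ⁻¹'
      {v | ({a ∈ P | ∃ h : key a ∈ S, v ⟨key a, h⟩ ∈ A} : Finset α) = T} := by
    intro T
    ext ω
    have : R ω = {a ∈ P | ∃ _ : key a ∈ S, f (key a) ω ∈ A} :=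
      filter_congr fun a ha => by simp [S, mem_image_of_mem key ha]
    simp only [E3, this, Set.mem_preimage, Set.mem_ofPred_eq]
  have h4e : ∀ T ∈ good, E4 T = (fun ω (i : S') => f i ω) ⁻¹'
      {v | s * (s * W) < #{a ∈ T | ∃ h : key' a ∈ S', v ⟨key' a, h⟩ ∈ B}} := by
    intro T hT
    ext ω
    have : ({a ∈ T | f (key' a) ω ∈ B} : Finset α) =
        {a ∈ T | ∃ _ : key' a ∈ S', f (key' a) ω ∈ B} :=
      filter_congr fun a ha => by
        simp [S', mem_image_of_mem key' (mem_powerset.1 (mem_filter.1 hT).1 ha)]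
    simp only [E4, this, Set.mem_preimage, Set.mem_ofPred_eq]
  have h34 : ∀ T ∈ good, μ.real (E3 T ∩ E4 T) = μ.real (E3 T) * μ.real (E4 T) := by
    intro T hT
    rw [h3e, h4e T hT]
    simp only [measureReal_def, ← ENNReal.toReal_mul]
    rw [hind.measure_inter_preimage_eq_mul _ _ (Set.toFinite _).measurableSet
      (Set.toFinite _).measurableSet]
  -- The events `R = T` are disjoint, so summing over all possible `T` costs no factor.
  have h3 : ∑ T ∈ good, μ.real (E3 T) ≤ 1 := by
    rw [← measureReal_biUnion_finset]
    · exact measureReal_le_one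
    · intro T _ T' _ hTT'
      exact Set.disjoint_left.2 fun ω h h' => hTT' (h.symm.trans h')
    · intro T _
      rw [h3e]
      exact (measurable_pi_lambda (fun ω (i : S) => f i ω) fun i => hfm i) (Set.toFinite _).measurableSet
  have hsub : {ω | s * (s * W) < #{a ∈ P | f (key a) ω ∈ A ∧ f (key' a) ω ∈ B}} ⊆
      (E1 ∪ ⋃ i ∈ S', E2 i) ∪ ⋃ T ∈ good, E3 T ∩ E4 T := by
    intro ω hω
    by_contra hcon
    simp only [Set.mem_union, Set.mem_iUnion, not_or, not_exists] at hcon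
    obtain ⟨⟨hc1, hc2⟩, hc3⟩ := hcon
    have hg : R ω ∈ good := by
      refine mem_filter.2 ⟨mem_powerset.2 (filter_subset _ _), ?_, fun i => ?_⟩
      · simp only [E1, Set.mem_ofPred_eq, not_lt] at hc1
        exact hc1.trans_eq (by ring)
      · by_cases hi : i ∈ S'
        · have := hc2 i hi
          simp only [E2, Set.mem_ofPred_eq, not_lt] at this
          simp only [R, filter_filter] at this ⊢
          simpa only [and_comm] using this
        · have : ({a ∈ R ω | key' a = i} : Finset α) = ∅ :=
            filter_false_of_mem fun a ha h =>
              hi (h ▸ mem_image_of_mem key' (mem_filter.1 ha).1)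
          rw [this]
          simp only [card_empty, Nat.cast_zero]
          positivity
    refine hc3 _ hg ⟨rfl, ?_⟩
    simp only [E4, R, filter_filter, Set.mem_ofPred_eq]
    exact hω
  calc _ ≤ μ.real ((E1 ∪ ⋃ i ∈ S', E2 i) ∪ ⋃ T ∈ good, E3 T ∩ E4 T) := measureReal_mono hsub
    _ ≤ (μ.real E1 + ∑ i ∈ S', μ.real (E2 i)) + ∑ T ∈ good, μ.real (E3 T ∩ E4 T) := by
        refine (measureReal_union_le _ _).trans (add_le_add ((measureReal_union_le _ _).trans
          (add_le_add le_rfl ?_)) ?_) <;> exact measureReal_biUnion_finset_le _ _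
    _ ≤ (Real.exp (2 - s) + ∑ i ∈ S', Real.exp (2 - s)) +
          ∑ T ∈ good, μ.real (E3 T) * Real.exp (2 - s) := by
        gcongr with i _ T hT
        · exact h2 i
        · rw [h34 T hT]
          exact mul_le_mul_of_nonneg_left (h4 T hT) measureReal_nonneg
    _ ≤ (Real.exp (2 - s) + #P * Real.exp (2 - s)) + 1 * Real.exp (2 - s) := by
        rw [sum_const, nsmul_eq_mul, ← sum_mul]
        gcongr
        exact card_image_le
    _ = _ := by ring

end Concentration

end MPCJoin

namespace MPCJoin

/-! ### Fractional edge coverings of graphs -/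

section Covering

open Finset

/-- Two vertices of a hypergraph are adjacent if they form an edge. -/
def Adjacent {att : Type} [DecidableEq att] (E : Finset (Finset att)) (X Y : att) : Prop :=
  X ≠ Y ∧ {X, Y} ∈ E

theorem Adjacent.symm {att : Type} [DecidableEq att] {E : Finset (Finset att)} {X Y : att}
    (h : Adjacent E X Y) : Adjacent E Y X :=
  ⟨h.1.symm, by rw [pair_comm]; exact h.2⟩

variable {att : Type} [DecidableEq att] {E : Finset (Finset att)}

theorem exists_adjacent (hE : ∀ e ∈ E, e.card = 2) {X : att} (hX : X ∈ E.biUnion id) :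
    ∃ Y ∈ E.biUnion id, Adjacent E X Y := by
  obtain ⟨e, he, hXe⟩ := mem_biUnion.1 hX
  obtain ⟨a, b, hab, rfl⟩ := card_eq_two.1 (hE e he)
  have hXe : X = a ∨ X = b := by simpa using hXe
  rcases hXe with rfl | rfl
  · exact ⟨b, mem_biUnion.2 ⟨_, he, by simp⟩, hab, he⟩
  · exact ⟨a, mem_biUnion.2 ⟨_, he, by simp⟩, hab.symm, by rw [pair_comm]; exact he⟩

open Classical in
/-- Weak duality, for the half-integral vertex packing given by a set `S` of vertices. -/
theorem card_add_card_le_sum (hE : ∀ e ∈ E, e.card = 2) {W : Finset att → ℝ}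
    (hW : IsFractionalEdgeCovering E W) {S : Finset att} (hS : S ⊆ E.biUnion id) :
    (#(E.biUnion id) : ℝ) + #S ≤
      2 * ∑ e ∈ E, W e + #{Y ∈ E.biUnion id | ∃ X ∈ S, Adjacent E X Y} := by
  set V := E.biUnion id with hV
  set N : Finset att := {Y ∈ V | ∃ X ∈ S, Adjacent E X Y} with hN
  -- Twice a fractional vertex packing: if one end of an edge lies in `S`, the other lies in `N`, so
  -- the weights of the two ends add up to at most `2`.
  set x : att → ℝ := fun X => (1 + (if X ∈ S then 1 else 0)) - (if X ∈ N then 1 else 0) with hx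
  have hx0 : ∀ X, 0 ≤ x X := by
    intro X
    simp only [hx]
    split_ifs <;> norm_num
  have hNV : N ⊆ V := filter_subset _ _
  have hsum : ∑ X ∈ V, x X = #V + #S - #N := by
    simp only [hx, sum_sub_distrib, sum_add_distrib, sum_const, nsmul_eq_mul, mul_one,
      sum_ite_mem, inter_eq_right.2 hS, inter_eq_right.2 hNV]
  have hedge : ∀ e ∈ E, ∑ X ∈ V with X ∈ e, x X ≤ 2 := by
    intro e he
    have hsub : e ⊆ V := fun X hX => mem_biUnion.2 ⟨e, he, hX⟩
    rw [filter_mem_eq_inter, inter_eq_right.2 hsub]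
    obtain ⟨a, b, hab, rfl⟩ := card_eq_two.1 (hE e he)
    have ha : a ∈ V := hsub (by simp)
    have hb : b ∈ V := hsub (by simp)
    have h1 : a ∈ S → b ∈ N := fun h => mem_filter.2 ⟨hb, a, h, hab, he⟩
    have h2 : b ∈ S → a ∈ N := fun h =>
      mem_filter.2 ⟨ha, b, h, hab.symm, by rw [pair_comm]; exact he⟩
    rw [sum_pair hab]
    simp only [hx]
    split_ifs <;> first | (exfalso; tauto) | norm_num
  have key : ∑ X ∈ V, x X ≤ 2 * ∑ e ∈ E, W e :=
    calc ∑ X ∈ V, x X ≤ ∑ X ∈ V, x X * ∑ e ∈ E with X ∈ e, W e :=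
          sum_le_sum fun X hX => le_mul_of_one_le_right (hx0 X) (hW.2 X hX)
      _ = ∑ e ∈ E, W e * ∑ X ∈ V with X ∈ e, x X := by
          simp only [mul_sum, sum_filter]
          rw [sum_comm]
          refine sum_congr rfl fun e _ => sum_congr rfl fun X _ => ?_
          split_ifs <;> ring
      _ ≤ ∑ e ∈ E, W e * 2 :=
          sum_le_sum fun e he => mul_le_mul_of_nonneg_left (hedge e he) (hW.1 e he).1
      _ = 2 * ∑ e ∈ E, W e := by rw [← sum_mul, mul_comm]
  linarith

open Classical in
theorem card_add_card_le_rho (hE : ∀ e ∈ E, e.card = 2) {S : Finset att} (hS : S ⊆ E.biUnion id) :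
    (#(E.biUnion id) : ℝ) + #S ≤
      2 * fractionalEdgeCoveringNumber E + #{Y ∈ E.biUnion id | ∃ X ∈ S, Adjacent E X Y} := by
  have h : (#(E.biUnion id) + #S - #{Y ∈ E.biUnion id | ∃ X ∈ S, Adjacent E X Y} : ℝ) / 2 ≤
      fractionalEdgeCoveringNumber E := by
    refine le_csInf ⟨_, fun _ => 1, ⟨fun _ _ => by norm_num, fun X hX => ?_⟩, rfl⟩ ?_
    · obtain ⟨e, he, hXe⟩ := mem_biUnion.1 hX
      rw [sum_const, nsmul_eq_mul, mul_one, Nat.one_le_cast, one_le_card]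
      exact ⟨e, mem_filter.2 ⟨he, hXe⟩⟩
    · rintro s ⟨W, hW, rfl⟩
      have := card_add_card_le_sum hE hW hS
      linarith
  linarith

end Covering

/-! ### Choice of hosts by Hall's theorem. -/

section Hosts

open Finset

variable {V : Type} [Fintype V] {Adj : V → V → Prop}

open Classical in
/-- A deficiency version of Hall's theorem: if `d + #(N S) ≥ #S` for all `S ⊆ I`, there is a choice
of neighbours for the elements of `I` with at least `#I - d` values. -/
theorem exists_choice_card_image (I : Finset V) (hI : ∀ X ∈ I, ∃ Y, Adj X Y) {d : ℕ}
    (hd : ∀ S ⊆ I, #S ≤ d + #{Y : V | ∃ X ∈ S, Adj X Y}) :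
    ∃ σ : V → V, (∀ X ∈ I, Adj X (σ X)) ∧ #I ≤ d + #(I.image σ) := by
  -- Adding `d` dummy neighbours to every element restores Hall's condition.
  let t : I → Finset (V ⊕ Fin d) := fun X => ({Y : V | Adj X Y} : Finset V).disjSum univ
  have hall : ∀ S : Finset I, #S ≤ #(S.biUnion t) := by
    intro S
    rcases S.eq_empty_or_nonempty with rfl | ⟨X0, hX0⟩
    · simp
    have h1 : #S = #(S.map (Function.Embedding.subtype _)) := (card_map _).symm
    have h2 : ({Y : V | ∃ X ∈ S.map (Function.Embedding.subtype _), Adj X Y} : Finset V).disjSum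
        (univ : Finset (Fin d)) ⊆ S.biUnion t := by
      intro z hz
      rw [mem_biUnion]
      rcases z with Y | i
      · simp only [inl_mem_disjSum, mem_filter, mem_univ, true_and, mem_map] at hz
        obtain ⟨_, ⟨X, hX, rfl⟩, hXY⟩ := hz
        exact ⟨X, hX, by simpa [t] using hXY⟩
      · exact ⟨X0, hX0, by simp [t]⟩
    have h3 := hd (S.map (Function.Embedding.subtype _)) fun X hX => by
      obtain ⟨Y, -, rfl⟩ := mem_map.1 hX
      exact Y.2
    have h4 := card_le_card h2
    rw [card_disjSum, card_univ, Fintype.card_fin] at h4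
    omega
  obtain ⟨f, hf, hft⟩ := (all_card_le_biUnion_card_iff_exists_injective t).1 hall
  choose nb hnb using hI
  -- The elements matched to dummies, at most `d` of them, get an arbitrary neighbour; the others
  -- have distinct images.
  let σ : V → V := fun X => if h : X ∈ I then Sum.elim id (fun _ => nb X h) (f ⟨X, h⟩) else X
  have hσ : ∀ X (h : X ∈ I), σ X = Sum.elim id (fun _ => nb X h) (f ⟨X, h⟩) :=
    fun X h => dif_pos h
  refine ⟨σ, fun X h => ?_, ?_⟩
  · rw [hσ X h]
    have := hft ⟨X, h⟩
    rcases hf' : f ⟨X, h⟩ with Y | i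
    · rw [hf'] at this
      simpa [t] using this
    · exact hnb X h
  · have h1 : (univ : Finset I).image f ⊆ (I.image σ).disjSum univ := by
      intro z hz
      obtain ⟨X, -, rfl⟩ := mem_image.1 hz
      rcases hf' : f X with Y | i
      · rw [inl_mem_disjSum, mem_image]
        exact ⟨X, X.2, by rw [hσ X X.2, hf']; rfl⟩
      · simp
    have h2 := card_le_card h1
    rw [card_image_of_injective _ hf, card_disjSum, card_univ, card_univ, Fintype.card_coe,
      Fintype.card_fin] at h2
    omega

-- With `d` the largest deficiency of a subset of `I`, the hypothesis gives `|V| + d ≤ r`, and the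
-- choice of neighbours loses at most `d` values.
open Classical in
theorem exists_host {r : ℝ}
    (hr : ∀ S : Finset V, (Fintype.card V : ℝ) + #S ≤ r + #{Y : V | ∃ X ∈ S, Adj X Y})
    (I : Finset V) (hI : ∀ X ∈ I, ∃ Y, Adj X Y) :
    ∃ σ : V → V, (∀ X ∈ I, Adj X (σ X)) ∧ (Fintype.card V : ℝ) + #I ≤ r + #(I.image σ) := by
  set d : ℕ := I.powerset.sup fun S => #S - #{Y : V | ∃ X ∈ S, Adj X Y} with hd
  have h1 : ∀ S ⊆ I, #S ≤ d + #{Y : V | ∃ X ∈ S, Adj X Y} := by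
    intro S hS
    have := le_sup (f := fun S => #S - #{Y : V | ∃ X ∈ S, Adj X Y}) (mem_powerset.2 hS)
    rw [← hd] at this
    omega
  have h2 : (Fintype.card V : ℝ) + d ≤ r := by
    obtain ⟨S, -, hS⟩ := exists_mem_eq_sup I.powerset ⟨∅, empty_mem_powerset I⟩
      fun S => #S - #{Y : V | ∃ X ∈ S, Adj X Y}
    rw [← hd] at hS
    -- Subtraction is truncated, so the maximiser carries no information when `d = 0`; the empty set
    -- is used instead.
    rcases Nat.eq_zero_or_pos d with h0 | h0
    · have := hr ∅
      simpa [h0] using this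
    · have h3 := hr S
      have h4 : (d : ℝ) + #{Y : V | ∃ X ∈ S, Adj X Y} = #S := by
        exact_mod_cast (by omega : d + #{Y : V | ∃ X ∈ S, Adj X Y} = #S)
      linarith
  obtain ⟨σ, hσ, hc⟩ := exists_choice_card_image I hI h1
  refine ⟨σ, hσ, ?_⟩
  have : (#I : ℝ) ≤ d + #(I.image σ) := by exact_mod_cast hc
  linarith

end Hosts

end MPCJoin

namespace MPCJoin

/-! ### Enumerations of finite sets. -/

section Index

open Finset

variable {α : Type}

open Classical in
/-- An enumeration of a finite set. -/
noncomputable def index (S : Set α) (a : α) : ℕ :=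
  if h : S.Finite ∧ a ∈ S then (h.1.toFinset.equivFin ⟨a, h.1.mem_toFinset.2 h.2⟩ : ℕ) else 0

theorem index_lt {S : Set α} (hS : S.Finite) {a : α} (ha : a ∈ S) : index S a < S.ncard := by
  rw [index, dif_pos ⟨hS, ha⟩, Set.ncard_eq_toFinset_card S hS]
  exact Fin.is_lt _

theorem index_injOn {S : Set α} (hS : S.Finite) : Set.InjOn (index S) S := by
  intro a ha b hb h
  rw [index, index, dif_pos ⟨hS, ha⟩, dif_pos ⟨hS, hb⟩] at h
  simpa using hS.toFinset.equivFin.injective (Fin.ext h)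

/-- Enumeration modulo `n` splits a finite set evenly into `n` parts. -/
theorem ncard_index_mod_le {S : Set α} (hS : S.Finite) (n b : ℕ) :
    {a ∈ S | index S a % n = b}.ncard ≤ S.ncard / n + 1 := by
  have h1 : {a ∈ S | index S a % n = b}.ncard ≤ (range (S.ncard / n + 1)).card := by
    rw [← Set.ncard_coe_finset]
    refine Set.ncard_le_ncard_of_injOn (fun a => index S a / n) ?_ ?_ (Finset.finite_toSet _)
    · intro a ha
      simp only [coe_range, Set.mem_Iio]
      exact Nat.lt_succ_of_le (Nat.div_le_div_right (index_lt hS ha.1).le)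
    · intro a ha a' ha' h
      refine index_injOn hS ha.1 ha'.1 ?_
      rw [← Nat.div_add_mod (index S a) n, ← Nat.div_add_mod (index S a') n, ha.2, ha'.2]
      exact congrArg (fun c => n * c + b) h
  simpa using h1

end Index

/-! ### The algorithm -/

section Core

set_option linter.unusedSectionVars false

open Finset

/-- Binary relations between the values of any two attributes, whose tuples are distributed over
`p` machines. -/
structure Placement (V dom : Type) (p : ℕ) where
  /-- the tuples over `X` and `Y` on a machine -/
  tup : Fin p → V → V → Finset (dom × dom)
  symm : ∀ {i X Y x y}, (x, y) ∈ tup i X Y → (y, x) ∈ tup i Y X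
  disj : ∀ {i j X Y a}, a ∈ tup i X Y → a ∈ tup j X Y → i = j
  ne : ∀ {i X Y a}, a ∈ tup i X Y → X ≠ Y

/-- The parameters of the algorithm that depend only on the schemes and the number of machines. -/
structure Plan (V : Type) where
  /-- adjacency of attributes -/
  Adj : V → V → Prop
  /-- A value of an attribute is heavy if a proportion `1 / lam` of the input contains it. -/
  lam : ℝ
  /-- the number of buckets into which the light values of an attribute are hashed -/
  cap : ℕ
  /-- a neighbour in `U` of an attribute that has all its neighbours in `U` -/
  host : Finset V → V → V

/-- A part of the space of all tuples: a set of attributes, the (heavy) values of these attributes,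
and a class of light values of each other attribute. -/
abbrev Cell (V dom : Type) : Type := Finset V × (V → dom) × (V → ℕ)

variable {V dom : Type} {p : ℕ}

/-- The attribute `X` is not in `U`, but all its neighbours are. -/
def Plan.Isolated (P : Plan V) (U : Finset V) (X : V) : Prop :=
  X ∉ U ∧ ∀ Y, P.Adj X Y → Y ∈ U

variable [Fintype V] [DecidableEq V] [DecidableEq dom]

open Classical in
/-- The number of classes of light values of an attribute. -/
noncomputable def Plan.width (P : Plan V) (N : Finset V → V → dom → ℕ) (U : Finset V) (η : V → dom)
    (X : V) : ℕ :=
  if X ∈ U then 1 else if P.Isolated U X then N U X (η (P.host U X)) else P.cap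

/-- The cells for given heavy values and given numbers of classes. -/
noncomputable def Plan.cellsOf [Nonempty dom] (P : Plan V) (H : V → Finset dom)
    (N : Finset V → V → dom → ℕ) : Finset (Cell V dom) :=
  univ.biUnion fun U =>
    (Fintype.piFinset fun X => if X ∈ U then H X else {Classical.arbitrary dom}).biUnion fun η =>
      (Fintype.piFinset fun X => range (P.width N U η X)).image fun b => (U, η, b)

theorem Plan.mem_cellsOf [Nonempty dom] {P : Plan V} {H : V → Finset dom}
    {N : Finset V → V → dom → ℕ} {κ : Cell V dom} :
    κ ∈ P.cellsOf H N ↔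
      (∀ X, κ.2.1 X ∈ if X ∈ κ.1 then H X else {Classical.arbitrary dom}) ∧
        ∀ X, κ.2.2 X < P.width N κ.1 κ.2.1 X := by
  obtain ⟨U, η, b⟩ := κ
  simp only [Plan.cellsOf, mem_biUnion, mem_univ, true_and, Fintype.mem_piFinset, mem_image,
    mem_range, Prod.mk.injEq]
  constructor
  · rintro ⟨U', η', h1, b', h2, rfl, rfl, rfl⟩
    exact ⟨h1, h2⟩
  · rintro ⟨h1, h2⟩
    exact ⟨U, η, h1, b, h2, rfl, rfl, rfl⟩

namespace Placement

variable (q : Placement V dom p)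

/-- The relation between the values of two attributes. -/
def rel (X Y : V) : Finset (dom × dom) := univ.biUnion fun i => q.tup i X Y

variable {q} in
theorem mem_rel {X Y : V} {a : dom × dom} : a ∈ q.rel X Y ↔ ∃ i, a ∈ q.tup i X Y := by
  simp [rel]

variable {q} in
theorem rel_symm {X Y : V} {x y : dom} (h : (x, y) ∈ q.rel X Y) : (y, x) ∈ q.rel Y X := by
  obtain ⟨i, hi⟩ := mem_rel.1 h
  exact mem_rel.2 ⟨i, q.symm hi⟩

/-- The number of tuples on a machine, each counted in both orders. -/
def localSize (i : Fin p) : ℕ := ∑ X, ∑ Y, #(q.tup i X Y)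

/-- The total number of tuples, each counted in both orders. -/
def size : ℕ := ∑ i, q.localSize i

/-- The degree of a value on a machine. -/
def localDeg (i : Fin p) (X Y : V) (x : dom) : ℕ := #{a ∈ q.tup i X Y | a.1 = x}

/-- The degree of a value. -/
def deg (X Y : V) (x : dom) : ℕ := #{a ∈ q.rel X Y | a.1 = x}

theorem deg_eq_sum (X Y : V) (x : dom) : q.deg X Y x = ∑ i, q.localDeg i X Y x := by
  rw [deg, rel, filter_biUnion, card_biUnion]
  · rfl
  · intro i _ j _ hij
    exact disjoint_left.2 fun a ha ha' =>
      hij (q.disj (mem_filter.1 ha).1 (mem_filter.1 ha').1)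

variable {q} in
theorem localDeg_pos {i : Fin p} {X Y : V} {x : dom} :
    0 < q.localDeg i X Y x ↔ ∃ y, (x, y) ∈ q.tup i X Y := by
  rw [localDeg, card_pos]
  constructor
  · rintro ⟨⟨a, b⟩, h⟩
    obtain ⟨h1, rfl⟩ := mem_filter.1 h
    exact ⟨b, h1⟩
  · rintro ⟨y, h⟩
    exact ⟨(x, y), mem_filter.2 ⟨h, rfl⟩⟩

variable {q} in
theorem deg_pos {X Y : V} {x : dom} : 0 < q.deg X Y x ↔ ∃ y, (x, y) ∈ q.rel X Y := by
  rw [deg, card_pos]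
  constructor
  · rintro ⟨⟨a, b⟩, h⟩
    obtain ⟨h1, rfl⟩ := mem_filter.1 h
    exact ⟨b, h1⟩
  · rintro ⟨y, h⟩
    exact ⟨(x, y), mem_filter.2 ⟨h, rfl⟩⟩

variable (P : Plan V)

/-- The heavy values of an attribute. -/
noncomputable def heavy (X : V) : Finset dom :=
  univ.biUnion fun Y => {x ∈ (q.rel X Y).image Prod.fst | (q.size : ℝ) ≤ q.deg X Y x * P.lam}

variable {q P} in
theorem mem_heavy {X : V} {x : dom} :
    x ∈ q.heavy P X ↔ ∃ Y, 0 < q.deg X Y x ∧ (q.size : ℝ) ≤ q.deg X Y x * P.lam := by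
  simp [heavy, deg_pos]

/-- The number of classes of light values of an isolated attribute. -/
noncomputable def parts (U : Finset V) (X : V) (z : dom) : ℕ :=
  -- The added `1` makes the degree divided by the number of parts at most `size / lam ^ 2`. The
  -- default for light `z` makes the function depend only on data that are broadcast.
  if z ∈ q.heavy P (P.host U X) then
    ⌊(q.deg (P.host U X) X z : ℝ) * P.lam ^ 2 / q.size⌋₊ + 1 else 1

/-- The value `x` of `X` is related to the given values of the attributes in `U`. -/
def Compatible (U : Finset V) (η : V → dom) (X : V) (x : dom) : Prop :=
  ∀ Z ∈ U, P.Adj Z X → (η Z, x) ∈ q.rel Z X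

/-- The seed assigns to each value of each attribute a machine and a bucket. -/
abbrev Seed (V dom : Type) (p n : ℕ) : Type := V × dom → Fin p × Fin n

variable (ω : Seed V dom p P.cap)

/-- The light values of an attribute on their home `j` that are compatible with the values of the
attributes in `U`. -/
def candidates (j : Fin p) (U : Finset V) (η : V → dom) (X : V) : Set dom :=
  {x | (ω (X, x)).1 = j ∧ x ∉ q.heavy P X ∧ q.Compatible P U η X x}

/-- The value `x` belongs to the bucket of `X` in a cell. -/
def Fits (κ : Cell V dom) (X : V) (x : dom) : Prop :=
  X ∉ κ.1 ∧ x ∉ q.heavy P X ∧ ((ω (X, x)).2 : ℕ) = κ.2.2 X ∧ q.Compatible P κ.1 κ.2.1 X x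

/-- The value `x` belongs to the class of the isolated attribute `X` in a cell. -/
def FitsIsolated (κ : Cell V dom) (X : V) (x : dom) : Prop :=
  P.Isolated κ.1 X ∧ x ∈ q.candidates P ω (ω (X, x)).1 κ.1 κ.2.1 X ∧
    index (q.candidates P ω (ω (X, x)).1 κ.1 κ.2.1 X) x % P.width (q.parts P) κ.1 κ.2.1 X = κ.2.2 X

variable [Nonempty dom]

/-- The cells. -/
noncomputable def cells : Finset (Cell V dom) := P.cellsOf (q.heavy P) (q.parts P)

/-- The number of a cell. -/
noncomputable def code (κ : Cell V dom) : ℕ := index (q.cells P : Set (Cell V dom)) κ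

/-- The messages of the algorithm. -/
noncomputable def records : ℕ → Fin p → Fin p → Set (Rec V dom)
  -- Local sizes go to everyone, and each nonzero local degree of a value goes to the home of the
  -- value.
  | 0, j, i => {r | r = .count (q.localSize j) ∨ ∃ X Y x, (ω (X, x)).1 = i ∧
      0 < q.localDeg j X Y x ∧ r = .tuple X Y (q.localDeg j X Y x) x x}
  -- The home now knows the total degrees and broadcasts them for its heavy values; from here on all
  -- machines agree on the cells and their codes.
  | 1, j, _ => {r | ∃ X Y x, (ω (X, x)).1 = j ∧ x ∈ q.heavy P X ∧
      r = .tuple X Y (q.deg X Y x) x x}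
  -- Heavy neighbours are collected at the home of each value; pairs of two heavy values are few and
  -- go to everyone.
  | 2, j, i => {r | ∃ Z X z x, (z, x) ∈ q.tup j Z X ∧ z ∈ q.heavy P Z ∧
      ((ω (X, x)).1 = i ∨ x ∈ q.heavy P X) ∧ r = .tuple Z X 0 z x}
  -- The home of `x` forwards its heavy neighbours to the machines that hold tuples containing `x`.
  -- Requiring a third attribute `Y ≠ Z` excludes the case of two attributes, where this round could
  -- be too expensive.
  | 3, j, i => {r | ∃ Z X z x, (ω (X, x)).1 = j ∧ (z, x) ∈ q.rel Z X ∧ z ∈ q.heavy P Z ∧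
      (∃ Y y, Y ≠ Z ∧ (x, y) ∈ q.tup i X Y) ∧ r = .tuple Z X 0 z x}
  -- Each cell receives the light tuples in its buckets, and from the homes the values in its
  -- classes of isolated attributes. The two kinds differ in whether the two attributes are equal.
  | 4, j, i => {r | ∃ κ ∈ q.cells P, q.code P κ % p = i ∧
      ((∃ X Y x y, P.Adj X Y ∧ (x, y) ∈ q.tup j X Y ∧ q.Fits P ω κ X x ∧ q.Fits P ω κ Y y ∧
          r = .tuple X Y (q.code P κ) x y) ∨
        ∃ X x, (ω (X, x)).1 = j ∧ q.FitsIsolated P ω κ X x ∧ r = .tuple X X (q.code P κ) x x)}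
  | _, _, _ => ∅

/-- The join of the relations. -/
def result : Set (V → dom) := {u | ∀ X Y, P.Adj X Y → (u X, u Y) ∈ q.rel X Y}

/-- The value `x` of `X` belongs to a cell. -/
def Matches (κ : Cell V dom) (X : V) (x : dom) : Prop :=
  (X ∈ κ.1 → x = κ.2.1 X) ∧ (P.Isolated κ.1 X → q.FitsIsolated P ω κ X x) ∧
    (X ∉ κ.1 → ¬ P.Isolated κ.1 X → q.Fits P ω κ X x)

/-- The part of the join that a machine produces. -/
def output (i : Fin p) : Set (V → dom) :=
  {u ∈ q.result P | ∃ κ ∈ q.cells P, q.code P κ % p = i ∧ ∀ X, q.Matches P ω κ X (u X)}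

variable {q P ω}

theorem parts_pos {U : Finset V} {X : V} {z : dom} : 0 < q.parts P U X z := by
  unfold parts
  split_ifs <;> omega

theorem width_pos (hcap : 0 < P.cap) {U : Finset V} {η : V → dom} {X : V} :
    0 < P.width (q.parts P) U η X := by
  unfold Plan.width
  split_ifs
  · exact one_pos
  · exact parts_pos
  · exact hcap

theorem code_injOn : Set.InjOn (q.code P) (q.cells P) := index_injOn (Finset.finite_toSet _)

theorem code_lt {κ : Cell V dom} (h : κ ∈ q.cells P) : q.code P κ < #(q.cells P) := by
  rw [← Set.ncard_coe_finset]
  exact index_lt (Finset.finite_toSet _) (mem_coe.2 h)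

open Classical in
/-- Every tuple of the join is produced. -/
theorem iUnion_output (hcap : 0 < P.cap) (hp : 0 < p) : ⋃ i, q.output P ω i = q.result P := by
  refine Set.Subset.antisymm (Set.iUnion_subset fun i u hu => hu.1) fun u hu => ?_
  -- The cell of a result tuple is forced: `U` records where it is heavy, `η` its values there (with
  -- a fixed default elsewhere), `b` its light classes.
  set U : Finset V := {X | u X ∈ q.heavy P X} with hU
  have hmU : ∀ X, X ∈ U ↔ u X ∈ q.heavy P X := fun X => by simp [hU]
  set η : V → dom := fun X => if X ∈ U then u X else Classical.arbitrary dom with hη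
  set b : V → ℕ := fun X => if X ∈ U then 0 else if P.Isolated U X then
    index (q.candidates P ω (ω (X, u X)).1 U η X) (u X) % P.width (q.parts P) U η X
    else ((ω (X, u X)).2 : ℕ) with hb
  have hcomp : ∀ X, q.Compatible P U η X (u X) := by
    intro X Z hZ hZX
    simp only [hη, hZ, if_true]
    exact hu Z X hZX
  have hκ : (U, η, b) ∈ q.cells P := by
    refine Plan.mem_cellsOf.2 ⟨fun X => ?_, fun X => ?_⟩
    · by_cases h : X ∈ U
      · simp only [hη, h, if_true]
        exact (hmU X).1 h
      · simp [hη, h]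
    · by_cases h : X ∈ U
      · simp only [hb, h, if_true]
        exact width_pos hcap
      · by_cases h' : P.Isolated U X
        · simp only [hb, h, h', if_true, if_false]
          exact Nat.mod_lt _ (width_pos hcap)
        · simp [hb, h, h', Plan.width]
  refine Set.mem_iUnion.2 ⟨⟨q.code P (U, η, b) % p, Nat.mod_lt _ hp⟩, hu, _, hκ, rfl, fun X => ?_⟩
  refine ⟨fun h => ?_, fun h => ⟨h, ⟨rfl, ?_, hcomp X⟩, ?_⟩, fun h h' => ⟨h, ?_, ?_, hcomp X⟩⟩
  · have h : X ∈ U := h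
    simp [hη, h]
  · exact fun h' => h.1 ((hmU X).2 h')
  · have h1 : X ∉ U := h.1
    have h2 : P.Isolated U X := h
    simp [hb, h1, h2]
  · exact fun h' => h ((hmU X).2 h')
  · have h1 : X ∉ U := h
    have h2 : ¬ P.Isolated U X := h'
    simp [hb, h1, h2]

/-! #### Locality -/

variable (P ω) in
/-- Two placements look the same to machine `j` before round `t`. -/
def SameView (q q' : Placement V dom p) (j : Fin p) (t : ℕ) : Prop :=
  q.tup j = q'.tup j ∧ ∀ t' < t, ∀ j', q.records P ω t' j' j = q'.records P ω t' j' j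

variable {q' : Placement V dom p} {j : Fin p} {t : ℕ}

theorem SameView.symm (h : SameView P ω q q' j t) : SameView P ω q' q j t :=
  ⟨h.1.symm, fun t' ht' j' => (h.2 t' ht' j').symm⟩

theorem SameView.localSize_eq (h : SameView P ω q q' j t) : q.localSize j = q'.localSize j := by
  simp [localSize, h.1]

theorem SameView.localDeg_self (h : SameView P ω q q' j t) (X Y : V) (x : dom) :
    q.localDeg j X Y x = q'.localDeg j X Y x := by
  simp [localDeg, h.1]

/-- Each count carries no sender in its text, but the inbox separates senders, so every local size
is known. -/
theorem SameView.size_eq (h : SameView P ω q q' j t) (ht : 1 ≤ t) : q.size = q'.size := by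
  refine sum_congr rfl fun i _ => ?_
  have h1 : Rec.count (q.localSize i) ∈ q.records P ω 0 i j := Or.inl rfl
  rw [h.2 0 ht] at h1
  rcases h1 with h1 | ⟨X, Y, x, -, -, h1⟩
  · exact Rec.count.inj h1
  · exact absurd h1 (by simp)

/-- Zero degrees send no record, so only an inequality can be read off directly; equality follows by
exchanging the placements. The later inclusions are used in the same way. -/
theorem SameView.localDeg_le (h : SameView P ω q q' j t) (ht : 1 ≤ t) {X : V} {x : dom}
    (hx : (ω (X, x)).1 = j) (i : Fin p) (Y : V) : q.localDeg i X Y x ≤ q'.localDeg i X Y x := by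
  rcases Nat.eq_zero_or_pos (q.localDeg i X Y x) with h0 | h0
  · omega
  have h1 : Rec.tuple X Y (q.localDeg i X Y x) x x ∈ q.records P ω 0 i j :=
    Or.inr ⟨X, Y, x, hx, h0, rfl⟩
  rw [h.2 0 ht] at h1
  rcases h1 with h1 | ⟨X', Y', x', -, -, h1⟩
  · exact absurd h1 (by simp)
  · obtain ⟨rfl, rfl, h2, rfl, -⟩ := Rec.tuple.inj h1
    exact h2.le

theorem SameView.localDeg_eq (h : SameView P ω q q' j t) (ht : 1 ≤ t) {X : V} {x : dom}
    (hx : (ω (X, x)).1 = j) (i : Fin p) (Y : V) : q.localDeg i X Y x = q'.localDeg i X Y x :=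
  (h.localDeg_le ht hx i Y).antisymm (h.symm.localDeg_le ht hx i Y)

theorem SameView.deg_eq (h : SameView P ω q q' j t) (ht : 1 ≤ t) {X : V} {x : dom}
    (hx : (ω (X, x)).1 = j) (Y : V) : q.deg X Y x = q'.deg X Y x := by
  simp only [deg_eq_sum, h.localDeg_eq ht hx]

theorem SameView.mem_heavy_iff (h : SameView P ω q q' j t) (ht : 1 ≤ t) {X : V} {x : dom}
    (hx : (ω (X, x)).1 = j) : x ∈ q.heavy P X ↔ x ∈ q'.heavy P X := by
  simp only [mem_heavy, h.size_eq ht, h.deg_eq ht hx]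

/-- Round `1` is a broadcast, so unlike the degree lemmas this one needs no condition on the home of
`x`. -/
theorem SameView.heavy_deg (h : SameView P ω q q' j t) (ht : 2 ≤ t) {X : V} {x : dom}
    (hx : x ∈ q.heavy P X) (Y : V) : x ∈ q'.heavy P X ∧ q.deg X Y x = q'.deg X Y x := by
  have h1 : Rec.tuple X Y (q.deg X Y x) x x ∈ q.records P ω 1 (ω (X, x)).1 j :=
    ⟨X, Y, x, rfl, hx, rfl⟩
  rw [h.2 1 ht] at h1
  obtain ⟨X', Y', x', -, hx', h1⟩ := h1
  obtain ⟨rfl, rfl, h2, rfl, -⟩ := Rec.tuple.inj h1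
  exact ⟨hx', h2⟩

theorem SameView.heavy_eq (h : SameView P ω q q' j t) (ht : 2 ≤ t) : q.heavy P = q'.heavy P := by
  ext X x
  exact ⟨fun hx => (h.heavy_deg ht hx X).1, fun hx => (h.symm.heavy_deg ht hx X).1⟩

theorem SameView.parts_eq (h : SameView P ω q q' j t) (ht : 2 ≤ t) : q.parts P = q'.parts P := by
  ext U X z
  unfold parts
  rw [← h.heavy_eq ht, h.size_eq (by omega)]
  split_ifs with hz
  · rw [(h.heavy_deg ht hz X).2]
  · rfl

theorem SameView.cells_eq (h : SameView P ω q q' j t) (ht : 2 ≤ t) : q.cells P = q'.cells P := by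
  rw [cells, cells, h.heavy_eq ht, h.parts_eq ht]

theorem SameView.code_eq (h : SameView P ω q q' j t) (ht : 2 ≤ t) : q.code P = q'.code P := by
  funext κ
  rw [code, code, h.cells_eq ht]

/-- After round `2`, a machine knows the heavy neighbours of the values of which it is the home,
and of the heavy values. -/
theorem SameView.rel_of_home (h : SameView P ω q q' j t) (ht : 3 ≤ t) {Z X : V} {z x : dom}
    (hz : z ∈ q.heavy P Z) (hx : (ω (X, x)).1 = j ∨ x ∈ q.heavy P X) (hr : (z, x) ∈ q.rel Z X) :
    (z, x) ∈ q'.rel Z X := by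
  obtain ⟨i, hi⟩ := mem_rel.1 hr
  have h1 : Rec.tuple Z X 0 z x ∈ q.records P ω 2 i j := ⟨Z, X, z, x, hi, hz, hx, rfl⟩
  rw [h.2 2 ht] at h1
  obtain ⟨Z', X', z', x', hi', -, -, h1⟩ := h1
  obtain ⟨rfl, rfl, -, rfl, rfl⟩ := Rec.tuple.inj h1
  exact mem_rel.2 ⟨i, hi'⟩

/-- After round `3`, a machine knows the heavy neighbours of the values in its own tuples. -/
theorem SameView.rel_of_tup (h : SameView P ω q q' j t) (ht : 4 ≤ t) {Z X Y : V} {z x y : dom}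
    (hz : z ∈ q.heavy P Z) (hx : (x, y) ∈ q.tup j X Y) (hY : Y ≠ Z) (hr : (z, x) ∈ q.rel Z X) :
    (z, x) ∈ q'.rel Z X := by
  have h1 : Rec.tuple Z X 0 z x ∈ q.records P ω 3 (ω (X, x)).1 j :=
    ⟨Z, X, z, x, rfl, hr, hz, ⟨Y, y, hY, hx⟩, rfl⟩
  rw [h.2 3 ht] at h1
  obtain ⟨Z', X', z', x', -, hr', -, -, h1⟩ := h1
  obtain ⟨rfl, rfl, -, rfl, rfl⟩ := Rec.tuple.inj h1
  exact hr'

theorem heavy_of_mem_cells {κ : Cell V dom} (hκ : κ ∈ q.cells P) {Z : V} (hZ : Z ∈ κ.1) :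
    κ.2.1 Z ∈ q.heavy P Z := by
  have := (Plan.mem_cellsOf.1 hκ).1 Z
  rwa [if_pos hZ] at this

theorem SameView.candidates_subset (h : SameView P ω q q' j t) (ht : 3 ≤ t) {κ : Cell V dom}
    (hκ : κ ∈ q.cells P) (X : V) :
    q.candidates P ω j κ.1 κ.2.1 X ⊆ q'.candidates P ω j κ.1 κ.2.1 X := by
  rintro x ⟨h1, h2, h3⟩
  refine ⟨h1, by rwa [← h.heavy_eq (by omega)], fun Z hZ hZX => ?_⟩
  exact h.rel_of_home ht (heavy_of_mem_cells hκ hZ) (Or.inl h1) (h3 Z hZ hZX)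

theorem SameView.candidates_eq (h : SameView P ω q q' j t) (ht : 3 ≤ t) {κ : Cell V dom}
    (hκ : κ ∈ q.cells P) (X : V) :
    q.candidates P ω j κ.1 κ.2.1 X = q'.candidates P ω j κ.1 κ.2.1 X :=
  (h.candidates_subset ht hκ X).antisymm
    (h.symm.candidates_subset ht (h.cells_eq (by omega) ▸ hκ) X)

/-- Compatibility involves only `Z ∈ κ.1`; since `Y ∉ κ.1`, such a `Z` differs from `Y`, and the
records of round `3` are available. -/
theorem SameView.fits (h : SameView P ω q q' j t) (ht : 4 ≤ t) {κ : Cell V dom}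
    (hκ : κ ∈ q.cells P) {X Y : V} {x y : dom} (hx : (x, y) ∈ q.tup j X Y) (hY : Y ∉ κ.1)
    (hf : q.Fits P ω κ X x) : q'.Fits P ω κ X x := by
  obtain ⟨h1, h2, h3, h4⟩ := hf
  refine ⟨h1, by rwa [← h.heavy_eq (by omega)], h3, fun Z hZ hZX => ?_⟩
  exact h.rel_of_tup ht (heavy_of_mem_cells hκ hZ) hx (fun e => hY (e ▸ hZ)) (h4 Z hZ hZX)

theorem SameView.records_zero_subset (h : SameView P ω q q' j 0) (i : Fin p) :
    q.records P ω 0 j i ⊆ q'.records P ω 0 j i := by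
  rintro r (rfl | ⟨X, Y, x, h1, h2, rfl⟩)
  · exact Or.inl (by rw [h.localSize_eq])
  · exact Or.inr ⟨X, Y, x, h1, h.localDeg_self X Y x ▸ h2, by rw [h.localDeg_self]⟩

theorem SameView.records_one_subset (h : SameView P ω q q' j 1) (i : Fin p) :
    q.records P ω 1 j i ⊆ q'.records P ω 1 j i := by
  rintro r ⟨X, Y, x, h1, h2, rfl⟩
  exact ⟨X, Y, x, h1, (h.mem_heavy_iff le_rfl h1).1 h2, by rw [h.deg_eq le_rfl h1]⟩

theorem SameView.records_two_subset (h : SameView P ω q q' j 2) (i : Fin p) :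
    q.records P ω 2 j i ⊆ q'.records P ω 2 j i := by
  rintro r ⟨Z, X, z, x, h1, h2, h3, rfl⟩
  rw [h.1] at h1
  rw [h.heavy_eq le_rfl] at h2 h3
  exact ⟨Z, X, z, x, h1, h2, h3, rfl⟩

theorem SameView.records_three_subset (h : SameView P ω q q' j 3) (i : Fin p) :
    q.records P ω 3 j i ⊆ q'.records P ω 3 j i := by
  rintro r ⟨Z, X, z, x, h1, h2, h3, ⟨Y, y, h4, h5⟩, rfl⟩
  refine ⟨Z, X, z, x, h1, h.rel_of_home le_rfl h3 (Or.inl h1) h2, ?_, ?_, rfl⟩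
  · rwa [← h.heavy_eq (by omega)]
  -- Whether machine `i` holds a tuple with `x` is known at the home from the local degrees of round
  -- `0`; the witness `y` may change.
  · have h6 := localDeg_pos.2 ⟨y, h5⟩
    rw [h.localDeg_eq (by omega) h1] at h6
    obtain ⟨y', hy'⟩ := localDeg_pos.1 h6
    exact ⟨Y, y', h4, hy'⟩

theorem SameView.records_four_subset (h : SameView P ω q q' j 4) (i : Fin p) :
    q.records P ω 4 j i ⊆ q'.records P ω 4 j i := by
  rintro r ⟨κ, hκ, hi, hr⟩
  have hcells := h.cells_eq (by omega)
  have hcode := h.code_eq (by omega)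
  refine ⟨κ, hcells ▸ hκ, hcode ▸ hi, ?_⟩
  rcases hr with ⟨X, Y, x, y, h1, h2, h3, h4, rfl⟩ | ⟨X, x, h1, h2, rfl⟩
  · exact Or.inl ⟨X, Y, x, y, h1, h.1 ▸ h2, h.fits le_rfl hκ h2 h4.1 h3,
      h.fits le_rfl hκ (q.symm h2) h3.1 h4, by rw [hcode]⟩
  · refine Or.inr ⟨X, x, h1, ?_, by rw [hcode]⟩
    unfold FitsIsolated at h2 ⊢
    rwa [h1, ← h.candidates_eq (by omega) hκ, ← h.parts_eq (by omega), ← h1]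

theorem SameView.records_subset (ht : t < 5) (h : SameView P ω q q' j t) (i : Fin p) :
    q.records P ω t j i ⊆ q'.records P ω t j i := by
  interval_cases t
  · exact h.records_zero_subset i
  · exact h.records_one_subset i
  · exact h.records_two_subset i
  · exact h.records_three_subset i
  · exact h.records_four_subset i

theorem SameView.records_eq (ht : t < 5) (h : SameView P ω q q' j t) (i : Fin p) :
    q.records P ω t j i = q'.records P ω t j i :=
  (h.records_subset ht i).antisymm (h.symm.records_subset ht i)

/-- The pair arrived in round `4` under the code of `κ`. Codes determine cells, and a pair of
distinct attributes cannot come from an isolated class, so the record certifies the same facts for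
`q'`. -/
theorem SameView.fits_of_output (h : SameView P ω q q' j 5) {u : V → dom} {κ : Cell V dom}
    (hu : u ∈ q.result P) (hκ : κ ∈ q.cells P) (hj : q.code P κ % p = j) {X Y : V}
    (hXY : P.Adj X Y) (hX : q.Fits P ω κ X (u X)) (hY : q.Fits P ω κ Y (u Y)) :
    (u X, u Y) ∈ q'.rel X Y ∧ q'.Fits P ω κ X (u X) ∧ q'.Fits P ω κ Y (u Y) := by
  obtain ⟨i, hi⟩ := mem_rel.1 (hu X Y hXY)
  have h1 : Rec.tuple X Y (q.code P κ) (u X) (u Y) ∈ q.records P ω 4 i j :=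
    ⟨κ, hκ, hj, Or.inl ⟨X, Y, _, _, hXY, hi, hX, hY, rfl⟩⟩
  rw [h.2 4 (by omega), h.code_eq (by omega)] at h1
  obtain ⟨κ', hκ', -, ⟨X', Y', x', y', hA, h2, h3, h4, h5⟩ | ⟨X', x', -, -, h5⟩⟩ := h1
  · obtain ⟨rfl, rfl, hc, rfl, rfl⟩ := Rec.tuple.inj h5
    rw [h.cells_eq (by omega)] at hκ
    obtain rfl := code_injOn hκ hκ' hc
    exact ⟨mem_rel.2 ⟨i, h2⟩, h3, h4⟩
  · obtain ⟨rfl, rfl, -⟩ := Rec.tuple.inj h5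
    exact absurd rfl (q.ne hi)

theorem SameView.fitsIsolated_of_output (h : SameView P ω q q' j 5) {κ : Cell V dom}
    (hκ : κ ∈ q.cells P) (hj : q.code P κ % p = j) {X : V} {x : dom}
    (hX : q.FitsIsolated P ω κ X x) : q'.FitsIsolated P ω κ X x := by
  have h1 : Rec.tuple X X (q.code P κ) x x ∈ q.records P ω 4 (ω (X, x)).1 j :=
    ⟨κ, hκ, hj, Or.inr ⟨X, x, rfl, hX, rfl⟩⟩
  rw [h.2 4 (by omega), h.code_eq (by omega)] at h1
  obtain ⟨κ', hκ', -, ⟨X', Y', x', y', hA, h2, h3, h4, h5⟩ | ⟨X', x', -, h3, h5⟩⟩ := h1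
  · obtain ⟨rfl, rfl, -⟩ := Rec.tuple.inj h5
    exact absurd rfl (q'.ne h2)
  · obtain ⟨rfl, -, hc, rfl, -⟩ := Rec.tuple.inj h5
    rw [h.cells_eq (by omega)] at hκ
    obtain rfl := code_injOn hκ hκ' hc
    exact h3

/-- Every condition on `u` is certified by something received. Pairs of light values arrive in round
`4`; a light attribute that is not isolated has a light neighbour, hence its fit arrives with such a
pair. A heavy-light pair is part of the compatibility of the light value, and a heavy-heavy pair was
broadcast in round `2`. -/
theorem SameView.output_subset (hsymm : ∀ X Y, P.Adj X Y → P.Adj Y X)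
    (h : SameView P ω q q' j 5) : q.output P ω j ⊆ q'.output P ω j := by
  rintro u ⟨hu, κ, hκ, hj, hm⟩
  have hnb : ∀ X, X ∉ κ.1 → ¬ P.Isolated κ.1 X → ∃ Y, P.Adj X Y ∧ Y ∉ κ.1 := by
    intro X hX hI
    by_contra! hcon
    exact hI ⟨hX, hcon⟩
  have hniso : ∀ X Y, P.Adj X Y → Y ∉ κ.1 → ¬ P.Isolated κ.1 X := fun X Y hXY hY hI =>
    hY (hI.2 Y hXY)
  have hfit : ∀ X Y, P.Adj X Y → X ∉ κ.1 → Y ∉ κ.1 →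
      (u X, u Y) ∈ q'.rel X Y ∧ q'.Fits P ω κ X (u X) := by
    intro X Y hXY hX hY
    have := h.fits_of_output hu hκ hj hXY ((hm X).2.2 hX (hniso X Y hXY hY))
      ((hm Y).2.2 hY (hniso Y X (hsymm _ _ hXY) hX))
    exact ⟨this.1, this.2.1⟩
  have hm' : ∀ X, q'.Matches P ω κ X (u X) := by
    refine fun X => ⟨(hm X).1, fun hI => h.fitsIsolated_of_output hκ hj ((hm X).2.1 hI),
      fun hX hI => ?_⟩
    obtain ⟨Y, hXY, hY⟩ := hnb X hX hI
    exact (hfit X Y hXY hX hY).2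
  have hcomp : ∀ X, X ∉ κ.1 → q'.Compatible P κ.1 κ.2.1 X (u X) := by
    intro X hX
    by_cases hI : P.Isolated κ.1 X
    · exact ((hm' X).2.1 hI).2.1.2.2
    · exact ((hm' X).2.2 hX hI).2.2.2
  have hhl : ∀ X Y, P.Adj X Y → X ∈ κ.1 → (u X, u Y) ∈ q'.rel X Y := by
    intro X Y hXY hX
    by_cases hY : Y ∈ κ.1
    · have hX' := heavy_of_mem_cells hκ hX
      have hY' := heavy_of_mem_cells hκ hY
      have := hu X Y hXY
      rw [(hm X).1 hX, (hm Y).1 hY] at this ⊢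
      exact h.rel_of_home (by omega) hX' (Or.inr hY') this
    · have := hcomp Y hY X hX hXY
      rwa [← (hm X).1 hX] at this
  refine ⟨fun X Y hXY => ?_, κ, h.cells_eq (by omega) ▸ hκ, h.code_eq (by omega) ▸ hj, hm'⟩
  by_cases hX : X ∈ κ.1
  · exact hhl X Y hXY hX
  by_cases hY : Y ∈ κ.1
  · exact rel_symm (hhl Y X (hsymm _ _ hXY) hY)
  · exact (hfit X Y hXY hX hY).1

theorem SameView.output_eq (hsymm : ∀ X Y, P.Adj X Y → P.Adj Y X)
    (h : SameView P ω q q' j 5) : q.output P ω j = q'.output P ω j :=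
  (h.output_subset hsymm).antisymm (h.symm.output_subset hsymm)

/-! #### Values in messages -/

variable (q) in
/-- The values that a machine has before round `t`. -/
def known (P : Plan V) (ω : Seed V dom p P.cap) (j : Fin p) (t : ℕ) : Set dom :=
  {x | (∃ X Y y, (x, y) ∈ q.tup j X Y) ∨
    ∃ t' < t, ∃ j', ∃ r ∈ q.records P ω t' j' j, x ∈ r.vals}

theorem home_known {X Y : V} {x y : dom} (h : (x, y) ∈ q.rel X Y) (ht : 1 ≤ t) :
    x ∈ q.known P ω (ω (X, x)).1 t := by
  obtain ⟨i, hi⟩ := mem_rel.1 h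
  exact Or.inr ⟨0, ht, i, _, Or.inr ⟨X, Y, x, rfl, localDeg_pos.2 ⟨y, hi⟩, rfl⟩, Or.inl rfl⟩

theorem heavy_known {X : V} {x : dom} (h : x ∈ q.heavy P X) (ht : 2 ≤ t) :
    x ∈ q.known P ω j t :=
  Or.inr ⟨1, ht, (ω (X, x)).1, _, ⟨X, X, x, rfl, h, rfl⟩, Or.inl rfl⟩

theorem exists_rel_of_heavy {X : V} {x : dom} (h : x ∈ q.heavy P X) : ∃ Y y, (x, y) ∈ q.rel X Y := by
  obtain ⟨Y, hY, -⟩ := mem_heavy.1 h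
  exact ⟨Y, deg_pos.1 hY⟩

/-- A host of an isolated attribute. -/
def _root_.MPCJoin.Plan.Valid (P : Plan V) : Prop :=
  (∀ X Y, P.Adj X Y → P.Adj Y X) ∧ (∀ X Y, P.Adj X Y → X ≠ Y) ∧
    ∀ U X, P.Isolated U X → P.Adj X (P.host U X)

theorem FitsIsolated.host_mem (hP : P.Valid) {κ : Cell V dom} {X : V} {x : dom}
    (h : q.FitsIsolated P ω κ X x) : (κ.2.1 (P.host κ.1 X), x) ∈ q.rel (P.host κ.1 X) X := by
  have h1 := hP.2.2 _ _ h.1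
  exact h.2.1.2.2 _ (h.1.2 _ h1) (hP.1 _ _ h1)

/-- A sender holds a value through its own tuples, or as the home that heard of it in round `0`, or
through the broadcast of heavy values. -/
theorem vals_known (hP : P.Valid) (ht : t < 5) {i : Fin p} {r : Rec V dom} (hr : r ∈ q.records P ω t j i)
    {x : dom} (hx : x ∈ r.vals) : x ∈ q.known P ω j t := by
  interval_cases t
  · rcases hr with rfl | ⟨X, Y, x', -, h, rfl⟩
    · exact absurd hx (Set.notMem_empty _)
    · obtain ⟨y, hy⟩ := localDeg_pos.1 h
      rcases hx with rfl | rfl <;> exact Or.inl ⟨X, Y, y, hy⟩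
  · obtain ⟨X, Y, x', h, h', rfl⟩ := hr
    obtain ⟨Y', y', hy'⟩ := exists_rel_of_heavy h'
    have := home_known (P := P) (ω := ω) (t := 1) hy' le_rfl
    rw [h] at this
    rcases hx with rfl | rfl <;> exact this
  · obtain ⟨Z, X, z, x', h, -, -, rfl⟩ := hr
    rcases hx with rfl | rfl
    · exact Or.inl ⟨Z, X, x', h⟩
    · exact Or.inl ⟨X, Z, z, q.symm h⟩
  · obtain ⟨Z, X, z, x', h, h', h'', -, rfl⟩ := hr
    rcases hx with rfl | rfl
    · exact heavy_known h'' (by omega)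
    · rw [← h]
      exact home_known (rel_symm h') (by omega)
  · obtain ⟨κ, -, -, ⟨X, Y, x', y', -, h, -, -, rfl⟩ | ⟨X, x', h, h', rfl⟩⟩ := hr
    · rcases hx with rfl | rfl
      · exact Or.inl ⟨X, Y, y', h⟩
      · exact Or.inl ⟨Y, X, x', q.symm h⟩
    · have := home_known (P := P) (ω := ω) (t := 4) (rel_symm (h'.host_mem hP)) (by omega)
      rw [h] at this
      rcases hx with rfl | rfl <;> exact this

theorem output_known (hP : P.Valid) {u : V → dom} (hu : u ∈ q.output P ω j) (X : V) :
    u X ∈ q.known P ω j 5 := by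
  obtain ⟨hu, κ, hκ, hj, hm⟩ := hu
  by_cases hX : X ∈ κ.1
  · have := heavy_of_mem_cells hκ hX
    rw [← (hm X).1 hX] at this
    exact heavy_known this (by omega)
  by_cases hI : P.Isolated κ.1 X
  · exact Or.inr ⟨4, by omega, _, _, ⟨κ, hκ, hj, Or.inr ⟨X, _, rfl, (hm X).2.1 hI, rfl⟩⟩,
      Or.inl rfl⟩
  · obtain ⟨Y, hXY, hY⟩ : ∃ Y, P.Adj X Y ∧ Y ∉ κ.1 := by
      by_contra! hcon
      exact hI ⟨hX, hcon⟩
    obtain ⟨i, hi⟩ := mem_rel.1 (hu X Y hXY)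
    have hYI : ¬ P.Isolated κ.1 Y := fun h => hX (h.2 X (hP.1 _ _ hXY))
    exact Or.inr ⟨4, by omega, i, _, ⟨κ, hκ, hj, Or.inl ⟨X, Y, _, _, hXY, hi,
      (hm X).2.2 hX hI, (hm Y).2.2 hY hYI, rfl⟩⟩, Or.inl rfl⟩

end Placement

end Core

end MPCJoin

namespace MPCJoin

/-! ### The number of cells. -/

section Counting

open Finset

/-- A machine's incoming records are bounded by embedding them, tagged with their senders, into one
explicit finite set. -/
theorem sum_ncard_le {ι R : Type} [Fintype ι] {S : ι → Set R} {F : Finset (ι × R)}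
    (h : ∀ j, ∀ r ∈ S j, (j, r) ∈ F) :
    (∀ j, (S j).Finite) ∧ ∑ j, (S j).ncard ≤ #F := by
  classical
  have hfin : ∀ j, (S j).Finite := fun j =>
    ((Finset.finite_toSet F).preimage (f := Prod.mk j)
      (fun a _ b _ hab => (Prod.mk.inj hab).2)).subset fun r hr => h j r hr
  refine ⟨hfin, ?_⟩
  calc ∑ j, (S j).ncard = ∑ j, #((hfin j).toFinset) :=
        sum_congr rfl fun j _ => Set.ncard_eq_toFinset_card _ (hfin j)
    _ = #(univ.sigma fun j => (hfin j).toFinset) := (card_sigma _ _).symm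
    _ ≤ #F := card_le_card_of_injOn (fun a => (a.1, a.2))
        (fun a ha => h _ _ ((hfin a.1).mem_toFinset.1 (mem_sigma.1 ha).2))
        (by rintro ⟨a, b⟩ _ ⟨a', b'⟩ _ hab; simpa using hab)

/-- The total number of combinations of parts, if part sizes are proportional to `a` and `f ≥ 1`
attributes have the same host. -/
theorem sum_prod_one_add_le {α β : Type} (H : Finset α) (F : Finset β) (hF : F.Nonempty)
    (a : β → α → ℝ) {k l : ℝ} (hk : 0 ≤ k) (hl : 1 ≤ l) (hH : (#H : ℝ) ≤ k * l)
    (ha0 : ∀ X ∈ F, ∀ z ∈ H, 0 ≤ a X z) (ha : ∀ X ∈ F, ∀ z ∈ H, a X z ≤ l ^ 2)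
    (hsum : ∀ X ∈ F, ∑ z ∈ H, a X z ≤ l ^ 2) :
    ∑ z ∈ H, ∏ X ∈ F, (a X z + 1) ≤ (k + 2) ^ #F * l ^ (2 * #F) := by
  classical
  obtain ⟨X0, hX0⟩ := hF
  obtain ⟨f, hf⟩ : ∃ f, #F = f + 1 := ⟨#F - 1, by have := card_pos.2 ⟨X0, hX0⟩; omega⟩
  have hl2 : 1 ≤ l ^ 2 := one_le_pow₀ hl
  -- One factor is kept for the sum over `z`; the others are bounded pointwise by `2 * l ^ 2`. The
  -- sum of the kept factor is at most `l ^ 2 + k * l`.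
  have h1 : ∀ z ∈ H, ∏ X ∈ F, (a X z + 1) ≤ (a X0 z + 1) * (2 * l ^ 2) ^ f := by
    intro z hz
    rw [← mul_prod_erase F _ hX0]
    have h2 : ∏ X ∈ F.erase X0, (a X z + 1) ≤ (2 * l ^ 2) ^ f := by
      have h3 : #(F.erase X0) = f := by rw [card_erase_of_mem hX0, hf]; rfl
      rw [← h3]
      rw [← prod_const]
      refine prod_le_prod (fun X hX => ?_) fun X hX => ?_
      · have := ha0 X (mem_of_mem_erase hX) z hz
        linarith
      · have := ha X (mem_of_mem_erase hX) z hz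
        linarith
    exact mul_le_mul_of_nonneg_left h2 (by have := ha0 X0 hX0 z hz; linarith)
  calc ∑ z ∈ H, ∏ X ∈ F, (a X z + 1) ≤ ∑ z ∈ H, (a X0 z + 1) * (2 * l ^ 2) ^ f := sum_le_sum h1
    _ = (∑ z ∈ H, a X0 z + #H) * (2 * l ^ 2) ^ f := by
        rw [← sum_mul, sum_add_distrib]; simp
    _ ≤ ((k + 1) * l ^ 2) * (2 * l ^ 2) ^ f := by
        gcongr
        have := hsum X0 hX0
        nlinarith
    _ ≤ ((k + 2) * l ^ 2) * ((k + 2) * l ^ 2) ^ f := by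
        gcongr <;> linarith
    _ = (k + 2) ^ #F * l ^ (2 * #F) := by
        rw [hf, ← pow_succ', mul_pow, ← pow_mul]

end Counting

namespace Placement

open Finset

set_option linter.unusedSectionVars false

variable {V dom : Type} {p : ℕ} [Fintype V] [DecidableEq V] [DecidableEq dom]
  {q : Placement V dom p} {P : Plan V}

theorem card_rel_le_size (X Y : V) : #(q.rel X Y) ≤ q.size := by
  refine card_biUnion_le.trans (sum_le_sum fun i _ => ?_)
  exact (single_le_sum (f := fun Y => #(q.tup i X Y)) (fun _ _ => Nat.zero_le _)
    (mem_univ Y)).trans (single_le_sum (f := fun X => ∑ Y, #(q.tup i X Y))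
    (fun _ _ => Nat.zero_le _) (mem_univ X))

theorem sum_deg_le_size (X Y : V) (H : Finset dom) : ∑ x ∈ H, q.deg X Y x ≤ q.size := by
  refine le_trans ?_ (card_rel_le_size (q := q) X Y)
  simp only [deg]
  rw [← card_biUnion]
  · exact card_le_card (biUnion_subset.2 fun x _ => filter_subset _ _)
  · intro x _ x' _ hxx'
    exact disjoint_left.2 fun a ha ha' =>
      hxx' ((mem_filter.1 ha).2.symm.trans (mem_filter.1 ha').2)

theorem deg_le_size (X Y : V) (x : dom) : q.deg X Y x ≤ q.size := by
  simpa using sum_deg_le_size (q := q) X Y {x}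

/-- For each neighbour the degrees sum to at most `size`, so at most `lam` values reach `size /
lam`. -/
theorem card_heavy_le (hlam : 0 ≤ P.lam) (hsize : 0 < q.size) (X : V) :
    (#(q.heavy P X) : ℝ) ≤ Fintype.card V * P.lam := by
  have h0 : (0 : ℝ) < q.size := by exact_mod_cast hsize
  have h1 : ∀ Y, (#{x ∈ (q.rel X Y).image Prod.fst | (q.size : ℝ) ≤ q.deg X Y x * P.lam} : ℝ) ≤
      P.lam := by
    intro Y
    set S : Finset dom := {x ∈ (q.rel X Y).image Prod.fst | (q.size : ℝ) ≤ q.deg X Y x * P.lam}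
    have h2 : (#S : ℝ) * q.size ≤ P.lam * q.size :=
      calc (#S : ℝ) * q.size = ∑ x ∈ S, (q.size : ℝ) := by simp
        _ ≤ ∑ x ∈ S, (q.deg X Y x * P.lam : ℝ) := sum_le_sum fun x hx => (mem_filter.1 hx).2
        _ = P.lam * ((∑ x ∈ S, q.deg X Y x : ℕ) : ℝ) := by
            rw [← sum_mul, mul_comm, Nat.cast_sum]
        _ ≤ P.lam * q.size := by
            gcongr
            exact sum_deg_le_size X Y S
    exact le_of_mul_le_mul_right h2 h0
  calc (#(q.heavy P X) : ℝ)
      ≤ ∑ Y, (#{x ∈ (q.rel X Y).image Prod.fst | (q.size : ℝ) ≤ q.deg X Y x * P.lam} : ℝ) := by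
        exact_mod_cast card_biUnion_le
    _ ≤ ∑ _Y : V, P.lam := sum_le_sum fun Y _ => h1 Y
    _ = Fintype.card V * P.lam := by simp

theorem parts_le (U : Finset V) (X : V) {z : dom} (hz : z ∈ q.heavy P (P.host U X)) :
    (q.parts P U X z : ℝ) ≤ q.deg (P.host U X) X z * P.lam ^ 2 / q.size + 1 := by
  rw [parts, if_pos hz]
  push_cast
  gcongr
  exact Nat.floor_le (by positivity)

/-- The number of combinations of a heavy value of `Z` with classes of the attributes in `F`,
which all have the host `Z`. -/
theorem sum_prod_parts_le (hlam : 1 ≤ P.lam) (hsize : 0 < q.size) {U F : Finset V} {Z : V}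
    (hF : ∀ X ∈ F, P.host U X = Z) :
    ∑ z ∈ q.heavy P Z, ∏ X ∈ F, (q.parts P U X z : ℝ) ≤
      (Fintype.card V + 2) ^ (#F + 1) * P.lam ^ (2 * #F + if F = ∅ then 1 else 0) := by
  have h0 : (0 : ℝ) < q.size := by exact_mod_cast hsize
  have hl0 : 0 ≤ P.lam := by linarith
  -- An attribute that hosts nothing contributes just its number of heavy values, hence one power of
  -- `lam`.
  rcases F.eq_empty_or_nonempty with rfl | hne
  · simp only [prod_empty, sum_const, nsmul_eq_mul, mul_one, card_empty, if_true]
    refine (card_heavy_le hl0 hsize Z).trans ?_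
    simp only [zero_add, pow_one, mul_zero]
    gcongr
    linarith
  · have h1 : ∀ H : Finset dom, ∀ X,
        ∑ z ∈ H, (q.deg Z X z * P.lam ^ 2 / q.size : ℝ) ≤ P.lam ^ 2 := by
      intro H X
      rw [← sum_div, ← sum_mul, div_le_iff₀ h0, mul_comm]
      gcongr
      exact_mod_cast sum_deg_le_size Z X H
    calc ∑ z ∈ q.heavy P Z, ∏ X ∈ F, (q.parts P U X z : ℝ)
        ≤ ∑ z ∈ q.heavy P Z, ∏ X ∈ F, (q.deg Z X z * P.lam ^ 2 / q.size + 1 : ℝ) := by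
          refine sum_le_sum fun z hz => prod_le_prod (fun _ _ => Nat.cast_nonneg _) fun X hX => ?_
          have := parts_le (q := q) (P := P) U X (z := z) (by rwa [hF X hX])
          rwa [hF X hX] at this
      _ ≤ (Fintype.card V + 2) ^ #F * P.lam ^ (2 * #F) :=
          sum_prod_one_add_le _ _ hne _ (Nat.cast_nonneg _) hlam (card_heavy_le hl0 hsize Z)
            (fun X _ z _ => by positivity)
            (fun X _ z _ => by simpa using h1 {z} X) (fun X _ => h1 _ X)
      _ ≤ _ := by
          rw [if_neg hne.ne_empty, add_zero]
          gcongr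
          · have : (0 : ℝ) ≤ Fintype.card V := Nat.cast_nonneg _
            linarith
          · omega

open Classical in
/-- The isolated attributes. -/
noncomputable def _root_.MPCJoin.Plan.isolated (P : Plan V) (U : Finset V) : Finset V :=
  {X | P.Isolated U X}

theorem _root_.MPCJoin.Plan.mem_isolated {U : Finset V} {X : V} :
    X ∈ P.isolated U ↔ P.Isolated U X := by
  simp [Plan.isolated]

variable [Nonempty dom]

-- Grouping isolated attributes by host makes the sum over `η` factor over attributes. In the
-- exponent, the rest contributes `#T`, the fibres `2 * #I`, and the attributes of `U` that are no
-- hosts `#U - #image`; the total is `|V| + #I - #image`.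
open Classical in
theorem sum_prod_width_le (hP : P.Valid) (hlam : 1 ≤ P.lam) (hcap : (P.cap : ℝ) ≤ 2 * P.lam)
    (hsize : 0 < q.size) (U : Finset V) :
    ∑ η ∈ Fintype.piFinset fun X => if X ∈ U then q.heavy P X else {Classical.arbitrary dom},
      ∏ X, (P.width (q.parts P) U η X : ℝ) ≤
      (Fintype.card V + 2) ^ Fintype.card V * P.lam ^
        (Fintype.card V + #(P.isolated U) - #((P.isolated U).image (P.host U))) := by
  set I := P.isolated U with hI
  set fib : V → Finset V := fun Z => {X ∈ I | P.host U X = Z} with hfib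
  have hIU : Disjoint U I := disjoint_left.2 fun X hX hX' => (Plan.mem_isolated.1 hX').1 hX
  have himage : I.image (P.host U) ⊆ U := by
    intro Z hZ
    obtain ⟨X, hX, rfl⟩ := mem_image.1 hZ
    have := Plan.mem_isolated.1 hX
    exact this.2 _ (hP.2.2 _ _ this)
  set T := (univ : Finset V) \ (U ∪ I) with hT
  have hcard : #U + #I + #T = Fintype.card V := by
    have h : #T + #(U ∪ I) = #(univ : Finset V) :=
      card_sdiff_add_card_eq_card (subset_univ (U ∪ I))
    rw [card_union_of_disjoint hIU, card_univ] at h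
    omega
  have hprod : ∀ η : V → dom, ∏ X, (P.width (q.parts P) U η X : ℝ) =
      (P.cap : ℝ) ^ #T * ∏ Z, ∏ X ∈ fib Z, (q.parts P U X (η Z) : ℝ) := by
    intro η
    have h1 : ∏ Z, ∏ X ∈ fib Z, (q.parts P U X (η Z) : ℝ) =
        ∏ X ∈ I, (q.parts P U X (η (P.host U X)) : ℝ) := by
      rw [← prod_fiberwise I (P.host U)]
      exact prod_congr rfl fun Z _ => prod_congr rfl fun X hX => by rw [(mem_filter.1 hX).2]
    rw [h1, ← prod_const, ← prod_sdiff (subset_univ (U ∪ I)), prod_union hIU]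
    congr 1
    · refine prod_congr rfl fun X hX => ?_
      have h2 := not_or.1 (mt mem_union.2 (mem_sdiff.1 hX).2)
      have h3 := mt Plan.mem_isolated.2 h2.2
      simp [Plan.width, h2.1, h3]
    · rw [prod_eq_one fun X hX => by simp [Plan.width, hX], one_mul]
      refine prod_congr rfl fun X hX => ?_
      have h2 := Plan.mem_isolated.1 hX
      simp [Plan.width, h2.1, h2]
  have hZ : ∀ Z, ∑ z ∈ (if Z ∈ U then q.heavy P Z else {Classical.arbitrary dom}),
      ∏ X ∈ fib Z, (q.parts P U X z : ℝ) ≤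
      if Z ∈ U then (Fintype.card V + 2 : ℝ) ^ (#(fib Z) + 1) *
        P.lam ^ (2 * #(fib Z) + if fib Z = ∅ then 1 else 0) else 1 := by
    intro Z
    by_cases h : Z ∈ U
    · rw [if_pos h, if_pos h]
      exact sum_prod_parts_le hlam hsize fun X hX => (mem_filter.1 hX).2
    · rw [if_neg h, if_neg h]
      have : fib Z = ∅ := filter_false_of_mem fun X hX hXZ =>
        h (himage (hXZ ▸ mem_image_of_mem _ hX))
      simp [this]
  have hfsum : ∑ Z ∈ U, #(fib Z) = #I :=
    (card_eq_sum_card_fiberwise fun X hX => himage (mem_image_of_mem _ hX)).symm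
  have hesum : ∑ Z ∈ U, (if fib Z = ∅ then 1 else 0) = #U - #(I.image (P.host U)) := by
    rw [← card_filter, ← card_sdiff_of_subset himage]
    congr 1
    ext Z
    simp only [mem_filter, mem_sdiff, mem_image, not_exists, not_and, hfib, filter_eq_empty_iff]
  simp only [hprod]
  rw [← mul_sum, ← prod_univ_sum (fun Z => if Z ∈ U then q.heavy P Z else {Classical.arbitrary dom})
    (fun Z z => ∏ X ∈ fib Z, (q.parts P U X z : ℝ))]
  calc (P.cap : ℝ) ^ #T * ∏ Z, ∑ z ∈ (if Z ∈ U then q.heavy P Z else {Classical.arbitrary dom}),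
        ∏ X ∈ fib Z, (q.parts P U X z : ℝ)
      ≤ ((Fintype.card V + 2) * P.lam) ^ #T *
        ∏ Z, if Z ∈ U then (Fintype.card V + 2 : ℝ) ^ (#(fib Z) + 1) *
        P.lam ^ (2 * #(fib Z) + if fib Z = ∅ then 1 else 0) else 1 := by
        gcongr with Z
        · have : (0 : ℝ) ≤ Fintype.card V := Nat.cast_nonneg _
          nlinarith
        · exact hZ Z
    _ = (Fintype.card V + 2) ^ (#T + (#I + #U)) *
        P.lam ^ (#T + (2 * #I + (#U - #(I.image (P.host U))))) := by
        rw [prod_ite_mem, univ_inter, prod_mul_distrib, prod_pow_eq_pow_sum, prod_pow_eq_pow_sum,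
          sum_add_distrib, sum_add_distrib, ← mul_sum, hfsum, hesum, sum_const, smul_eq_mul,
          mul_one, mul_pow, pow_add, pow_add]
        ring
    _ = _ := by
        have h1 := card_le_card himage
        congr 2 <;> omega

/-- The host condition bounds the exponent of `lam` by `r` for every `U`, and `lam ^ r = p`; there
are `2 ^ |V|` sets `U`. -/
theorem card_cells_le (hP : P.Valid) (hlam : 1 ≤ P.lam) (hcap : (P.cap : ℝ) ≤ 2 * P.lam)
    (hsize : 0 < q.size) {r : ℝ}
    (hhost : ∀ U, (Fintype.card V : ℝ) + #(P.isolated U) ≤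
      r + #((P.isolated U).image (P.host U))) (hp : P.lam ^ r = p) :
    (#(q.cells P) : ℝ) ≤ 2 ^ Fintype.card V * (Fintype.card V + 2) ^ Fintype.card V * p := by
  classical
  have h1 : (#(q.cells P) : ℝ) ≤ ∑ U : Finset V,
      ∑ η ∈ Fintype.piFinset fun X => if X ∈ U then q.heavy P X else {Classical.arbitrary dom},
        ∏ X, (P.width (q.parts P) U η X : ℝ) := by
    have : #(q.cells P) ≤ ∑ U : Finset V,
      ∑ η ∈ Fintype.piFinset fun X => if X ∈ U then q.heavy P X else {Classical.arbitrary dom},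
        ∏ X, P.width (q.parts P) U η X := by
      refine card_biUnion_le.trans (sum_le_sum fun U _ => ?_)
      refine card_biUnion_le.trans (sum_le_sum fun η _ => ?_)
      refine card_image_le.trans ?_
      simp
    exact_mod_cast this
  refine h1.trans ?_
  calc _ ≤ ∑ U : Finset V, ((Fintype.card V + 2) ^ Fintype.card V * p : ℝ) := by
        refine sum_le_sum fun U _ => (sum_prod_width_le hP hlam hcap hsize U).trans ?_
        gcongr
        rw [← hp, ← Real.rpow_natCast]
        refine Real.rpow_le_rpow_of_exponent_le hlam ?_
        have h2 : #((P.isolated U).image (P.host U)) ≤ #(P.isolated U) := card_image_le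
        rw [Nat.cast_sub (by omega), Nat.cast_add]
        have := hhost U
        linarith
    _ = _ := by
        rw [sum_const, card_univ, Fintype.card_finset, nsmul_eq_mul]
        push_cast
        ring

end Placement

end MPCJoin

namespace MPCJoin

/-! ### The load of each round for a good seed. -/

namespace Placement

open Finset

set_option linter.unusedSectionVars false

variable {V dom : Type} {p : ℕ} [Fintype V] [DecidableEq V] [DecidableEq dom]
  (q : Placement V dom p) (P : Plan V)

/-- The tuples over two attributes, each with the machine that holds it. -/
def placed (X Y : V) : Finset (Fin p × dom × dom) :=
  {a ∈ univ ×ˢ q.rel X Y | a.2 ∈ q.tup a.1 X Y}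

/-- The machines that hold a tuple over two attributes, with the value of the first one. -/
def holders (X Y : V) : Finset (Fin p × dom) := (q.placed X Y).image fun a => (a.1, a.2.1)

/-- The tuples over two attributes with a heavy first value. -/
noncomputable def heavyPairs (Z X : V) : Finset (Fin p × dom × dom) :=
  {a ∈ q.placed Z X | a.2.1 ∈ q.heavy P Z}

/-- The tuples over two attributes with light values. -/
noncomputable def lightPairs (X Y : V) : Finset (Fin p × dom × dom) :=
  {a ∈ q.placed X Y | a.2.1 ∉ q.heavy P X ∧ a.2.2 ∉ q.heavy P Y}

/-- The seed distributes the tuples evenly, up to a factor `s` for each hash function. -/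
structure GoodSeed (ω : Seed V dom p P.cap) (s : ℝ) : Prop where
  holders : ∀ X Y i, (#{a ∈ q.holders X Y | (ω (X, a.2)).1 = i} : ℝ) ≤
    s * (Fintype.card V * (q.size / p))
  heavyPairs : ∀ Z X i, (#{a ∈ q.heavyPairs P Z X | (ω (X, a.2.2)).1 = i} : ℝ) ≤
    s * (Fintype.card V * (q.size / p))
  lightPairs : ∀ X Y, X ≠ Y → ∀ b b' : ℕ,
    (#{a ∈ q.lightPairs P X Y | (ω (X, a.2.1)).2 = b ∧ (ω (Y, a.2.2)).2 = b'} : ℝ) ≤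
      s * (s * (q.size / P.lam ^ 2))

/-- The parameters fit the size of the input. -/
structure Admissible : Prop where
  valid : P.Valid
  one_le_lam : 1 ≤ P.lam
  lam_sq_le : P.lam ^ 2 ≤ p
  lam_cube_le : 3 ≤ Fintype.card V → P.lam ^ 3 ≤ p
  lam_le_cap : P.lam ≤ P.cap
  cap_le : (P.cap : ℝ) ≤ 2 * P.lam
  le_size : p ^ 3 ≤ q.size
  host_le : ∃ r : ℝ, P.lam ^ r = p ∧ ∀ U, (Fintype.card V : ℝ) + #(P.isolated U) ≤
    r + #((P.isolated U).image (P.host U))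

variable {q P} {ω : Seed V dom p P.cap} {s : ℝ}

theorem mem_placed {X Y : V} {a : Fin p × dom × dom} :
    a ∈ q.placed X Y ↔ a.2 ∈ q.tup a.1 X Y := by
  simp only [placed, mem_filter, mem_product, mem_univ, true_and, and_iff_right_iff_imp]
  exact fun h => mem_rel.2 ⟨_, h⟩

theorem placed_injOn (X Y : V) : Set.InjOn Prod.snd (q.placed X Y : Set (Fin p × dom × dom)) := by
  rintro ⟨i, a⟩ h ⟨j, b⟩ h' hab
  obtain rfl : a = b := hab
  obtain rfl : i = j := q.disj (mem_placed.1 (mem_coe.1 h)) (mem_placed.1 (mem_coe.1 h'))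
  rfl

theorem card_placed_le_size (X Y : V) : #(q.placed X Y) ≤ q.size :=
  (card_le_card_of_injOn Prod.snd (fun _ ha => mem_rel.2 ⟨_, mem_placed.1 ha⟩)
    (placed_injOn X Y)).trans (card_rel_le_size X Y)

theorem mem_holders {X Y : V} {a : Fin p × dom} :
    a ∈ q.holders X Y ↔ ∃ y, (a.2, y) ∈ q.tup a.1 X Y := by
  simp only [holders, mem_image, mem_placed, Prod.exists]
  constructor
  · rintro ⟨i, x, y, h, rfl⟩
    exact ⟨y, h⟩
  · rintro ⟨y, h⟩
    exact ⟨a.1, a.2, y, h, rfl⟩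

namespace Admissible

variable (h : q.Admissible P)

include h

theorem lam_pos : 0 < P.lam := by linarith [h.one_le_lam]

theorem one_le_p : (1 : ℝ) ≤ p := (one_le_pow₀ h.one_le_lam).trans h.lam_sq_le

theorem p_pos : 0 < p := by exact_mod_cast (zero_lt_one.trans_le h.one_le_p)

theorem size_pos : 0 < q.size := (pow_pos h.p_pos 3).trans_le h.le_size

theorem cap_pos : 0 < P.cap := by exact_mod_cast h.lam_pos.trans_le h.lam_le_cap

theorem size_div_p_le : (q.size : ℝ) / p ≤ q.size / P.lam ^ 2 :=
  div_le_div_of_nonneg_left (Nat.cast_nonneg _) (pow_pos h.lam_pos 2) h.lam_sq_le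

theorem sq_p_le : (p : ℝ) ^ 2 ≤ q.size / p := by
  rw [le_div_iff₀ (by exact_mod_cast h.p_pos)]
  exact_mod_cast h.le_size

theorem p_le_size_div_p : (p : ℝ) ≤ q.size / p :=
  le_trans (by nlinarith [h.one_le_p]) h.sq_p_le

theorem p_le : (p : ℝ) ≤ q.size / P.lam ^ 2 := h.p_le_size_div_p.trans h.size_div_p_le

theorem lam_le_p : P.lam ≤ p := by nlinarith [h.lam_sq_le, h.one_le_lam]

theorem card_heavy_le (X : V) : (#(q.heavy P X) : ℝ) ≤ Fintype.card V * P.lam :=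
  Placement.card_heavy_le h.lam_pos.le h.size_pos X

variable [Nonempty dom]

theorem records_zero (hω : q.GoodSeed P ω s) (hs : 0 ≤ s) (i : Fin p) :
    (∀ j, (q.records P ω 0 j i).Finite) ∧ (∑ j, (q.records P ω 0 j i).ncard : ℝ) ≤
      (1 + Fintype.card V ^ 2 * (s * Fintype.card V)) * (q.size / P.lam ^ 2) := by
  classical
  let F : Finset (Fin p × Rec V dom) := univ.image (fun j => (j, .count (q.localSize j))) ∪
    (univ : Finset (V × V)).biUnion fun c =>
      {a ∈ q.holders c.1 c.2 | (ω (c.1, a.2)).1 = i}.image fun a =>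
        (a.1, .tuple c.1 c.2 (q.localDeg a.1 c.1 c.2 a.2) a.2 a.2)
  have hF : ∀ j, ∀ r ∈ q.records P ω 0 j i, (j, r) ∈ F := by
    rintro j r (rfl | ⟨X, Y, x, h1, h2, rfl⟩)
    · exact mem_union_left _ (mem_image.2 ⟨j, mem_univ _, rfl⟩)
    · exact mem_union_right _ (mem_biUnion.2 ⟨(X, Y), mem_univ _, mem_image.2 ⟨(j, x),
        mem_filter.2 ⟨mem_holders.2 (localDeg_pos.1 h2), h1⟩, rfl⟩⟩)
  obtain ⟨hfin, hle⟩ := sum_ncard_le hF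
  refine ⟨hfin, ?_⟩
  have h1 : #F ≤ p + ∑ c : V × V, #{a ∈ q.holders c.1 c.2 | (ω (c.1, a.2)).1 = i} := by
    refine (card_union_le _ _).trans (add_le_add (card_image_le.trans (by simp)) ?_)
    exact card_biUnion_le.trans (sum_le_sum fun c _ => card_image_le)
  have h2 : ((∑ j, (q.records P ω 0 j i).ncard : ℕ) : ℝ) ≤
      p + ∑ c : V × V, (#{a ∈ q.holders c.1 c.2 | (ω (c.1, a.2)).1 = i} : ℝ) := by
    exact_mod_cast hle.trans h1
  push_cast at h2
  calc _ ≤ _ := h2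
    _ ≤ p + ∑ _c : V × V, s * (Fintype.card V * (q.size / p)) := by
        gcongr with c
        exact hω.holders c.1 c.2 i
    _ = p + (Fintype.card V ^ 2 * (s * Fintype.card V)) * (q.size / p) := by
        simp only [sum_const, card_univ, Fintype.card_prod, nsmul_eq_mul]
        push_cast
        ring
    _ ≤ q.size / P.lam ^ 2 + (Fintype.card V ^ 2 * (s * Fintype.card V)) *
          (q.size / P.lam ^ 2) := by
        gcongr ?_ + _ * ?_
        · exact h.p_le
        · exact h.size_div_p_le
    _ = _ := by ring

theorem records_one (i : Fin p) :
    (∀ j, (q.records P ω 1 j i).Finite) ∧ (∑ j, (q.records P ω 1 j i).ncard : ℝ) ≤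
      Fintype.card V ^ 3 * (q.size / P.lam ^ 2) := by
  classical
  let F : Finset (Fin p × Rec V dom) := (univ : Finset (V × V)).biUnion fun c =>
      (q.heavy P c.1).image fun x => ((ω (c.1, x)).1, .tuple c.1 c.2 (q.deg c.1 c.2 x) x x)
  have hF : ∀ j, ∀ r ∈ q.records P ω 1 j i, (j, r) ∈ F := by
    rintro j r ⟨X, Y, x, h1, h2, rfl⟩
    exact mem_biUnion.2 ⟨(X, Y), mem_univ _, mem_image.2 ⟨x, h2, by rw [h1]⟩⟩
  obtain ⟨hfin, hle⟩ := sum_ncard_le hF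
  refine ⟨hfin, ?_⟩
  have h1 : #F ≤ ∑ c : V × V, #(q.heavy P c.1) :=
    card_biUnion_le.trans (sum_le_sum fun c _ => card_image_le)
  have h2 : ((∑ j, (q.records P ω 1 j i).ncard : ℕ) : ℝ) ≤ ∑ c : V × V, (#(q.heavy P c.1) : ℝ) := by
    exact_mod_cast hle.trans h1
  push_cast at h2
  calc _ ≤ _ := h2
    _ ≤ ∑ _c : V × V, (Fintype.card V * P.lam : ℝ) := sum_le_sum fun c _ => h.card_heavy_le c.1
    _ = Fintype.card V ^ 3 * P.lam := by
        simp only [sum_const, card_univ, Fintype.card_prod, nsmul_eq_mul]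
        push_cast
        ring
    _ ≤ _ := by
        gcongr
        exact h.lam_le_p.trans h.p_le

/-- Heavy pairs spread over the homes, plus at most `(|V| * lam) ^ 2` pairs of two heavy values per
pair of attributes, which is `O(p)`. -/
theorem records_two (hω : q.GoodSeed P ω s) (hs : 0 ≤ s) (i : Fin p) :
    (∀ j, (q.records P ω 2 j i).Finite) ∧ (∑ j, (q.records P ω 2 j i).ncard : ℝ) ≤
      (Fintype.card V ^ 2 * (s * Fintype.card V) + Fintype.card V ^ 4) *
        (q.size / P.lam ^ 2) := by
  classical
  let G : V × V → Finset (Fin p × dom × dom) := fun c =>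
    {a ∈ q.heavyPairs P c.1 c.2 | a.2.2 ∈ q.heavy P c.2}
  let F : Finset (Fin p × Rec V dom) := (univ : Finset (V × V)).biUnion fun c =>
    ({a ∈ q.heavyPairs P c.1 c.2 | (ω (c.2, a.2.2)).1 = i} ∪ G c).image fun a =>
        (a.1, .tuple c.1 c.2 0 a.2.1 a.2.2)
  have hF : ∀ j, ∀ r ∈ q.records P ω 2 j i, (j, r) ∈ F := by
    rintro j r ⟨Z, X, z, x, h1, h2, h3, rfl⟩
    refine mem_biUnion.2 ⟨(Z, X), mem_univ _, mem_image.2 ⟨(j, z, x), ?_, rfl⟩⟩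
    have h4 : (j, z, x) ∈ q.heavyPairs P Z X := mem_filter.2 ⟨mem_placed.2 h1, h2⟩
    exact mem_union.2 (h3.imp (fun h3 => mem_filter.2 ⟨h4, h3⟩) fun h3 => mem_filter.2 ⟨h4, h3⟩)
  obtain ⟨hfin, hle⟩ := sum_ncard_le hF
  refine ⟨hfin, ?_⟩
  have h1 : #F ≤ ∑ c : V × V, (#{a ∈ q.heavyPairs P c.1 c.2 | (ω (c.2, a.2.2)).1 = i} +
      #(q.heavy P c.1) * #(q.heavy P c.2)) := by
    refine card_biUnion_le.trans (sum_le_sum fun c _ => card_image_le.trans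
      ((card_union_le _ _).trans (add_le_add le_rfl ?_)))
    rw [← card_product]
    refine card_le_card_of_injOn Prod.snd (fun a ha => ?_) ((placed_injOn (q := q) c.1 c.2).mono fun a ha => ?_)
    · exact mem_product.2 ⟨(mem_filter.1 (mem_filter.1 ha).1).2, (mem_filter.1 ha).2⟩
    · exact (mem_filter.1 (mem_filter.1 (mem_coe.1 ha)).1).1
  have h2 : ((∑ j, (q.records P ω 2 j i).ncard : ℕ) : ℝ) ≤ ∑ c : V × V,
      ((#{a ∈ q.heavyPairs P c.1 c.2 | (ω (c.2, a.2.2)).1 = i} : ℝ) +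
      #(q.heavy P c.1) * #(q.heavy P c.2)) := by
    exact_mod_cast hle.trans h1
  push_cast at h2
  calc _ ≤ _ := h2
    _ ≤ ∑ _c : V × V, (s * (Fintype.card V * (q.size / p)) +
          (Fintype.card V * P.lam) * (Fintype.card V * P.lam) : ℝ) := by
        have := h.lam_pos
        gcongr with c
        · exact hω.heavyPairs c.1 c.2 i
        · exact h.card_heavy_le c.1
        · exact h.card_heavy_le c.2
    _ = Fintype.card V ^ 2 * (s * Fintype.card V) * (q.size / p) +
          Fintype.card V ^ 4 * P.lam ^ 2 := by
        simp only [sum_const, card_univ, Fintype.card_prod, nsmul_eq_mul]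
        push_cast
        ring
    _ ≤ Fintype.card V ^ 2 * (s * Fintype.card V) * (q.size / P.lam ^ 2) +
          Fintype.card V ^ 4 * (q.size / P.lam ^ 2) := by
        gcongr _ * ?_ + _ * ?_
        · exact h.size_div_p_le
        · exact h.lam_sq_le.trans h.p_le
    _ = _ := by ring

/-- Each stored tuple attracts at most the `O(lam)` heavy values of a third attribute, so about `lam
* size / p` records. This is at most `size / lam ^ 2` because `lam ^ 3 ≤ p` when there are three
attributes; with fewer, nothing is sent. -/
theorem records_three {B : ℝ} (hB : 0 ≤ B)
    (hlocal : ∀ i, (q.localSize i : ℝ) ≤ B * (q.size / p)) (i : Fin p) :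
    (∀ j, (q.records P ω 3 j i).Finite) ∧ (∑ j, (q.records P ω 3 j i).ncard : ℝ) ≤
      Fintype.card V ^ 2 * B * (q.size / P.lam ^ 2) := by
  classical
  let G : V × V × V → Finset (dom × dom × dom) := fun c =>
    if c.1 ≠ c.2.1 ∧ c.2.1 ≠ c.2.2 ∧ c.2.2 ≠ c.1 then
      q.heavy P c.1 ×ˢ q.tup i c.2.1 c.2.2 else ∅
  let F : Finset (Fin p × Rec V dom) := (univ : Finset (V × V × V)).biUnion fun c =>
    (G c).image fun a => ((ω (c.2.1, a.2.1)).1, .tuple c.1 c.2.1 0 a.1 a.2.1)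
  have hF : ∀ j, ∀ r ∈ q.records P ω 3 j i, (j, r) ∈ F := by
    rintro j r ⟨Z, X, z, x, h1, h2, h3, ⟨Y, y, h4, h5⟩, rfl⟩
    refine mem_biUnion.2 ⟨(Z, X, Y), mem_univ _, mem_image.2 ⟨(z, x, y), ?_, by rw [h1]⟩⟩
    obtain ⟨i', hi'⟩ := mem_rel.1 h2
    simp only [G]
    rw [if_pos ⟨q.ne hi', q.ne h5, h4⟩]
    exact mem_product.2 ⟨h3, h5⟩
  obtain ⟨hfin, hle⟩ := sum_ncard_le hF
  refine ⟨hfin, ?_⟩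
  have h1 : #F ≤ ∑ c : V × V × V, #(G c) :=
    card_biUnion_le.trans (sum_le_sum fun c _ => card_image_le)
  have h2 : ((∑ j, (q.records P ω 3 j i).ncard : ℕ) : ℝ) ≤ ∑ c : V × V × V, (#(G c) : ℝ) := by
    exact_mod_cast hle.trans h1
  push_cast at h2
  refine h2.trans ?_
  by_cases hV : 3 ≤ Fintype.card V
  · calc ∑ c : V × V × V, (#(G c) : ℝ)
        ≤ ∑ c : V × V × V, (Fintype.card V * P.lam : ℝ) * #(q.tup i c.2.1 c.2.2) := by
          refine sum_le_sum fun c _ => ?_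
          simp only [G]
          split_ifs
          · rw [card_product, Nat.cast_mul]
            gcongr
            exact h.card_heavy_le c.1
          · have := h.lam_pos
            rw [card_empty, Nat.cast_zero]
            positivity
      _ = Fintype.card V ^ 2 * (P.lam * q.localSize i) := by
          rw [Fintype.sum_prod_type]
          simp only [← mul_sum, sum_const, card_univ, nsmul_eq_mul, localSize]
          rw [Fintype.sum_prod_type]
          push_cast
          ring
      _ ≤ Fintype.card V ^ 2 * (P.lam * (B * (q.size / p))) := by
          have := h.lam_pos
          gcongr
          exact hlocal i
      _ = Fintype.card V ^ 2 * B * (P.lam * (q.size / p)) := by ring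
      _ ≤ _ := by
          gcongr
          have h3 := h.lam_cube_le hV
          have h4 := h.lam_pos
          have h5 : (0 : ℝ) < p := by exact_mod_cast h.p_pos
          rw [← mul_div_assoc, div_le_div_iff₀ h5 (by positivity)]
          calc P.lam * (q.size : ℝ) * P.lam ^ 2 = q.size * P.lam ^ 3 := by ring
            _ ≤ (q.size : ℝ) * p := by gcongr
  · have h3 : ∀ c : V × V × V, (#(G c) : ℝ) = 0 := by
      intro c
      have : ¬ (c.1 ≠ c.2.1 ∧ c.2.1 ≠ c.2.2 ∧ c.2.2 ≠ c.1) := fun hc => hV <| by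
        rw [← card_eq_three.2 ⟨c.1, c.2.1, c.2.2, hc.1, hc.2.2.symm, hc.2.1, rfl⟩]
        exact card_le_univ _
      simp [G, this]
    simp only [h3, sum_const_zero]
    positivity

/-- The candidates of an isolated attribute for given values of its neighbours. -/
theorem sum_candidates {κ : Cell V dom} {X : V} (hX : P.Isolated κ.1 X) :
    (∀ j, (q.candidates P ω j κ.1 κ.2.1 X).Finite) ∧
      ∑ j, (q.candidates P ω j κ.1 κ.2.1 X).ncard ≤ q.deg (P.host κ.1 X) X (κ.2.1 (P.host κ.1 X)) := by
  have hadj := h.valid.2.2 _ _ hX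
  let F : Finset (Fin p × dom) :=
    {a ∈ q.rel (P.host κ.1 X) X | a.1 = κ.2.1 (P.host κ.1 X)}.image fun a => ((ω (X, a.2)).1, a.2)
  have hF : ∀ j, ∀ x ∈ q.candidates P ω j κ.1 κ.2.1 X, (j, x) ∈ F := by
    rintro j x ⟨h1, -, h3⟩
    exact mem_image.2 ⟨(κ.2.1 (P.host κ.1 X), x),
      mem_filter.2 ⟨h3 _ (hX.2 _ hadj) (h.valid.1 _ _ hadj), rfl⟩, by rw [h1]⟩
  obtain ⟨hfin, hle⟩ := sum_ncard_le hF
  exact ⟨hfin, hle.trans card_image_le⟩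

/-- Each home cuts its own candidates evenly, without coordination. Rounding costs at most one value
per home, `p` in all, which the large input absorbs; the rest is the degree divided by the number of
parts. -/
theorem sum_fitsIsolated {κ : Cell V dom} (hκ : κ ∈ q.cells P) (X : V) :
    (∀ j, {x | (ω (X, x)).1 = j ∧ q.FitsIsolated P ω κ X x}.Finite) ∧
      ∑ j, ({x | (ω (X, x)).1 = j ∧ q.FitsIsolated P ω κ X x}.ncard : ℝ) ≤
        2 * (q.size / P.lam ^ 2) := by
  by_cases hX : P.Isolated κ.1 X
  swap
  · have : ∀ j, {x | (ω (X, x)).1 = j ∧ q.FitsIsolated P ω κ X x} = ∅ := fun j =>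
      Set.eq_empty_of_forall_notMem fun x hx => hX hx.2.1
    simp only [this, Set.ncard_empty, Nat.cast_zero, sum_const_zero]
    exact ⟨fun _ => Set.finite_empty, by positivity⟩
  obtain ⟨hfin, hle⟩ := h.sum_candidates (q := q) (ω := ω) hX
  set n := P.width (q.parts P) κ.1 κ.2.1 X with hn
  have hsub : ∀ j, {x | (ω (X, x)).1 = j ∧ q.FitsIsolated P ω κ X x} ⊆
      {x ∈ q.candidates P ω j κ.1 κ.2.1 X |
        index (q.candidates P ω j κ.1 κ.2.1 X) x % n = κ.2.2 X} := by
    rintro j x ⟨rfl, -, h2, h3⟩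
    exact ⟨h2, h3⟩
  refine ⟨fun j => ((hfin j).subset fun x hx => hx.1).subset (hsub j), ?_⟩
  have hnpos : (0 : ℝ) < n := by exact_mod_cast width_pos h.cap_pos
  have hsize : (0 : ℝ) < q.size := by exact_mod_cast h.size_pos
  set D := q.deg (P.host κ.1 X) X (κ.2.1 (P.host κ.1 X)) with hD
  have hDn : (D : ℝ) / n ≤ q.size / P.lam ^ 2 := by
    have hz := heavy_of_mem_cells hκ (hX.2 _ (h.valid.2.2 _ _ hX))
    have h1 : n = ⌊(D : ℝ) * P.lam ^ 2 / q.size⌋₊ + 1 := by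
      rw [hn, Plan.width, if_neg hX.1, if_pos hX, parts, if_pos hz]
    have h2 : (D : ℝ) * P.lam ^ 2 / q.size < n := by
      rw [h1]
      push_cast
      exact Nat.lt_floor_add_one _
    have h3 := h.lam_pos
    rw [div_lt_iff₀ hsize] at h2
    rw [div_le_div_iff₀ hnpos (by positivity)]
    linarith
  calc ∑ j, ({x | (ω (X, x)).1 = j ∧ q.FitsIsolated P ω κ X x}.ncard : ℝ)
      ≤ ∑ j, ((q.candidates P ω j κ.1 κ.2.1 X).ncard / n + 1 : ℝ) := by
        refine sum_le_sum fun j _ => ?_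
        calc ({x | (ω (X, x)).1 = j ∧ q.FitsIsolated P ω κ X x}.ncard : ℝ)
            ≤ ((q.candidates P ω j κ.1 κ.2.1 X).ncard / n + 1 : ℕ) := by
              exact_mod_cast (Set.ncard_le_ncard (hsub j)
                ((hfin j).subset fun x hx => hx.1)).trans (ncard_index_mod_le (hfin j) n _)
          _ ≤ _ := by
              push_cast
              gcongr
              exact Nat.cast_div_le
    _ = ((∑ j, (q.candidates P ω j κ.1 κ.2.1 X).ncard : ℕ) : ℝ) / n + p := by
        rw [sum_add_distrib, ← sum_div]
        simp
    _ ≤ D / n + p := by gcongr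
    _ ≤ q.size / P.lam ^ 2 + q.size / P.lam ^ 2 := add_le_add hDn h.p_le
    _ = _ := by ring

/-- Codes enumerate the `O(p)` cells, so residues modulo `p` distribute them evenly. -/
theorem card_cells_of_machine (i : Fin p) :
    (#{κ ∈ q.cells P | q.code P κ % p = i} : ℝ) ≤
      2 ^ Fintype.card V * (Fintype.card V + 2) ^ Fintype.card V + 1 := by
  obtain ⟨r, hr, hhost⟩ := h.host_le
  have h1 := card_cells_le (q := q) h.valid h.one_le_lam h.cap_le h.size_pos hhost hr
  have h2 : #{κ ∈ q.cells P | q.code P κ % p = i} ≤ #(q.cells P) / p + 1 := by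
    have := ncard_index_mod_le (Finset.finite_toSet (q.cells P)) p i
    rw [Set.ncard_coe_finset] at this
    refine le_trans (le_of_eq ?_) this
    rw [← Set.ncard_coe_finset]
    congr 1
    ext κ
    simp only [mem_coe, mem_filter, Set.mem_ofPred_eq]
    rfl
  have hp : (0 : ℝ) < p := by exact_mod_cast h.p_pos
  calc (#{κ ∈ q.cells P | q.code P κ % p = i} : ℝ) ≤ ((#(q.cells P) / p + 1 : ℕ) : ℝ) := by
        exact_mod_cast h2
    _ ≤ #(q.cells P) / p + 1 := by
        push_cast
        gcongr
        exact Nat.cast_div_le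
    _ ≤ _ := by
        gcongr
        rwa [div_le_iff₀ hp]

theorem records_four (hω : q.GoodSeed P ω s) (i : Fin p) :
    (∀ j, (q.records P ω 4 j i).Finite) ∧ (∑ j, (q.records P ω 4 j i).ncard : ℝ) ≤
      (2 ^ Fintype.card V * (Fintype.card V + 2) ^ Fintype.card V + 1) *
        (Fintype.card V ^ 2 * s ^ 2 + 2 * Fintype.card V) * (q.size / P.lam ^ 2) := by
  classical
  let G : Cell V dom → V × V → Finset (Fin p × dom × dom) := fun κ c =>
    if c.1 ≠ c.2 then {a ∈ q.lightPairs P c.1 c.2 |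
      (ω (c.1, a.2.1)).2 = κ.2.2 c.1 ∧ (ω (c.2, a.2.2)).2 = κ.2.2 c.2} else ∅
  let J : Cell V dom → V → Fin p → Finset dom := fun κ X j =>
    if hκ : κ ∈ q.cells P then ((h.sum_fitsIsolated (ω := ω) hκ X).1 j).toFinset else ∅
  let K : Finset (Cell V dom) := {κ ∈ q.cells P | q.code P κ % p = i}
  let F : Finset (Fin p × Rec V dom) := K.biUnion fun κ =>
    ((univ : Finset (V × V)).biUnion fun c => (G κ c).image fun a =>
      (a.1, .tuple c.1 c.2 (q.code P κ) a.2.1 a.2.2)) ∪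
    ((univ : Finset (V × Fin p)).biUnion fun c => (J κ c.1 c.2).image fun x =>
      (c.2, .tuple c.1 c.1 (q.code P κ) x x))
  have hF : ∀ j, ∀ r ∈ q.records P ω 4 j i, (j, r) ∈ F := by
    rintro j r ⟨κ, hκ, hi, hr⟩
    refine mem_biUnion.2 ⟨κ, mem_filter.2 ⟨hκ, hi⟩, ?_⟩
    rcases hr with ⟨X, Y, x, y, h1, h2, h3, h4, rfl⟩ | ⟨X, x, h1, h2, rfl⟩
    · refine mem_union_left _ (mem_biUnion.2 ⟨(X, Y), mem_univ _, mem_image.2 ⟨(j, x, y), ?_, rfl⟩⟩)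
      simp only [G]
      rw [if_pos (h.valid.2.1 _ _ h1)]
      exact mem_filter.2 ⟨mem_filter.2 ⟨mem_placed.2 h2, h3.2.1, h4.2.1⟩, h3.2.2.1, h4.2.2.1⟩
    · refine mem_union_right _ (mem_biUnion.2 ⟨(X, j), mem_univ _, mem_image.2 ⟨x, ?_, rfl⟩⟩)
      simp only [J, dif_pos hκ, Set.Finite.mem_toFinset]
      exact ⟨h1, h2⟩
  obtain ⟨hfin, hle⟩ := sum_ncard_le hF
  refine ⟨hfin, ?_⟩
  have h1 : #F ≤ ∑ κ ∈ K, (∑ c : V × V, #(G κ c) + ∑ X : V, ∑ j, #(J κ X j)) := by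
    refine card_biUnion_le.trans (sum_le_sum fun κ _ => (card_union_le _ _).trans
      (add_le_add ?_ ?_))
    · exact card_biUnion_le.trans (sum_le_sum fun c _ => card_image_le)
    · rw [← Fintype.sum_prod_type']
      exact card_biUnion_le.trans (sum_le_sum fun c _ => card_image_le)
  have h2 : ((∑ j, (q.records P ω 4 j i).ncard : ℕ) : ℝ) ≤
      ∑ κ ∈ K, (∑ c : V × V, (#(G κ c) : ℝ) + ∑ X : V, ∑ j, (#(J κ X j) : ℝ)) := by
    exact_mod_cast hle.trans h1
  push_cast at h2
  have hL : 0 ≤ (q.size : ℝ) / P.lam ^ 2 := by positivity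
  calc _ ≤ _ := h2
    _ ≤ ∑ κ ∈ K, (∑ _c : V × V, s * (s * (q.size / P.lam ^ 2)) +
          ∑ _X : V, 2 * (q.size / P.lam ^ 2) : ℝ) := by
        refine sum_le_sum fun κ hκ => add_le_add (sum_le_sum fun c _ => ?_) (sum_le_sum fun X _ => ?_)
        · simp only [G]
          split_ifs with hc
          · exact hω.lightPairs _ _ hc _ _
          · rw [card_empty, Nat.cast_zero, ← mul_assoc]
            exact mul_nonneg (mul_self_nonneg s) hL
        · have hκ := (mem_filter.1 hκ).1
          refine le_trans (le_of_eq (sum_congr rfl fun j _ => ?_))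
            (h.sum_fitsIsolated (ω := ω) hκ X).2
          simp only [J, dif_pos hκ]
          exact congrArg Nat.cast
            (Set.ncard_eq_toFinset_card _ ((h.sum_fitsIsolated (ω := ω) hκ X).1 j)).symm
    _ = #K * ((Fintype.card V ^ 2 * s ^ 2 + 2 * Fintype.card V) * (q.size / P.lam ^ 2)) := by
        simp only [sum_const, card_univ, Fintype.card_prod, nsmul_eq_mul]
        push_cast
        ring
    _ ≤ (2 ^ Fintype.card V * (Fintype.card V + 2) ^ Fintype.card V + 1) *
        ((Fintype.card V ^ 2 * s ^ 2 + 2 * Fintype.card V) * (q.size / P.lam ^ 2)) := by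
        gcongr
        exact h.card_cells_of_machine i
    _ = _ := by ring

omit [Nonempty dom] in
theorem localDeg_le_size (i : Fin p) (X Y : V) (x : dom) : q.localDeg i X Y x ≤ q.size :=
  (single_le_sum (fun _ _ => Nat.zero_le _) (mem_univ i)).trans
    ((q.deg_eq_sum X Y x).ge.trans (deg_le_size X Y x))

/-- The numbers are sizes, degrees, zeros and codes; a code is less than the number of cells, which
is `O(p)` and hence `O(size)`. -/
theorem num_le {t : ℕ} (ht : t < 5) {j i : Fin p} {r : Rec V dom} (hr : r ∈ q.records P ω t j i) :
    r.num ≤ 2 ^ Fintype.card V * (Fintype.card V + 2) ^ Fintype.card V * q.size := by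
  have hone : 1 ≤ 2 ^ Fintype.card V * (Fintype.card V + 2) ^ Fintype.card V := by
    have := Nat.one_le_two_pow (n := Fintype.card V)
    have h2 := Nat.one_le_pow (Fintype.card V) (Fintype.card V + 2) (by omega)
    nlinarith
  have hsize : q.size ≤ 2 ^ Fintype.card V * (Fintype.card V + 2) ^ Fintype.card V * q.size :=
    Nat.le_mul_of_pos_left _ hone
  have hcells : #(q.cells P) ≤
      2 ^ Fintype.card V * (Fintype.card V + 2) ^ Fintype.card V * q.size := by
    obtain ⟨r, hr, hhost⟩ := h.host_le
    have h1 := card_cells_le (q := q) h.valid h.one_le_lam h.cap_le h.size_pos hhost hr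
    have h2 : #(q.cells P) ≤ 2 ^ Fintype.card V * (Fintype.card V + 2) ^ Fintype.card V * p := by
      exact_mod_cast h1
    have h3 : p ≤ q.size := (Nat.le_self_pow (by norm_num) p).trans h.le_size
    exact h2.trans (Nat.mul_le_mul_left _ h3)
  have hlocal : q.localSize j ≤ q.size := single_le_sum (fun _ _ => Nat.zero_le _) (mem_univ j)
  interval_cases t
  · rcases hr with rfl | ⟨X, Y, x, -, -, rfl⟩
    · exact hlocal.trans hsize
    · exact (h.localDeg_le_size j X Y x).trans hsize
  · obtain ⟨X, Y, x, -, -, rfl⟩ := hr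
    exact (deg_le_size X Y x).trans hsize
  · obtain ⟨Z, X, z, x, -, -, -, rfl⟩ := hr
    exact Nat.zero_le _
  · obtain ⟨Z, X, z, x, -, -, -, -, rfl⟩ := hr
    exact Nat.zero_le _
  · obtain ⟨κ, hκ, -, ⟨X, Y, x, y, -, -, -, -, rfl⟩ | ⟨X, x, -, -, rfl⟩⟩ := hr <;>
      exact (code_lt hκ).le.trans hcells

/-- A constant in the bound on the number of records that a machine receives. -/
noncomputable def _root_.MPCJoin.loadConstant (k : ℕ) (B : ℝ) : ℝ :=
  1 + 2 * k ^ 3 + k ^ 4 + k ^ 2 * B + (2 ^ k * (k + 2) ^ k + 1) * (k ^ 2 + 2 * k)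

omit h in
theorem _root_.MPCJoin.loadConstant_nonneg {k : ℕ} {B : ℝ} (hB : 0 ≤ B) :
    0 ≤ loadConstant k B := by
  unfold loadConstant
  positivity

theorem records_le (hω : q.GoodSeed P ω s) (hs : 1 ≤ s) {B : ℝ} (hB : 0 ≤ B)
    (hlocal : ∀ i, (q.localSize i : ℝ) ≤ B * (q.size / p)) {t : ℕ} (ht : t < 5) (i : Fin p) :
    (∀ j, (q.records P ω t j i).Finite) ∧ (∑ j, (q.records P ω t j i).ncard : ℝ) ≤
      loadConstant (Fintype.card V) B * s ^ 2 * (q.size / P.lam ^ 2) := by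
  have hs0 : 0 ≤ s := by linarith
  have hs2 : 1 ≤ s ^ 2 := one_le_pow₀ hs
  have hss : s ≤ s ^ 2 := by nlinarith
  have hL : 0 ≤ (q.size : ℝ) / P.lam ^ 2 := by positivity
  set k : ℝ := (Fintype.card V : ℝ) with hk
  have hk0 : 0 ≤ k := Nat.cast_nonneg _
  set D : ℝ := 2 ^ Fintype.card V * (k + 2) ^ Fintype.card V + 1 with hD
  have hD0 : 0 ≤ D := by positivity
  have hLC : loadConstant (Fintype.card V) B =
      1 + 2 * k ^ 3 + k ^ 4 + k ^ 2 * B + D * (k ^ 2 + 2 * k) := rfl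
  have h3 : k ^ 3 * s ≤ k ^ 3 * s ^ 2 := by gcongr
  have h4 : k ^ 4 ≤ k ^ 4 * s ^ 2 := le_mul_of_one_le_right (by positivity) hs2
  have h3' : k ^ 3 ≤ k ^ 3 * s ^ 2 := le_mul_of_one_le_right (by positivity) hs2
  have h2 : k ^ 2 * B ≤ k ^ 2 * B * s ^ 2 := le_mul_of_one_le_right (by positivity) hs2
  have h1 : D * (2 * k) ≤ D * (2 * k) * s ^ 2 := le_mul_of_one_le_right (by positivity) hs2
  have p3 : 0 ≤ k ^ 3 * s ^ 2 := by positivity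
  have p4 : 0 ≤ k ^ 4 * s ^ 2 := by positivity
  have p2 : 0 ≤ k ^ 2 * B * s ^ 2 := by positivity
  have p1 : 0 ≤ D * (2 * k) * s ^ 2 := by positivity
  have p0 : 0 ≤ D * k ^ 2 * s ^ 2 := by positivity
  have key : ∀ {a x : ℝ}, x ≤ a * (q.size / P.lam ^ 2) →
      a ≤ loadConstant (Fintype.card V) B * s ^ 2 →
      x ≤ loadConstant (Fintype.card V) B * s ^ 2 * (q.size / P.lam ^ 2) :=
    fun h1 h2 => h1.trans (mul_le_mul_of_nonneg_right h2 hL)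
  rw [hLC] at key ⊢
  interval_cases t
  · refine ⟨(h.records_zero hω hs0 i).1, key (h.records_zero hω hs0 i).2 ?_⟩
    linarith
  · refine ⟨(h.records_one i).1, key (h.records_one i).2 ?_⟩
    linarith
  · refine ⟨(h.records_two hω hs0 i).1, key (h.records_two hω hs0 i).2 ?_⟩
    linarith
  · refine ⟨(h.records_three hB hlocal i).1, key (h.records_three hB hlocal i).2 ?_⟩
    linarith
  · refine ⟨(h.records_four hω i).1, key (h.records_four hω i).2 ?_⟩
    linarith

end Admissible

end Placement

end MPCJoin

namespace MPCJoin

/-! ### Random seeds are good with high probability. -/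

section Uniform

open ProbabilityTheory

/-- The uniform distribution of a pair of hash values, independently for each key. -/
noncomputable def seedLaw (ι : Type) (p n : ℕ) : Measure (ι → Fin p × Fin n) :=
  Measure.infinitePi fun _ : ι => uniformOn (Set.univ : Set (Fin p × Fin n))

variable {ι : Type} {p n : ℕ} [NeZero p] [NeZero n]

instance : IsProbabilityMeasure (seedLaw ι p n) := by
  unfold seedLaw
  infer_instance

theorem iIndepFun_seedLaw : iIndepFun (fun i ω => ω i) (seedLaw ι p n) :=
  iIndepFun_infinitePi (X := fun _ v => v) fun _ => measurable_id

theorem seedLaw_real_preimage (i : ι) (A : Set (Fin p × Fin n)) :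
    (seedLaw ι p n).real ((fun ω => ω i) ⁻¹' A) = A.ncard / (p * n) := by
  have h1 : (seedLaw ι p n).map (fun ω => ω i) = uniformOn Set.univ :=
    Measure.infinitePi_map_eval _ i
  rw [← map_measureReal_apply (measurable_pi_apply i) (Set.toFinite A).measurableSet, h1,
    measureReal_def, uniformOn_univ, Measure.count_apply_finite A (Set.toFinite A),
    ENNReal.toReal_div, Set.ncard_eq_toFinset_card A (Set.toFinite A)]
  simp

theorem seedLaw_real_fst (i : ι) (a : Fin p) :
    (seedLaw ι p n).real ((fun ω => ω i) ⁻¹' {v | v.1 = a}) ≤ 1 / p := by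
  rw [seedLaw_real_preimage]
  have h : ({v | v.1 = a} : Set (Fin p × Fin n)) = {a} ×ˢ Set.univ := by
    ext v; simp
  have hp : (p : ℝ) ≠ 0 := Nat.cast_ne_zero.2 (NeZero.ne p)
  have hn : (n : ℝ) ≠ 0 := Nat.cast_ne_zero.2 (NeZero.ne n)
  rw [h, Set.ncard_prod, Set.ncard_singleton, Set.ncard_univ, Nat.card_fin]
  push_cast
  apply le_of_eq
  field_simp

theorem seedLaw_real_snd (i : ι) (b : Fin n) :
    (seedLaw ι p n).real ((fun ω => ω i) ⁻¹' {v | v.2 = b}) ≤ 1 / n := by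
  rw [seedLaw_real_preimage]
  have h : ({v | v.2 = b} : Set (Fin p × Fin n)) = Set.univ ×ˢ {b} := by
    ext v; simp
  have hp : (p : ℝ) ≠ 0 := Nat.cast_ne_zero.2 (NeZero.ne p)
  have hn : (n : ℝ) ≠ 0 := Nat.cast_ne_zero.2 (NeZero.ne n)
  rw [h, Set.ncard_prod, Set.ncard_singleton, Set.ncard_univ, Nat.card_fin]
  push_cast
  apply le_of_eq
  field_simp

end Uniform

namespace Placement

open Finset

set_option linter.unusedSectionVars false

variable {V dom : Type} {p : ℕ} [Fintype V] [DecidableEq V] [DecidableEq dom]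
  {q : Placement V dom p} {P : Plan V} {s : ℝ}

namespace Admissible

variable (h : q.Admissible P)

include h

theorem size_div_p_pos : (0 : ℝ) < q.size / p :=
  div_pos (by exact_mod_cast h.size_pos) (by exact_mod_cast h.p_pos)

theorem one_le_W : (1 : ℝ) ≤ q.size / P.lam ^ 2 := h.one_le_p.trans h.p_le

theorem card_pos_of_mem (X : V) : (1 : ℝ) ≤ Fintype.card V := by
  exact_mod_cast Fintype.card_pos_iff.2 ⟨X⟩

variable [NeZero p] [NeZero P.cap]

/-- A value has at most `p` holders, well below the mean bucket size `size / p ≥ p ^ 2`, so no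
single key can overload a bucket. -/
theorem holders_le (X Y : V) (i : Fin p) :
    (seedLaw (V × dom) p P.cap).real {ω | s * (Fintype.card V * (q.size / p)) <
      (#{a ∈ q.holders X Y | (ω (X, a.2)).1 = i} : ℝ)} ≤ Real.exp (2 - s) := by
  have hV := h.card_pos_of_mem X
  have hsp := h.size_div_p_pos
  have hp : (0 : ℝ) < p := by exact_mod_cast h.p_pos
  have hle : (q.size : ℝ) / p ≤ Fintype.card V * (q.size / p) :=
    le_mul_of_one_le_left hsp.le hV
  have hkey : ∀ c : V × dom, (#{a ∈ q.holders X Y | (X, a.2) = c} : ℝ) ≤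
      Fintype.card V * (q.size / p) := by
    intro c
    refine le_trans ?_ (h.p_le_size_div_p.trans hle)
    have : #{a ∈ q.holders X Y | (X, a.2) = c} ≤ #(univ : Finset (Fin p)) :=
      card_le_card_of_injOn Prod.fst (fun _ _ => mem_univ _) fun a ha b hb hab =>
        Prod.ext hab (by
          have h1 := (mem_filter.1 (mem_coe.1 ha)).2
          have h2 := (mem_filter.1 (mem_coe.1 hb)).2
          exact (Prod.mk.inj (h1.trans h2.symm)).2)
    rw [card_univ, Fintype.card_fin] at this
    exact_mod_cast this
  have hcard : (#(q.holders X Y) : ℝ) ≤ p * (Fintype.card V * (q.size / p)) := by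
    calc (#(q.holders X Y) : ℝ) ≤ q.size := by
          exact_mod_cast card_image_le.trans (card_placed_le_size X Y)
      _ = p * (q.size / p) := by field_simp
      _ ≤ _ := by gcongr
  have key := measureReal_bucket_le (A := {v | v.1 = i}) (n := p) (f := fun i ω => ω i)
    (μ := seedLaw (V × dom) p P.cap) iIndepFun_seedLaw measurable_pi_apply
    (Set.toFinite _).measurableSet hp (by positivity) (fun _ => seedLaw_real_fst _ _)
    (q.holders X Y) (fun a => (X, a.2)) (fun c => by convert! hkey c) hcard s
  refine le_trans (le_of_eq (congrArg _ ?_)) key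
  ext ω
  simp only [Set.mem_ofPred_eq]

/-- A key `x` has at most one pair for each heavy `z`, so at most `|V| * lam` pairs. The factor
`|V|` in the bucket bound makes room for these. -/
theorem heavyPairs_le (Z X : V) (i : Fin p) :
    (seedLaw (V × dom) p P.cap).real {ω | s * (Fintype.card V * (q.size / p)) <
      (#{a ∈ q.heavyPairs P Z X | (ω (X, a.2.2)).1 = i} : ℝ)} ≤ Real.exp (2 - s) := by
  have hV := h.card_pos_of_mem X
  have hsp := h.size_div_p_pos
  have hp : (0 : ℝ) < p := by exact_mod_cast h.p_pos
  have hle : (q.size : ℝ) / p ≤ Fintype.card V * (q.size / p) :=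
    le_mul_of_one_le_left hsp.le hV
  have hkey : ∀ c : V × dom, (#{a ∈ q.heavyPairs P Z X | (X, a.2.2) = c} : ℝ) ≤
      Fintype.card V * (q.size / p) := by
    intro c
    have : #{a ∈ q.heavyPairs P Z X | (X, a.2.2) = c} ≤ #(q.heavy P Z) := by
      refine card_le_card_of_injOn (fun a => a.2.1)
        (fun a ha => (mem_filter.1 (mem_filter.1 (mem_coe.1 ha)).1).2) fun a ha b hb hab => ?_
      have h1 := mem_filter.1 (mem_coe.1 ha)
      have h2 := mem_filter.1 (mem_coe.1 hb)
      exact placed_injOn (q := q) Z X (mem_filter.1 h1.1).1 (mem_filter.1 h2.1).1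
        (Prod.ext hab (Prod.mk.inj (h1.2.trans h2.2.symm)).2)
    calc (#{a ∈ q.heavyPairs P Z X | (X, a.2.2) = c} : ℝ) ≤ #(q.heavy P Z) := by
          exact_mod_cast this
      _ ≤ Fintype.card V * P.lam := h.card_heavy_le Z
      _ ≤ _ := by
          gcongr
          exact h.lam_le_p.trans h.p_le_size_div_p
  have hcard : (#(q.heavyPairs P Z X) : ℝ) ≤ p * (Fintype.card V * (q.size / p)) := by
    calc (#(q.heavyPairs P Z X) : ℝ) ≤ q.size := by
          exact_mod_cast (card_filter_le _ _).trans (card_placed_le_size Z X)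
      _ = p * (q.size / p) := by field_simp
      _ ≤ _ := by gcongr
  have key := measureReal_bucket_le (A := {v | v.1 = i}) (n := p) (f := fun i ω => ω i)
    (μ := seedLaw (V × dom) p P.cap) iIndepFun_seedLaw measurable_pi_apply
    (Set.toFinite _).measurableSet hp (by positivity) (fun _ => seedLaw_real_fst _ _)
    (q.heavyPairs P Z X) (fun a => (X, a.2.2)) (fun c => by convert! hkey c) hcard s
  refine le_trans (le_of_eq (congrArg _ ?_)) key
  ext ω
  simp only [Set.mem_ofPred_eq]

theorem card_light_le {X Y : V} {x : dom} (hx : x ∉ q.heavy P X) :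
    (q.deg X Y x : ℝ) ≤ P.lam * (q.size / P.lam ^ 2) := by
  have hl := h.lam_pos
  rcases Nat.eq_zero_or_pos (q.deg X Y x) with h0 | h0
  · rw [h0, Nat.cast_zero]
    positivity
  · have h1 : ¬ (q.size : ℝ) ≤ q.deg X Y x * P.lam := fun h2 => hx (mem_heavy.2 ⟨Y, h0, h2⟩)
    have e : P.lam * (q.size / P.lam ^ 2) = q.size / P.lam := by field_simp
    rw [e, le_div_iff₀ hl]
    linarith

/-- Lightness bounds the number of pairs per key by `lam` times the target `size / lam ^ 2`, and two
keys in different attributes determine the pair; these are the hypotheses of the two-key bound with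
`n = lam`. -/
theorem lightPairs_le (X Y : V) (hXY : X ≠ Y) (b b' : Fin P.cap) (hs : 0 < s) :
    (seedLaw (V × dom) p P.cap).real {ω | s * (s * (q.size / P.lam ^ 2)) <
      (#{a ∈ q.lightPairs P X Y | (ω (X, a.2.1)).2 = b ∧ (ω (Y, a.2.2)).2 = b'} : ℝ)} ≤
      (q.size + 2) * Real.exp (2 - s) := by
  have hl := h.lam_pos
  have hW := h.one_le_W
  have hcap : 1 / (P.cap : ℝ) ≤ 1 / P.lam := one_div_le_one_div_of_le hl h.lam_le_cap
  have hinj : Set.InjOn Prod.snd (q.lightPairs P X Y : Set (Fin p × dom × dom)) :=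
    (placed_injOn (q := q) X Y).mono fun a ha => (mem_filter.1 (mem_coe.1 ha)).1
  have hcard : #(q.lightPairs P X Y) ≤ q.size := (card_filter_le _ _).trans (card_placed_le_size X Y)
  have hdeg : ∀ c : V × dom, (#{a ∈ q.lightPairs P X Y | (X, a.2.1) = c} : ℝ) ≤
      P.lam * (q.size / P.lam ^ 2) := by
    intro c
    rcases ({a ∈ q.lightPairs P X Y | (X, a.2.1) = c} : Finset _).eq_empty_or_nonempty with
      h0 | ⟨a, ha⟩
    · rw [h0, card_empty, Nat.cast_zero]; positivity
    · obtain ⟨ha1, rfl⟩ := mem_filter.1 ha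
      refine le_trans ?_ (h.card_light_le (Y := Y) (mem_filter.1 ha1).2.1)
      have : #{a' ∈ q.lightPairs P X Y | (X, a'.2.1) = (X, a.2.1)} ≤ q.deg X Y a.2.1 := by
        refine card_le_card_of_injOn Prod.snd (fun a' ha' => ?_)
          (hinj.mono fun a' ha' => (mem_filter.1 (mem_coe.1 ha')).1)
        have h1 := mem_filter.1 (mem_coe.1 ha')
        exact mem_filter.2 ⟨mem_rel.2 ⟨_, mem_placed.1 (mem_filter.1 h1.1).1⟩,
          (Prod.mk.inj h1.2).2⟩
      exact_mod_cast this
  have hdeg' : ∀ c : V × dom, (#{a ∈ q.lightPairs P X Y | (Y, a.2.2) = c} : ℝ) ≤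
      P.lam * (q.size / P.lam ^ 2) := by
    intro c
    rcases ({a ∈ q.lightPairs P X Y | (Y, a.2.2) = c} : Finset _).eq_empty_or_nonempty with
      h0 | ⟨a, ha⟩
    · rw [h0, card_empty, Nat.cast_zero]; positivity
    · obtain ⟨ha1, rfl⟩ := mem_filter.1 ha
      refine le_trans ?_ (h.card_light_le (Y := X) (mem_filter.1 ha1).2.2)
      have : #{a' ∈ q.lightPairs P X Y | (Y, a'.2.2) = (Y, a.2.2)} ≤ q.deg Y X a.2.2 := by
        refine card_le_card_of_injOn (fun a' => a'.2.swap) (fun a' ha' => ?_)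
          fun a' ha' b' hb' hab => hinj (mem_filter.1 (mem_coe.1 ha')).1
            (mem_filter.1 (mem_coe.1 hb')).1 (Prod.swap_injective hab)
        have h1 := mem_filter.1 (mem_coe.1 ha')
        exact mem_filter.2 ⟨mem_rel.2 ⟨_, q.symm (mem_placed.1 (mem_filter.1 h1.1).1)⟩,
          (Prod.mk.inj h1.2).2⟩
      exact_mod_cast this
  have hpair : ∀ c c' : V × dom,
      (#{a ∈ q.lightPairs P X Y | (Y, a.2.2) = c' ∧ (X, a.2.1) = c} : ℝ) ≤ q.size / P.lam ^ 2 := by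
    intro c c'
    refine le_trans ?_ hW
    rw [Nat.cast_le_one]
    refine card_le_one.2 fun a ha a' ha' => ?_
    obtain ⟨h1, h2, h3⟩ := mem_filter.1 ha
    obtain ⟨h1', h2', h3'⟩ := mem_filter.1 ha'
    exact hinj h1 h1' (Prod.ext (Prod.mk.inj (h3.trans h3'.symm)).2
      (Prod.mk.inj (h2.trans h2'.symm)).2)
  have hcard' : (#(q.lightPairs P X Y) : ℝ) ≤ P.lam * (P.lam * (q.size / P.lam ^ 2)) := by
    have e : P.lam * (P.lam * (q.size / P.lam ^ 2)) = q.size := by field_simp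
    rw [e]
    exact_mod_cast hcard
  have key := measureReal_bucket_pair_le (A := {v | v.2 = b}) (B := {v | v.2 = b'}) (n := P.lam)
    (W := q.size / P.lam ^ 2) (f := fun i ω => ω i) (μ := seedLaw (V × dom) p P.cap)
    iIndepFun_seedLaw
    measurable_pi_apply (Set.toFinite _).measurableSet (Set.toFinite _).measurableSet hl
    (by linarith) (fun _ => (seedLaw_real_snd _ _).trans hcap)
    (fun _ => (seedLaw_real_snd _ _).trans hcap) (q.lightPairs P X Y) (fun a => (X, a.2.1))
    (fun a => (Y, a.2.2)) (fun _ _ _ _ hab => hXY (Prod.mk.inj hab).1)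
    (fun c => by convert! hdeg c) (fun c => by convert! hdeg' c)
    (fun c c' => by convert! hpair c c') hcard' hs
  refine le_trans ?_ (key.trans ?_)
  · refine le_of_eq (congrArg _ ?_)
    ext ω
    simp only [Set.mem_ofPred_eq]
  · gcongr

/-- The seed is good with high probability. -/
theorem not_goodSeed_le (hs : 0 < s) :
    (seedLaw (V × dom) p P.cap).real {ω | ¬ q.GoodSeed P ω s} ≤
      14 * Fintype.card V ^ 2 * q.size ^ 2 * Real.exp (2 - s) := by
  set μ := seedLaw (V × dom) p P.cap
  let E1 : V × V × Fin p → Set (Seed V dom p P.cap) := fun c =>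
    {ω | s * (Fintype.card V * (q.size / p)) <
      (#{a ∈ q.holders c.1 c.2.1 | (ω (c.1, a.2)).1 = c.2.2} : ℝ)}
  let E2 : V × V × Fin p → Set (Seed V dom p P.cap) := fun c =>
    {ω | s * (Fintype.card V * (q.size / p)) <
      (#{a ∈ q.heavyPairs P c.1 c.2.1 | (ω (c.2.1, a.2.2)).1 = c.2.2} : ℝ)}
  let E3 : (V × V) × Fin P.cap × Fin P.cap → Set (Seed V dom p P.cap) := fun c =>
    {ω | c.1.1 ≠ c.1.2 ∧ s * (s * (q.size / P.lam ^ 2)) < (#{a ∈ q.lightPairs P c.1.1 c.1.2 |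
      (ω (c.1.1, a.2.1)).2 = c.2.1 ∧ (ω (c.1.2, a.2.2)).2 = c.2.2} : ℝ)}
  have h1 : ∀ c, μ.real (E1 c) ≤ Real.exp (2 - s) := fun c => h.holders_le c.1 c.2.1 c.2.2
  have h2 : ∀ c, μ.real (E2 c) ≤ Real.exp (2 - s) := fun c => h.heavyPairs_le c.1 c.2.1 c.2.2
  have h3 : ∀ c, μ.real (E3 c) ≤ (q.size + 2) * Real.exp (2 - s) := by
    intro c
    by_cases hc : c.1.1 = c.1.2
    · have : E3 c = ∅ := Set.eq_empty_of_forall_notMem fun ω hω => hω.1 hc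
      rw [this, measureReal_empty]
      positivity
    · exact (measureReal_mono fun ω hω => hω.2).trans (h.lightPairs_le _ _ hc c.2.1 c.2.2 hs)
  have hsub : {ω | ¬ q.GoodSeed P ω s} ⊆ ((⋃ c, E1 c) ∪ ⋃ c, E2 c) ∪ ⋃ c, E3 c := by
    intro ω hω
    by_contra hcon
    simp only [Set.mem_union, Set.mem_iUnion, not_or, not_exists] at hcon
    obtain ⟨⟨hc1, hc2⟩, hc3⟩ := hcon
    refine hω ⟨fun X Y i => not_lt.1 (hc1 (X, Y, i)), fun X Y i => not_lt.1 (hc2 (X, Y, i)),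
      fun X Y hXY b b' => ?_⟩
    by_cases hb : b < P.cap ∧ b' < P.cap
    · have h4 := hc3 ((X, Y), ⟨b, hb.1⟩, ⟨b', hb.2⟩)
      refine le_trans (le_of_eq ?_) (not_lt.1 fun h5 => h4 ⟨hXY, h5⟩)
      simp only [Fin.ext_iff]
    · have h4 : ({a ∈ q.lightPairs P X Y | ((ω (X, a.2.1)).2 : ℕ) = b ∧
          ((ω (Y, a.2.2)).2 : ℕ) = b'} : Finset _) = ∅ :=
        filter_false_of_mem fun a _ hab => hb ⟨hab.1 ▸ Fin.is_lt _, hab.2 ▸ Fin.is_lt _⟩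
      rw [h4, card_empty, Nat.cast_zero]
      positivity
  have hcap2 : (P.cap : ℝ) ^ 2 ≤ 4 * p := by
    have := h.cap_le
    have h4 := h.lam_sq_le
    calc (P.cap : ℝ) ^ 2 ≤ (2 * P.lam) ^ 2 := by gcongr
      _ = 4 * P.lam ^ 2 := by ring
      _ ≤ 4 * p := by gcongr
  have hp1 := h.one_le_p
  have hps : (p : ℝ) ≤ q.size := by
    exact_mod_cast (Nat.le_self_pow (by norm_num) p).trans h.le_size
  calc μ.real {ω | ¬ q.GoodSeed P ω s}
      ≤ (∑ c, μ.real (E1 c) + ∑ c, μ.real (E2 c)) + ∑ c, μ.real (E3 c) := by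
        refine (measureReal_mono hsub).trans ((measureReal_union_le _ _).trans (add_le_add
          ((measureReal_union_le _ _).trans (add_le_add ?_ ?_)) ?_)) <;>
        exact measureReal_iUnion_fintype_le _
    _ ≤ (∑ _c : V × V × Fin p, Real.exp (2 - s) + ∑ _c : V × V × Fin p, Real.exp (2 - s)) +
          ∑ _c : (V × V) × Fin P.cap × Fin P.cap, (q.size + 2) * Real.exp (2 - s) := by
        gcongr with c _ c _ c _
        · exact h1 c
        · exact h2 c
        · exact h3 c
    -- The `14` below is `2 + 4 + 8`, from `p ≤ size`, `cap ^ 2 ≤ 4 * p` and `1 ≤ size`.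
    _ = Fintype.card V ^ 2 * (2 * p + P.cap ^ 2 * (q.size + 2)) * Real.exp (2 - s) := by
        simp only [sum_const, card_univ, Fintype.card_prod, Fintype.card_fin, nsmul_eq_mul]
        push_cast
        ring
    _ ≤ Fintype.card V ^ 2 * (14 * q.size ^ 2) * Real.exp (2 - s) := by
        gcongr
        have h5 : (P.cap : ℝ) ^ 2 * (q.size + 2) ≤ 4 * q.size * (q.size + 2) := by
          gcongr
          linarith
        nlinarith
    _ = _ := by ring

end Admissible

end Placement

end MPCJoin

namespace MPCJoin

open Finset

/-! ### Join queries as placements of pairs of values. -/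

section Holds

variable {att dom : Type} [DecidableEq att]

/-- The scheme of `t` consists of `X` and `Y`, and the values of these attributes are `x` and
`y`. -/
def Holds (t : Tuple att dom) (X Y : att) (x y : dom) : Prop :=
  X ≠ Y ∧ t.1 = {X, Y} ∧ ∃ (hX : X ∈ t.1) (hY : Y ∈ t.1), t.2 ⟨X, hX⟩ = x ∧ t.2 ⟨Y, hY⟩ = y

theorem Holds.symm {t : Tuple att dom} {X Y : att} {x y : dom} (h : Holds t X Y x y) :
    Holds t Y X y x := by
  obtain ⟨h1, h2, hX, hY, h3, h4⟩ := h
  exact ⟨h1.symm, by rw [h2, pair_comm], hY, hX, h4, h3⟩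

theorem Holds.unique {t t' : Tuple att dom} {X Y : att} {x y : dom} (h : Holds t X Y x y)
    (h' : Holds t' X Y x y) : t = t' := by
  obtain ⟨U, u⟩ := t
  obtain ⟨U', u'⟩ := t'
  obtain ⟨-, h2, hX, hY, h3, h4⟩ := h
  obtain ⟨-, h2', hX', hY', h3', h4'⟩ := h'
  obtain rfl : U = U' := h2.trans h2'.symm
  congr 1
  funext Z
  obtain ⟨Z, hZm⟩ := Z
  have hZ : Z = X ∨ Z = Y := by
    have h : Z ∈ U := hZm
    rw [show U = {X, Y} from h2] at h
    simpa using h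
  rcases hZ with rfl | rfl
  · exact h3.trans h3'.symm
  · exact h4.trans h4'.symm

theorem exists_holds {t : Tuple att dom} {X Y : att} (hXY : X ≠ Y) (h : t.1 = {X, Y}) :
    ∃ x y, Holds t X Y x y :=
  ⟨_, _, hXY, h, h ▸ mem_insert_self X _, h ▸ mem_insert_of_mem (mem_singleton_self Y), rfl, rfl⟩

end Holds

section Instances

variable {att dom : Type} [DecidableEq att]

namespace JoinQuery

variable {Q : JoinQuery att dom}

theorem attset_eq (Q : JoinQuery att dom) : Q.attset = Q.schemes.biUnion id := by
  rw [attset, schemes, image_biUnion]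
  rfl

theorem joinTuples_eq {U : Finset att} (hU : U = Q.attset) : Q.joinTuples =
    {t | ∃ u : U → dom, (∀ (R : Relation att dom) (hR : R ∈ Q),
      (fun X : R.scheme => u ⟨X.1, hU ▸ scheme_subset_attset hR X.2⟩) ∈ R.tuples) ∧
        t = ⟨U, u⟩} := by
  subst hU
  rfl

/-- Simplicity enters in the backward direction: the relation of a labelled input tuple is recovered
from its scheme. -/
theorem mem_tuples_iff (hs : Q.IsSimple) (hb : Q.IsBinary) (u : Q.schemes.biUnion id → dom) :
    (∀ (R : Relation att dom) (hR : R ∈ Q),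
      (fun X : R.scheme => u ⟨X.1, Q.attset_eq ▸ scheme_subset_attset hR X.2⟩) ∈ R.tuples) ↔
    ∀ X Y : Q.schemes.biUnion id, Adjacent Q.schemes X.1 Y.1 →
      ∃ t ∈ Q.inputTuples, Holds t X.1 Y.1 (u X) (u Y) := by
  constructor
  · rintro h X Y ⟨hXY, hE⟩
    obtain ⟨R, hR, hRs⟩ := mem_image.1 hE
    exact ⟨_, ⟨R, hR, _, h R hR, rfl⟩, hXY, hRs, by simp [hRs], by simp [hRs], rfl, rfl⟩
  · intro h R hR
    obtain ⟨a, b, hab, hRs⟩ := card_eq_two.1 (hb R hR)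
    have hE : {a, b} ∈ Q.schemes := mem_image.2 ⟨R, hR, hRs⟩
    have ha : a ∈ Q.schemes.biUnion id := mem_biUnion.2 ⟨_, hE, by simp⟩
    have hb : b ∈ Q.schemes.biUnion id := mem_biUnion.2 ⟨_, hE, by simp⟩
    obtain ⟨t, ⟨R', hR', v, hv, rfl⟩, hH⟩ := h ⟨a, ha⟩ ⟨b, hb⟩ ⟨hab, hE⟩
    obtain rfl : R' = R := hs _ hR' _ hR (hH.2.1.trans hRs.symm)
    have h1 : Holds ⟨R'.scheme, fun X : R'.scheme =>
        u ⟨X.1, Q.attset_eq ▸ scheme_subset_attset hR X.2⟩⟩ a b (u ⟨a, ha⟩) (u ⟨b, hb⟩) :=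
      ⟨hab, hRs, by simp [hRs], by simp [hRs], rfl, rfl⟩
    have h2 := hH.unique h1
    have h3 := eq_of_heq (Sigma.mk.inj h2).2
    rwa [← h3]

theorem joinTuples_eq_of_schemes {E : Finset (Finset att)} (hE : Q.schemes = E) (hs : Q.IsSimple)
    (hb : Q.IsBinary) : Q.joinTuples =
    {t | ∃ u : E.biUnion id → dom, (∀ X Y : E.biUnion id, Adjacent E X.1 Y.1 →
      ∃ t ∈ Q.inputTuples, Holds t X.1 Y.1 (u X) (u Y)) ∧ t = ⟨E.biUnion id, u⟩} := by
  subst hE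
  rw [joinTuples_eq Q.attset_eq.symm]
  simp only [mem_tuples_iff hs hb]

open Classical in
theorem exists_finset_inputTuples (hs : Q.IsSimple) :
    ∃ F : Finset (Tuple att dom), (∀ t, t ∈ F ↔ t ∈ Q.inputTuples) ∧ #F = Q.inputSize := by
  refine ⟨Q.biUnion fun R => R.tuples.image fun u => (⟨R.scheme, u⟩ : Tuple att dom),
    fun t => ?_, ?_⟩
  · simp only [mem_biUnion, mem_image, inputTuples, Set.mem_ofPred_eq, eq_comm]
  · rw [card_biUnion]
    · refine sum_congr rfl fun R _ => card_image_of_injective _ fun u v huv => ?_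
      exact eq_of_heq (Sigma.mk.inj huv).2
    · intro R hR S hS hRS
      refine disjoint_left.2 fun t ht ht' => hRS ?_
      obtain ⟨u, -, rfl⟩ := mem_image.1 ht
      obtain ⟨v, -, h⟩ := mem_image.1 ht'
      exact hs R hR S hS (Sigma.mk.inj h).1.symm

end JoinQuery

/-- A simple binary join with edge set `E` of size at least `p ^ 3`, with its distribution among
`p` machines. -/
structure JoinInstance (att dom : Type) [DecidableEq att] (E : Finset (Finset att)) (p : ℕ) where
  query : JoinQuery att dom
  place : Tuple att dom → Fin p
  simple : query.IsSimple
  binary : query.IsBinary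
  schemes_eq : query.schemes = E
  le_size : p ^ 3 ≤ query.inputSize

namespace JoinInstance

variable {E : Finset (Finset att)} {p : ℕ} (x : JoinInstance att dom E p)

/-- The initial storage of the machines. -/
def storage (i : Fin p) : Set (Tuple att dom) := initialStorage x.query x.place i

theorem storage_finite (i : Fin p) : (x.storage i).Finite := by
  obtain ⟨F, hF, -⟩ := JoinQuery.exists_finset_inputTuples x.simple
  exact (finite_toSet F).subset fun t ht => (hF t).2 ht.1

/-- The pairs of values of two attributes in the tuples of a finite set. -/
theorem finite_holds {I : Set (Tuple att dom)} (hI : I.Finite) (X Y : att) :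
    {a : dom × dom | ∃ t ∈ I, Holds t X Y a.1 a.2}.Finite := by
  classical
  rcases isEmpty_or_nonempty dom with hd | ⟨⟨d⟩⟩
  · exact Set.toFinite _
  refine (hI.image fun t => ((if h : X ∈ t.1 then t.2 ⟨X, h⟩ else d),
    (if h : Y ∈ t.1 then t.2 ⟨Y, h⟩ else d))).subset ?_
  rintro ⟨a, b⟩ ⟨t, ht, -, -, hX, hY, h1, h2⟩
  exact ⟨t, ht, by simp [hX, hY, h1, h2]⟩

/-- The tuples of the instance as pairs of values. -/
noncomputable def placement : Placement (E.biUnion id) dom p where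
  tup i X Y := (finite_holds (x.storage_finite i) X.1 Y.1).toFinset
  symm := by
    intro i X Y a b h
    obtain ⟨t, ht, h⟩ := (Set.Finite.mem_toFinset _).1 h
    exact (Set.Finite.mem_toFinset _).2 ⟨t, ht, h.symm⟩
  disj := by
    intro i j X Y a h h'
    obtain ⟨t, ht, h⟩ := (Set.Finite.mem_toFinset _).1 h
    obtain ⟨t', ht', h'⟩ := (Set.Finite.mem_toFinset _).1 h'
    obtain rfl := h.unique h'
    exact ht.2.symm.trans ht'.2
  ne := by
    intro i X Y a h hXY
    obtain ⟨t, -, h⟩ := (Set.Finite.mem_toFinset _).1 h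
    exact h.1 (congrArg Subtype.val hXY)

variable {x}

theorem mem_tup {i : Fin p} {X Y : E.biUnion id} {a b : dom} :
    (a, b) ∈ x.placement.tup i X Y ↔ ∃ t ∈ x.storage i, Holds t X.1 Y.1 a b :=
  Set.Finite.mem_toFinset _

theorem tup_eq {y : JoinInstance att dom E p} {i : Fin p} (h : x.storage i = y.storage i) :
    x.placement.tup i = y.placement.tup i := by
  ext X Y ⟨a, b⟩
  rw [mem_tup, mem_tup, h]

theorem mem_rel [DecidableEq dom] {X Y : E.biUnion id} {a b : dom} :
    (a, b) ∈ x.placement.rel X Y ↔ ∃ t ∈ x.query.inputTuples, Holds t X.1 Y.1 a b := by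
  simp only [Placement.mem_rel, mem_tup]
  constructor
  · rintro ⟨i, t, ht, h⟩
    exact ⟨t, ht.1, h⟩
  · rintro ⟨t, ht, h⟩
    exact ⟨x.place t, t, ⟨ht, rfl⟩, h⟩

theorem scheme_mem {t : Tuple att dom} (ht : t ∈ x.query.inputTuples) :
    t.1 ∈ E ∧ t.1.card = 2 := by
  obtain ⟨R, hR, u, -, rfl⟩ := ht
  exact ⟨x.schemes_eq ▸ mem_image_of_mem _ hR, x.binary R hR⟩

-- Double counting: a binary tuple appears under exactly the two orderings of its attributes.
open Classical in
theorem localSize_eq (i : Fin p) : x.placement.localSize i = 2 * (x.storage i).ncard := by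
  set I := (x.storage_finite i).toFinset with hI
  have h1 : ∀ X Y : E.biUnion id, #(x.placement.tup i X Y) =
      #{t ∈ I | X ≠ Y ∧ t.1 = {X.1, Y.1}} := by
    intro X Y
    symm
    have key : ∀ t ∈ ({t ∈ I | X ≠ Y ∧ t.1 = {X.1, Y.1}} : Finset (Tuple att dom)),
        ∃ a : dom × dom, Holds t X.1 Y.1 a.1 a.2 := by
      intro t ht
      obtain ⟨-, h2, h3⟩ := mem_filter.1 ht
      obtain ⟨a, b, h⟩ := exists_holds (fun h => h2 (Subtype.ext h)) h3
      exact ⟨(a, b), h⟩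
    choose f hf using key
    refine card_bij f (fun t ht => ?_) (fun t ht t' ht' h => ?_) fun a ha => ?_
    · exact mem_tup.2 ⟨t, (Set.Finite.mem_toFinset _).1 (mem_filter.1 ht).1, hf t ht⟩
    · have h2 := hf t' ht'
      rw [← h] at h2
      exact (hf t ht).unique h2
    · obtain ⟨t, ht, h⟩ := mem_tup.1 ha
      have h2 : t ∈ ({t ∈ I | X ≠ Y ∧ t.1 = {X.1, Y.1}} : Finset (Tuple att dom)) :=
        mem_filter.2 ⟨(Set.Finite.mem_toFinset _).2 ht, fun e => h.1 (congrArg _ e), h.2.1⟩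
      refine ⟨t, h2, ?_⟩
      obtain ⟨-, -, _, _, h3, h4⟩ := h
      obtain ⟨-, -, _, _, h5, h6⟩ := hf t h2
      exact Prod.ext (h5.symm.trans h3) (h6.symm.trans h4)
  have h2 : ∀ t ∈ I, #{c : E.biUnion id × E.biUnion id | c.1 ≠ c.2 ∧ t.1 = {c.1.1, c.2.1}} = 2 := by
    intro t ht
    obtain ⟨hE, h2⟩ := scheme_mem (x := x) ((Set.Finite.mem_toFinset _).1 ht).1
    obtain ⟨a, b, hab, hs⟩ := card_eq_two.1 h2
    have ha : a ∈ E.biUnion id := mem_biUnion.2 ⟨_, hE, by simp [hs]⟩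
    have hb : b ∈ E.biUnion id := mem_biUnion.2 ⟨_, hE, by simp [hs]⟩
    rw [card_eq_two]
    refine ⟨(⟨a, ha⟩, ⟨b, hb⟩), (⟨b, hb⟩, ⟨a, ha⟩), fun h => hab (by simpa using congrArg Prod.fst h),
      ?_⟩
    ext ⟨⟨X, hX⟩, ⟨Y, hY⟩⟩
    simp only [mem_filter, mem_univ, true_and, mem_insert, mem_singleton, Prod.mk.injEq,
      Subtype.mk.injEq, hs, ne_eq]
    constructor
    · rintro ⟨h3, h4⟩
      have h5 : X ∈ ({a, b} : Finset att) := h4 ▸ mem_insert_self X _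
      have h6 : Y ∈ ({a, b} : Finset att) := h4 ▸ mem_insert_of_mem (mem_singleton_self Y)
      simp only [mem_insert, mem_singleton] at h5 h6
      rcases h5 with rfl | rfl <;> rcases h6 with rfl | rfl <;> simp_all
    · rintro (⟨rfl, rfl⟩ | ⟨rfl, rfl⟩)
      · exact ⟨hab, rfl⟩
      · exact ⟨hab.symm, pair_comm _ _⟩
  calc x.placement.localSize i
      = ∑ c : E.biUnion id × E.biUnion id, #{t ∈ I | c.1 ≠ c.2 ∧ t.1 = {c.1.1, c.2.1}} := by
        rw [Fintype.sum_prod_type]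
        exact sum_congr rfl fun X _ => sum_congr rfl fun Y _ => h1 X Y
    _ = ∑ t ∈ I, #{c : E.biUnion id × E.biUnion id | c.1 ≠ c.2 ∧ t.1 = {c.1.1, c.2.1}} :=
        sum_card_bipartiteAbove_eq_sum_card_bipartiteBelow
          (fun (c : E.biUnion id × E.biUnion id) (t : Tuple att dom) =>
            c.1 ≠ c.2 ∧ t.1 = {c.1.1, c.2.1})
    _ = ∑ _t ∈ I, 2 := sum_congr rfl h2
    _ = 2 * (x.storage i).ncard := by
        rw [sum_const, smul_eq_mul, mul_comm, Set.ncard_eq_toFinset_card _ (x.storage_finite i)]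

open Classical in
theorem size_eq : x.placement.size = 2 * x.query.inputSize := by
  obtain ⟨F, hF, hc⟩ := JoinQuery.exists_finset_inputTuples x.simple
  rw [Placement.size, ← hc, card_eq_sum_card_fiberwise (f := x.place) (t := univ)
    fun _ _ => mem_univ _, mul_sum]
  refine sum_congr rfl fun i _ => ?_
  rw [localSize_eq, ← Set.ncard_coe_finset]
  congr 2
  ext t
  simp only [coe_filter, hF, Set.mem_ofPred_eq]
  rfl

theorem joinTuples_eq [DecidableEq dom] {P : Plan (E.biUnion id)}
    (hP : ∀ X Y, P.Adj X Y ↔ Adjacent E X.1 Y.1) :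
    x.query.joinTuples = {t | ∃ u ∈ x.placement.result P, t = ⟨E.biUnion id, u⟩} := by
  rw [JoinQuery.joinTuples_eq_of_schemes x.schemes_eq x.simple x.binary]
  simp only [Placement.result, mem_rel, hP]
  rfl

end JoinInstance

end Instances

end MPCJoin

namespace MPCJoin

open Finset

/-! ### The parameters for a given set of schemes. -/

section PlanOf

variable {att : Type} [DecidableEq att] {E : Finset (Finset att)}

open Classical in
theorem card_add_card_le_of_subtype (hE : ∀ e ∈ E, e.card = 2) (S : Finset (E.biUnion id)) :
    (Fintype.card (E.biUnion id) : ℝ) + #S ≤ 2 * fractionalEdgeCoveringNumber E +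
      #{Y : E.biUnion id | ∃ X ∈ S, Adjacent E X.1 Y.1} := by
  have h := card_add_card_le_rho hE (S := S.map (Function.Embedding.subtype _)) fun X hX => by
    obtain ⟨Y, -, rfl⟩ := mem_map.1 hX
    exact Y.2
  have h1 : ({Y ∈ E.biUnion id | ∃ X ∈ S.map (Function.Embedding.subtype _), Adjacent E X Y} :
      Finset att) = ({Y : E.biUnion id | ∃ X ∈ S, Adjacent E X.1 Y.1} : Finset _).map
        (Function.Embedding.subtype _) := by
    ext Y
    simp only [mem_filter, mem_map, mem_univ, true_and]
    constructor
    · rintro ⟨hY, _, ⟨X, hX, rfl⟩, hXY⟩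
      exact ⟨⟨Y, hY⟩, ⟨X, hX, hXY⟩, rfl⟩
    · rintro ⟨Y, ⟨X, hX, hXY⟩, rfl⟩
      exact ⟨Y.2, X, ⟨X, hX, rfl⟩, hXY⟩
  rw [h1, card_map, card_map] at h
  rwa [Fintype.card_coe]

/-- The plan for the join with edge set `E` on `p` machines. -/
theorem exists_plan (hE : ∀ e ∈ E, e.card = 2) (hne : E.Nonempty) {p : ℕ} (hp : 1 ≤ p) :
    ∃ P : Plan (E.biUnion id), (∀ X Y, P.Adj X Y ↔ Adjacent E X.1 Y.1) ∧
      P.lam ^ 2 = (p : ℝ) ^ (1 / fractionalEdgeCoveringNumber E) ∧ 0 < P.cap ∧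
      ∀ (dom : Type) (q : Placement (E.biUnion id) dom p), p ^ 3 ≤ q.size → q.Admissible P := by
  classical
  set ρ := fractionalEdgeCoveringNumber E with hρ
  set n := Fintype.card (E.biUnion id) with hn
  have hr := card_add_card_le_of_subtype hE
  have hnρ : (n : ℝ) ≤ 2 * ρ := by
    rw [hn, Fintype.card_coe]
    simpa using hr ∅
  have hadj : ∀ X : E.biUnion id, ∃ Y : E.biUnion id, Adjacent E X.1 Y.1 := fun X => by
    obtain ⟨Y, hY, h⟩ := exists_adjacent hE X.2
    exact ⟨⟨Y, hY⟩, h⟩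
  have hn2 : 2 ≤ n := by
    obtain ⟨e, he⟩ := hne
    rw [hn, Fintype.card_coe, ← hE e he]
    exact card_le_card (subset_biUnion_of_mem id he)
  have hρ1 : 1 ≤ ρ := by
    have : (2 : ℝ) ≤ n := by exact_mod_cast hn2
    linarith
  have hρ0 : 0 < ρ := by linarith
  have hp1 : (1 : ℝ) ≤ p := by exact_mod_cast hp
  have hp0 : (0 : ℝ) ≤ p := by linarith
  -- Hosts are fixed for every `U` from the schemes alone, before any input is seen.
  choose σ hσ hσc using fun U : Finset (E.biUnion id) =>
    exists_host (Adj := fun X Y : E.biUnion id => Adjacent E X.1 Y.1) hr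
      ({X | X ∉ U ∧ ∀ Y : E.biUnion id, Adjacent E X.1 Y.1 → Y ∈ U} : Finset (E.biUnion id))
      fun X _ => hadj X
  -- Then `l ^ (2 * ρ) = p`. The bounds `l ^ 2 ≤ p` and, for three attributes, `l ^ 3 ≤ p` follow
  -- from `n ≤ 2 * ρ`, the duality bound for `S = ∅`.
  set l : ℝ := (p : ℝ) ^ (1 / (2 * ρ)) with hl
  have hl1 : 1 ≤ l := Real.one_le_rpow hp1 (by positivity)
  have hlpow : ∀ m : ℕ, l ^ m = (p : ℝ) ^ (m / (2 * ρ)) := fun m => by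
    rw [hl, ← Real.rpow_natCast, ← Real.rpow_mul hp0]
    congr 1
    ring
  have hlple : ∀ m : ℕ, (m : ℝ) ≤ 2 * ρ → l ^ m ≤ p := fun m hm => by
    rw [hlpow]
    calc (p : ℝ) ^ (m / (2 * ρ)) ≤ (p : ℝ) ^ (1 : ℝ) :=
          Real.rpow_le_rpow_of_exponent_le hp1 ((div_le_one (by positivity)).2 hm)
      _ = p := Real.rpow_one _
  let P : Plan (E.biUnion id) := ⟨fun X Y => Adjacent E X.1 Y.1, l, ⌈l⌉₊, σ⟩
  have hI : ∀ U, P.isolated U =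
      ({X | X ∉ U ∧ ∀ Y : E.biUnion id, Adjacent E X.1 Y.1 → Y ∈ U} : Finset (E.biUnion id)) := by
    intro U
    ext X
    simp only [Plan.mem_isolated, mem_filter, mem_univ, true_and]
    rfl
  refine ⟨P, fun _ _ => Iff.rfl, ?_, Nat.ceil_pos.2 (by linarith), fun dom q hq => ?_⟩
  · have h1 : P.lam = l := rfl
    rw [h1, hlpow]
    congr 1
    field_simp
    norm_num
  · refine ⟨⟨fun _ _ h => h.symm, fun X Y h hXY => h.1 (congrArg _ hXY), fun U X hX => ?_⟩, hl1,
      hlple 2 (by push_cast; linarith), fun h3 => hlple 3 ?_, Nat.le_ceil l, ?_, hq,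
      2 * ρ, ?_, fun U => ?_⟩
    · exact hσ U X (hI U ▸ Plan.mem_isolated.2 hX)
    · have : ((3 : ℕ) : ℝ) ≤ n := by exact_mod_cast h3
      linarith
    · have := (Nat.ceil_lt_add_one (by linarith : 0 ≤ l)).le
      change ((⌈l⌉₊ : ℕ) : ℝ) ≤ 2 * l
      linarith
    · change l ^ (2 * ρ) = p
      rw [hl, ← Real.rpow_mul hp0, one_div_mul_cancel (by positivity), Real.rpow_one]
    · rw [hI U]
      convert! hσc U

end PlanOf

namespace Placement

variable {V dom : Type} {p : ℕ} [Fintype V] [DecidableEq V] [DecidableEq dom]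
  {q : Placement V dom p} {P : Plan V}

/-- Every seed is good for a very large factor. -/
theorem Admissible.goodSeed (h : q.Admissible P) (ω : Seed V dom p P.cap) :
    q.GoodSeed P ω q.size := by
  have hs : (1 : ℝ) ≤ q.size := by exact_mod_cast h.size_pos
  have key : ∀ {n : ℕ} {W : ℝ}, n ≤ q.size → 1 ≤ W → (n : ℝ) ≤ q.size * W := fun hn hW =>
    (Nat.cast_le.2 hn).trans (le_mul_of_one_le_right (by linarith) hW)
  have hsp : (1 : ℝ) ≤ q.size / p := h.one_le_p.trans h.p_le_size_div_p
  refine ⟨fun X Y i => key ?_ ?_, fun Z X i => key ?_ ?_, fun X Y _ b b' => key ?_ ?_⟩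
  · exact (card_filter_le _ _).trans (card_image_le.trans (card_placed_le_size X Y))
  · exact one_le_mul_of_one_le_of_one_le (h.card_pos_of_mem X) hsp
  · exact (card_filter_le _ _).trans ((card_filter_le _ _).trans (card_placed_le_size Z X))
  · exact one_le_mul_of_one_le_of_one_le (h.card_pos_of_mem X) hsp
  · exact (card_filter_le _ _).trans ((card_filter_le _ _).trans (card_placed_le_size X Y))
  · exact one_le_mul_of_one_le_of_one_le hs h.one_le_W

/-- Finiteness is needed for every seed and distribution, so the load bound is applied with the
trivial factors `s = size` and `B = p`. -/
theorem Admissible.records_finite [Nonempty dom] (h : q.Admissible P) (ω : Seed V dom p P.cap)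
    {t : ℕ} (ht : t < 5) (j i : Fin p) : (q.records P ω t j i).Finite := by
  have hs : (1 : ℝ) ≤ q.size := by exact_mod_cast h.size_pos
  have hp : (0 : ℝ) < p := by exact_mod_cast h.p_pos
  refine (h.records_le (h.goodSeed ω) hs (B := p) hp.le (fun i => ?_) ht i).1 j
  rw [mul_div_cancel₀ _ hp.ne']
  exact_mod_cast single_le_sum (f := q.localSize) (fun _ _ => Nat.zero_le _) (mem_univ i)

end Placement

/-! ### The algorithm and its load in words. -/

section Algorithm

variable {att dom : Type} [DecidableEq att] {E : Finset (Finset att)} {p : ℕ}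
  {P : Plan (E.biUnion id)}

/-- What a machine has received consists of the values in its inboxes. -/
theorem known_subset_storedValues [DecidableEq dom] [Nonempty dom] (x : JoinInstance att dom E p)
    (hx : x.placement.Admissible P) (ω : Placement.Seed (E.biUnion id) dom p P.cap) (j : Fin p)
    {t : ℕ} (ht : t ≤ 5) :
    x.placement.known P ω j t ⊆ storedValues (x.storage j)
      (transcriptHistory (fun (x : JoinInstance att dom E p) ω t j i =>
        Rec.encode (x.placement.records P ω t j i)) x ω t j) := by
  rintro a (⟨X, Y, b, h⟩ | ⟨t', ht', j', r, hr, ha⟩)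
  · obtain ⟨t, ht, -, -, hX, -, rfl, -⟩ := JoinInstance.mem_tup.1 h
    exact Or.inl ⟨t, ht, ⟨X.1, hX⟩, rfl⟩
  · refine Or.inr ⟨_, List.mem_map.2 ⟨t', List.mem_range.2 ht', rfl⟩, j', ?_⟩
    exact (Rec.mem_encode (hx.records_finite ω (by omega) j' j)).2 ⟨r, hr, Rec.val_mem_words.2 ha⟩

theorem sameView_of_encode_eq [DecidableEq dom] [Nonempty dom] {x y : JoinInstance att dom E p}
    (hx : x.placement.Admissible P) (hy : y.placement.Admissible P)
    {ω : Placement.Seed (E.biUnion id) dom p P.cap} {j : Fin p} {t : ℕ} (ht : t ≤ 5)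
    (hxy : x.storage j = y.storage j)
    (h : ∀ t' < t, ∀ j', Rec.encode (x.placement.records P ω t' j' j) =
      Rec.encode (y.placement.records P ω t' j' j)) :
    Placement.SameView P ω x.placement y.placement j t :=
  ⟨JoinInstance.tup_eq hxy, fun t' ht' j' => Rec.encode_injective
    (hx.records_finite ω (by omega) j' j) (hy.records_finite ω (by omega) j' j) (h t' ht' j')⟩

/-- The transcript of the join algorithm. -/
noncomputable def joinTranscript [DecidableEq dom] [Nonempty dom]
    (hP : ∀ x : JoinInstance att dom E p, x.placement.Admissible P) :
    Transcript (JoinInstance att dom E p) att dom (Placement.Seed (E.biUnion id) dom p P.cap) p where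
  init x := x.storage
  rounds := 5
  msg x ω t j i := Rec.encode (x.placement.records P ω t j i)
  out x ω i := {t | ∃ u ∈ x.placement.output P ω i, t = ⟨E.biUnion id, u⟩}
  msg_local x y ω t j ht hxy h i := by
    rw [(sameView_of_encode_eq (hP x) (hP y) ht.le hxy h).records_eq ht i]
  out_local x y ω j hxy h := by
    rw [(sameView_of_encode_eq (hP x) (hP y) le_rfl hxy h).output_eq (hP x).valid.1]
  msg_stored x ω t j i a ht ha := by
    obtain ⟨r, hr, ha⟩ := (Rec.mem_encode ((hP x).records_finite ω ht j i)).1 ha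
    exact known_subset_storedValues x (hP x) ω j ht.le
      (Placement.vals_known (hP x).valid ht hr (Rec.val_mem_words.1 ha))
  out_stored x ω j t ht X := by
    obtain ⟨u, hu, rfl⟩ := ht
    exact known_subset_storedValues x (hP x) ω j le_rfl
      (Placement.output_known (hP x).valid hu X)

/-- The transcript of the trivial algorithm for one machine. -/
noncomputable def localTranscript (hE : ∀ e ∈ E, e.card = 2) :
    Transcript (JoinInstance att dom E 1) att dom Unit 1 where
  init x := x.storage
  rounds := 0
  msg _ _ _ _ _ := []
  out x _ _ := x.query.joinTuples
  msg_local _ _ _ _ _ ht := absurd ht (Nat.not_lt_zero _)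
  out_local x y ω j hxy _ := by
    have h : ∀ x : JoinInstance att dom E 1, x.query.inputTuples = x.storage j := fun x => by
      ext t
      exact ⟨fun ht => ⟨ht, Subsingleton.elim _ _⟩, fun ht => ht.1⟩
    rw [JoinQuery.joinTuples_eq_of_schemes x.schemes_eq x.simple x.binary,
      JoinQuery.joinTuples_eq_of_schemes y.schemes_eq y.simple y.binary, h x, h y, hxy]
  msg_stored _ _ _ _ _ _ ht := absurd ht (Nat.not_lt_zero _)
  out_stored x ω j t ht X := by
    rw [JoinQuery.joinTuples_eq_of_schemes x.schemes_eq x.simple x.binary] at ht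
    obtain ⟨u, hu, rfl⟩ := ht
    obtain ⟨Y, hY, hXY⟩ := exists_adjacent hE X.2
    obtain ⟨t, ht, -, -, hX, -, h, -⟩ := hu X ⟨Y, hY⟩ hXY
    exact Or.inl ⟨t, ⟨ht, Subsingleton.elim _ _⟩, ⟨X.1, hX⟩, h⟩

end Algorithm

/-- A constant in the bound on the integers that are sent. -/
def wordConstant (k : ℕ) : ℕ := 2 ^ k * (k + 2) ^ k * 2 + k ^ 2

theorem wordConstant_mono {n k : ℕ} (h : n ≤ k) : wordConstant n ≤ wordConstant k := by
  unfold wordConstant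
  have h2 : (n + 2) ^ n ≤ (k + 2) ^ k :=
    (Nat.pow_le_pow_left (by omega) n).trans (Nat.pow_le_pow_right (by omega) h)
  gcongr
  norm_num

theorem loadConstant_mono {n k : ℕ} (h : n ≤ k) {B : ℝ} (hB : 0 ≤ B) :
    loadConstant n B ≤ loadConstant k B := by
  unfold loadConstant
  have h2 : ((n : ℝ) + 2) ^ n ≤ ((k : ℝ) + 2) ^ k := by
    exact_mod_cast (Nat.pow_le_pow_left (by omega) n).trans
      (Nat.pow_le_pow_right (by omega : 0 < k + 2) h)
  gcongr
  norm_num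

section Bounds

variable {att dom : Type} [DecidableEq att] [DecidableEq dom] [Nonempty dom]
  {E : Finset (Finset att)} {p : ℕ} {P : Plan (E.biUnion id)}
  {x : JoinInstance att dom E p}

/-- Since `2 ≤ m`, a constant factor is at most `m` to the power of that constant; this is why `p =
1` is treated separately. -/
theorem num_le_of_mem_encode (hx : x.placement.Admissible P) (hp : 2 ≤ p) {k : ℕ}
    (hk : (E.biUnion id).card ≤ k) {ω : Placement.Seed (E.biUnion id) dom p P.cap} {t : ℕ}
    (ht : t < 5) {j i : Fin p} {n : ℕ}
    (hn : Word.num n ∈ Rec.encode (x.placement.records P ω t j i)) :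
    n ≤ x.query.inputSize ^ (wordConstant k + 1) := by
  set m := x.query.inputSize
  have hm : 2 ≤ m := hp.trans ((Nat.le_self_pow (by norm_num) p).trans x.le_size)
  obtain ⟨r, hr, hn⟩ := (Rec.mem_encode (hx.records_finite ω ht j i)).1 hn
  set c := Fintype.card (E.biUnion id) with hc
  have hck : c ≤ k := by rwa [hc, Fintype.card_coe]
  have h1 : n ≤ wordConstant c * m := by
    unfold wordConstant
    rcases Rec.num_mem_words hn with h | h
    · have := hx.num_le ht hr
      rw [JoinInstance.size_eq] at this
      calc n ≤ 2 ^ c * (c + 2) ^ c * (2 * m) := h.trans this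
        _ = (2 ^ c * (c + 2) ^ c * 2) * m := by ring
        _ ≤ _ := Nat.mul_le_mul_right _ (Nat.le_add_right _ _)
    · calc n ≤ c ^ 2 * 1 := by rw [mul_one]; exact h
        _ ≤ _ := Nat.mul_le_mul (Nat.le_add_left _ _) (by omega)
  calc n ≤ wordConstant c * m := h1
    _ ≤ wordConstant k * m := Nat.mul_le_mul_right _ (wordConstant_mono hck)
    _ ≤ m ^ wordConstant k * m := Nat.mul_le_mul_right _
        ((Nat.lt_two_pow_self).le.trans (Nat.pow_le_pow_left hm _))
    _ = m ^ (wordConstant k + 1) := (pow_succ _ _).symm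

/-- The `8` is four words per record times two, as the placement counts each tuple in both orders.
-/
theorem sum_length_encode_le (hx : x.placement.Admissible P) {k : ℕ}
    (hk : (E.biUnion id).card ≤ k) {ω : Placement.Seed (E.biUnion id) dom p P.cap} {s B : ℝ}
    (hω : x.placement.GoodSeed P ω s) (hs : 1 ≤ s) (hB : 0 ≤ B)
    (hd : EvenlyDistributed B x.query x.place) {t : ℕ} (ht : t < 5) (i : Fin p) :
    ((∑ j, (Rec.encode (x.placement.records P ω t j i)).length : ℕ) : ℝ) ≤
      8 * loadConstant k B * s ^ 2 * (x.query.inputSize / P.lam ^ 2) := by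
  have hlocal : ∀ i, (x.placement.localSize i : ℝ) ≤ B * (x.placement.size / p) := by
    intro i
    rw [JoinInstance.localSize_eq, JoinInstance.size_eq]
    push_cast
    calc 2 * ((x.storage i).ncard : ℝ) ≤ 2 * (B * x.query.inputSize / p) := by
          gcongr
          exact hd i
      _ = B * (2 * x.query.inputSize / p) := by ring
  obtain ⟨hfin, hle⟩ := hx.records_le hω hs hB hlocal ht i
  have hck : Fintype.card (E.biUnion id) ≤ k := by rwa [Fintype.card_coe]
  have h1 : ∀ j, (Rec.encode (x.placement.records P ω t j i)).length =
      4 * (x.placement.records P ω t j i).ncard := fun j => Rec.length_encode (hfin j)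
  simp only [h1]
  rw [JoinInstance.size_eq] at hle
  push_cast at hle ⊢
  rw [← mul_sum]
  calc _ ≤ 4 * (loadConstant (Fintype.card (E.biUnion id)) B * s ^ 2 *
        (2 * x.query.inputSize / P.lam ^ 2)) := by gcongr
    _ ≤ 4 * (loadConstant k B * s ^ 2 * (2 * x.query.inputSize / P.lam ^ 2)) := by
        gcongr
        exact loadConstant_mono hck hB
    _ = _ := by ring

end Bounds

/-- The choice of the factor `s` for a given failure probability. -/
theorem mul_exp_le_rpow {D c m p : ℝ} (hD : 0 ≤ D) (hc : 0 ≤ c) (hm : 1 ≤ m) (hp : 1 ≤ p) :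
    D * m ^ 2 * Real.exp (2 - (4 + c + Real.log (D + 1)) * (1 + Real.log m + Real.log p)) ≤
      p ^ (-c) := by
  have h1 := Real.log_nonneg hm
  have h2 := Real.log_nonneg hp
  have h3 : 0 ≤ Real.log (D + 1) := Real.log_nonneg (by linarith)
  have hm0 : 0 < m := by linarith
  have hp0 : 0 < p := by linarith
  calc D * m ^ 2 * Real.exp (2 - (4 + c + Real.log (D + 1)) * (1 + Real.log m + Real.log p))
      ≤ (D + 1) * m ^ 2 *
        Real.exp (2 - (4 + c + Real.log (D + 1)) * (1 + Real.log m + Real.log p)) := by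
        gcongr
        linarith
    _ = Real.exp (Real.log (D + 1) + 2 * Real.log m +
        (2 - (4 + c + Real.log (D + 1)) * (1 + Real.log m + Real.log p))) := by
        rw [Real.exp_add, Real.exp_add, Real.exp_log (by linarith),
          show 2 * Real.log m = Real.log (m ^ 2) by rw [Real.log_pow]; norm_num,
          Real.exp_log (by positivity)]
    _ ≤ Real.exp (Real.log p * -c) := by
        rw [Real.exp_le_exp]
        -- In the product defining `s`, the summand `4` pays for `m ^ 2` and the `2` in the
        -- exponent, `log (D + 1)` for `D`, and `c` leaves `p ^ (-c)`.
        nlinarith [mul_nonneg hc h1, mul_nonneg h3 h1, mul_nonneg h3 h2]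
    _ = p ^ (-c) := (Real.rpow_def_of_pos hp0 _).symm

end MPCJoin

namespace MPCJoin

open Finset

/-! ### Assembly. -/

section Main

variable {att dom : Type} [DecidableEq att] {E : Finset (Finset att)} {p k : ℕ}

/-- A single machine stores the whole input and can answer without communication, which also covers
`m = 1`, where powers of `m` bound no constant. -/
theorem exists_algorithm_one [Nonempty dom] (hE : ∀ e ∈ E, e.card = 2) (w d : ℕ) {c C : ℝ}
    (hC : 0 ≤ C) : ∃ A : MPCAlgorithm att dom 1, A.rounds ≤ 5 ∧ ∀ x : JoinInstance att dom E 1,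
      (∀ ω : A.Seed, A.produced x.storage ω = x.query.joinTuples) ∧
      (∀ ω : A.Seed, A.WordsBounded x.storage ω (x.query.inputSize ^ w)) ∧
      A.law {ω | C * (1 + Real.log x.query.inputSize + Real.log (1 : ℕ)) ^ d *
            ((x.query.inputSize : ℝ) / ((1 : ℕ) : ℝ) ^ (1 / x.query.rho))
          < (A.load x.storage ω : ℝ)} ≤ ENNReal.ofReal (((1 : ℕ) : ℝ) ^ (-c)) := by
  let T := localTranscript (dom := dom) hE
  refine ⟨T.algorithm (Measure.dirac ()), Nat.zero_le _, fun x => ⟨fun ω => ?_, fun ω t ht => ?_, ?_⟩⟩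
  · refine (T.algorithm_produced (Measure.dirac ()) x ω).trans ?_
    exact Set.iUnion_const _
  · exact absurd ht (Nat.not_lt_zero _)
  · refine le_trans (measure_mono_null (t := ∅) ?_ measure_empty).le bot_le
    intro ω hω
    have h0 : (T.algorithm (Measure.dirac ())).load x.storage ω = 0 := rfl
    rw [Set.mem_ofPred_eq, h0, Nat.cast_zero] at hω
    have := Real.log_natCast_nonneg x.query.inputSize
    have := Real.log_natCast_nonneg 1
    exact absurd hω (not_lt.2 (by positivity))

theorem exists_algorithm [Nonempty dom] (hE : ∀ e ∈ E, e.card = 2) (hne : E.Nonempty)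
    (hp : 2 ≤ p) (hk : (E.biUnion id).card ≤ k) {c B D C : ℝ} (hc : 0 ≤ c) (hB : 0 ≤ B)
    (hD : D = 56 * k ^ 2) (hC : C = 40 * loadConstant k B * (4 + c + Real.log (D + 1)) ^ 2) :
    ∃ A : MPCAlgorithm att dom p, A.rounds ≤ 5 ∧ ∀ x : JoinInstance att dom E p,
      EvenlyDistributed B x.query x.place →
      (∀ ω : A.Seed, A.produced x.storage ω = x.query.joinTuples) ∧
      (∀ ω : A.Seed, A.WordsBounded x.storage ω (x.query.inputSize ^ (wordConstant k + 1))) ∧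
      A.law {ω | C * (1 + Real.log x.query.inputSize + Real.log p) ^ 2 *
            ((x.query.inputSize : ℝ) / (p : ℝ) ^ (1 / x.query.rho))
          < (A.load x.storage ω : ℝ)} ≤ ENNReal.ofReal ((p : ℝ) ^ (-c)) := by
  classical
  obtain ⟨P, hadj, hlam, hcap, hadm⟩ := exists_plan hE hne (one_le_two.trans hp)
  have hP : ∀ x : JoinInstance att dom E p, x.placement.Admissible P := fun x => by
    refine hadm dom x.placement (x.le_size.trans ?_)
    rw [JoinInstance.size_eq]
    omega
  have : NeZero p := ⟨by omega⟩
  have : NeZero P.cap := ⟨hcap.ne'⟩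
  let T := joinTranscript hP
  let law := seedLaw (E.biUnion id × dom) p P.cap
  refine ⟨T.algorithm law, le_rfl, fun x hd => ⟨fun ω => ?_, fun ω t ht i j n hn => ?_, ?_⟩⟩
  · rw [JoinInstance.joinTuples_eq hadj, ← Placement.iUnion_output (ω := ω) hcap (by omega)]
    refine (T.algorithm_produced law x ω).trans ?_
    ext t
    simp only [Set.mem_iUnion, Set.mem_ofPred_eq, T, joinTranscript]
    exact ⟨fun ⟨i, u, hu, h⟩ => ⟨u, ⟨i, hu⟩, h⟩, fun ⟨u, ⟨i, hu⟩, h⟩ => ⟨i, u, hu, h⟩⟩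
  · have hn' : Word.num n ∈ T.msg x ω t j i := T.algorithm_message law (q := x) (ω := ω) ht j i ▸ hn
    exact num_le_of_mem_encode (hP x) hp hk ht hn'
  · set m := x.query.inputSize with hm
    have hm1 : (1 : ℝ) ≤ m := by
      exact_mod_cast (Nat.one_le_pow 3 p (by omega)).trans x.le_size
    have hp1 : (1 : ℝ) ≤ p := by exact_mod_cast one_le_two.trans hp
    have hlm := Real.log_nonneg hm1
    have hlp := Real.log_nonneg hp1
    have hD0 : 0 ≤ D := by rw [hD]; positivity
    have hlD : 0 ≤ Real.log (D + 1) := Real.log_nonneg (by linarith)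
    set s : ℝ := (4 + c + Real.log (D + 1)) * (1 + Real.log m + Real.log p) with hs
    have hs1 : 1 ≤ s := one_le_mul_of_one_le_of_one_le (by linarith) (by linarith)
    -- On good seeds the load bound holds, so only bad seeds can exceed it.
    have hsub : {ω | C * (1 + Real.log m + Real.log p) ^ 2 *
          ((m : ℝ) / (p : ℝ) ^ (1 / x.query.rho)) <
        ((T.algorithm law).load x.storage ω : ℝ)} ⊆ {ω | ¬ x.placement.GoodSeed P ω s} := by
      intro ω hω hgood
      rw [Set.mem_ofPred_eq] at hω
      refine absurd hω (not_lt.2 ?_)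
      set R : ℝ := 8 * loadConstant k B * s ^ 2 * (m / P.lam ^ 2) with hR
      have hR0 : 0 ≤ R := by
        have := loadConstant_nonneg (k := k) hB
        positivity
      have h1 : (T.algorithm law).load x.storage ω ≤ ∑ _t ∈ range T.rounds, ⌊R⌋₊ :=
        T.algorithm_load_le law (q := x) (ω := ω) (N := fun _ => ⌊R⌋₊) fun t ht i =>
          Nat.le_floor (sum_length_encode_le (hP x) hk hgood hs1 hB hd ht i)
      have h2 : T.rounds = 5 := rfl
      rw [sum_const, card_range, h2, smul_eq_mul] at h1
      calc ((T.algorithm law).load x.storage ω : ℝ) ≤ ((5 * ⌊R⌋₊ : ℕ) : ℝ) := Nat.cast_le.2 h1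
        _ ≤ 5 * R := by
            push_cast
            gcongr
            exact Nat.floor_le hR0
        _ = C * (1 + Real.log m + Real.log p) ^ 2 * ((m : ℝ) / (p : ℝ) ^ (1 / x.query.rho)) := by
            rw [hR, hlam, hC, hs, JoinQuery.rho, x.schemes_eq]
            ring
    calc (T.algorithm law).law {ω | C * (1 + Real.log m + Real.log p) ^ 2 *
          ((m : ℝ) / (p : ℝ) ^ (1 / x.query.rho)) < ((T.algorithm law).load x.storage ω : ℝ)}
        ≤ law {ω | ¬ x.placement.GoodSeed P ω s} := measure_mono hsub
      _ = ENNReal.ofReal (law.real {ω | ¬ x.placement.GoodSeed P ω s}) := by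
          rw [ofReal_measureReal]
      _ ≤ ENNReal.ofReal ((p : ℝ) ^ (-c)) := by
          refine ENNReal.ofReal_le_ofReal (((hP x).not_goodSeed_le (by linarith)).trans ?_)
          refine le_trans ?_ (mul_exp_le_rpow hD0 hc hm1 hp1)
          rw [JoinInstance.size_eq, Fintype.card_coe, hD, ← hm]
          push_cast
          calc 14 * ((E.biUnion id).card : ℝ) ^ 2 * (2 * m) ^ 2 * Real.exp (2 - s)
              ≤ 14 * (k : ℝ) ^ 2 * (2 * m) ^ 2 * Real.exp (2 - s) := by gcongr
            _ = 56 * k ^ 2 * m ^ 2 * Real.exp (2 - s) := by ring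
            _ = _ := by rw [hs, hD]

end Main

end MPCJoin

theorem mainTheorem4 (k : ℕ) :
    ∃ r w d : ℕ, ∀ c B : ℝ, 0 < c → 0 < B → ∃ C : ℝ, 0 < C ∧
      ∀ (att dom : Type) [DecidableEq att] [Countable dom] [Infinite dom]
        (E : Finset (Finset att)) (p : ℕ), (E.biUnion id).card ≤ k → 1 ≤ p →
        ∃ A : MPCAlgorithm att dom p, A.rounds ≤ r ∧
          ∀ Q : JoinQuery att dom, Q.IsSimple → Q.IsBinary → Q.schemes = E →
            p ^ 3 ≤ Q.inputSize →
            ∀ place : Tuple att dom → Fin p, EvenlyDistributed B Q place →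
              (∀ ω : A.Seed, A.produced (initialStorage Q place) ω = Q.joinTuples) ∧
              (∀ ω : A.Seed, A.WordsBounded (initialStorage Q place) ω (Q.inputSize ^ w)) ∧
              A.law {ω | C * (1 + Real.log Q.inputSize + Real.log p) ^ d *
                    ((Q.inputSize : ℝ) / (p : ℝ) ^ (1 / Q.rho))
                  < (A.load (initialStorage Q place) ω : ℝ)}
                ≤ ENNReal.ofReal ((p : ℝ) ^ (-c)) := by
  refine ⟨5, wordConstant k + 1, 2, fun c B hc hB => ?_⟩
  set D : ℝ := 56 * (k : ℝ) ^ 2 with hD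
  have hlD : 0 ≤ Real.log (D + 1) := Real.log_nonneg (by rw [hD]; nlinarith [sq_nonneg (k : ℝ)])
  have hL : 0 < loadConstant k B := by unfold loadConstant; positivity
  -- Five rounds times the factor `8` from encoding; the square comes from `s ^ 2`, one `s` for each
  -- of the two hashings of a light pair.
  refine ⟨40 * loadConstant k B * (4 + c + Real.log (D + 1)) ^ 2, by positivity, ?_⟩
  intro att dom _ _ _ E p hk hp
  by_cases hE : (∀ e ∈ E, e.card = 2) ∧ E.Nonempty
  · rcases hp.eq_or_lt with rfl | hp2
    · obtain ⟨A, hr, hA⟩ := exists_algorithm_one (dom := dom) hE.1 (wordConstant k + 1) 2 (c := c)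
        (C := 40 * loadConstant k B * (4 + c + Real.log (D + 1)) ^ 2) (by positivity)
      exact ⟨A, hr, fun Q hs hb hQ hm place _ => hA ⟨Q, place, hs, hb, hQ, hm⟩⟩
    · obtain ⟨A, hr, hA⟩ := exists_algorithm (dom := dom) hE.1 hE.2 hp2 hk hc.le hB.le hD rfl
      exact ⟨A, hr, fun Q hs hb hQ hm place hd => hA ⟨Q, place, hs, hb, hQ, hm⟩ hd⟩
  -- No query qualifies: either some scheme is not binary, or there are no relations and the input
  -- size `0` is below `p ^ 3`.
  · refine ⟨⟨Unit, Measure.dirac (), 0, fun _ _ _ _ _ => [], fun _ _ _ _ => ∅, by simp, by simp⟩,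
      Nat.zero_le _, fun Q _ hb hQ hm => absurd ⟨fun e he => ?_, ?_⟩ hE⟩
    · rw [← hQ] at he
      obtain ⟨R, hR, rfl⟩ := Finset.mem_image.1 he
      exact hb R hR
    · rw [Finset.nonempty_iff_ne_empty, ← hQ]
      intro h
      have hQ0 : Q = ∅ := Finset.image_eq_empty.1 h
      have h1 : Q.inputSize = 0 := by simp [hQ0, JoinQuery.inputSize]
      have h2 : 0 < p ^ 3 := pow_pos hp 3
      omega
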